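/- Let $\mathcal M=\mathbb R$ or $\mathcal M=\mathbb T=\mathbb R/\mathbb Z$, let $k\ge 2$ be an integer, $s<0$ and $\theta\in\mathbb R$, and let $u_0,u_1\in H^s(\mathcal M)$ be complex-valued, where $\|f\|_{H^s}=\|(1+|\xi|^2)^{s/2}\widehat f(\xi)\|_{L^2_\xi}$ with $\xi\in\mathbb R$, respectively $\xi\in\mathbb Z$, and $\widehat f(\xi)=\int_{\mathcal M} f(x)e^{-2\pi i x\xi}\,dx$. Then for every $\varepsilon>0$ there are $T>0$, a solution $u_\varepsilon$ on $[0,T]\times\mathcal M$ of the generalized improved Boussinesq equation $$\partial_t^2u-\partial_x^2u-\partial_t^2\partial_x^2u=\partial_x^2(u^k),$$ and a time $t_\varepsilon\in(0,\varepsilon)$ with $t_\varepsilon\le T$, such that $$\|u_\varepsilon(0)-u_0\|_{H^s}+\|\partial_tu_\varepsilon(0)-u_1\|_{H^s}<\varepsilon,\qquad u_\varepsilon(t_\varepsilon)\in H^\theta(\mathcal M),\qquad \|u_\varepsilon(t_\varepsilon)\|_{H^\theta}>\varepsilon^{-1}.$$ If $u_0$ and $u_1$ are real-valued, then $u_\varepsilon$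 can be chosen real-valued. Here a solution is a function $u\in C^2([0,T];\mathcal FL^1(\mathcal M))$ that satisfies the equation in the sense of distributions in $x$ for every $t\in[0,T]$ (with one-sided time derivatives at $0$ and $T$), where the Wiener algebra $\mathcal FL^1(\mathcal M)$ is the space of the functions whose Fourier transform is in $L^1(\mathbb R)$, respectively $\ell^1(\mathbb Z)$, normed by the $L^1$, respectively $\ell^1$, norm of the Fourier transform. -/

import Mathlib

open Set MeasureTheory
open scoped ENNReal SchwartzMap Laplacian BoundedContinuousFunction ContDiff

noncomputable section

/-! ### The real line

Distributions on `ℝ` are Mathlib's tempered distributions `𝓢'(ℝ, ℂ)`. -/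

namespace Line

/-- The `H^s(ℝ)` norm of a tempered distribution, `‖⟨ξ⟩^s f̂‖_{L²} = ‖⟨∇⟩^s f‖_{L²}`.
The `L²` function representing `⟨∇⟩^s f` is unique if it exists; the value is `∞` otherwise,
that is, if `f` is not in `H^s(ℝ)`. -/
def sobolevNorm (s : ℝ) (f : 𝓢'(ℝ, ℂ)) : ℝ≥0∞ :=
  ⨅ (g : Lp ℂ 2 (volume : Measure ℝ))
    (_ : TemperedDistribution.besselPotential ℝ ℂ s f = (g : 𝓢'(ℝ, ℂ))), ‖g‖ₑ

/-- The tempered distribution `φ ↦ ∫ φ f` of a bounded continuous function `f`. -/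
def toDistribution (f : ℝ →ᵇ ℂ) : 𝓢'(ℝ, ℂ) :=
  ((BoundedContinuousFunction.memLp_top (μ := (volume : Measure ℝ)) f).toLp f :
    Lp ℂ ⊤ (volume : Measure ℝ))

/-- A distribution is real-valued if it is real on real-valued test functions. -/
def IsReal (f : 𝓢'(ℝ, ℂ)) : Prop :=
  ∀ φ : 𝓢(ℝ, ℂ), (∀ x, (φ x).im = 0) → (f φ).im = 0

/-- `u` is a solution, on the time interval `[0, T]` and on `ℝ`, of
`∂_t² u - ∂_x² u - ∂_t² ∂_x² u = ∂_x² (u^k)`, and `v = ∂_t u`.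

The Wiener algebra `𝓕L¹(ℝ)` consists of the inverse Fourier transforms of the functions in `L¹(ℝ)`,
with the `L¹` norm of the Fourier transform as norm. The solution is of class `C²` in time with
values in `𝓕L¹(ℝ)`: `U t`, `V t`, `W t` are the Fourier transforms of `u t`, `∂_t u t`, `∂_t² u t`,
and the derivatives are those of `L¹(ℝ)`-valued functions (one-sided at `0` and `T`). The equation
holds for all `t ∈ [0, T]` in the sense of distributions in `x`; `Δ` is `∂_x²` here. -/
structure IsSolution (k : ℕ) (T : ℝ) (u v : ℝ → (ℝ →ᵇ ℂ)) : Prop where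
  pos : 0 < T
  exists_fourier : ∃ U V W : ℝ → Lp ℂ 1 (volume : Measure ℝ),
    (∀ t ∈ Icc 0 T, u t = Real.Lp.fourierTransformInv (U t)) ∧
    (∀ t ∈ Icc 0 T, v t = Real.Lp.fourierTransformInv (V t)) ∧
    (∀ t ∈ Icc 0 T, HasDerivWithinAt U (V t) (Icc 0 T) t) ∧
    (∀ t ∈ Icc 0 T, HasDerivWithinAt V (W t) (Icc 0 T) t) ∧
    ContinuousOn W (Icc 0 T) ∧
    ∀ t ∈ Icc 0 T,
      toDistribution (Real.Lp.fourierTransformInv (W t)) - Δ (toDistribution (u t))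
        - Δ (toDistribution (Real.Lp.fourierTransformInv (W t)))
      = Δ (toDistribution (u t ^ k))

end Line

/-! ### The torus `𝕋 = ℝ/ℤ` -/

namespace Torus

/-- The test functions `C^∞(𝕋)`, as smooth `1`-periodic functions on `ℝ`. -/
def TestFunction : Submodule ℂ (ℝ → ℂ) where
  carrier := {φ | ContDiff ℝ ∞ φ ∧ Function.Periodic φ 1}
  add_mem' h₁ h₂ := ⟨h₁.1.add h₂.1, h₁.2.add h₂.2⟩
  zero_mem' := ⟨contDiff_const, fun _ => rfl⟩
  smul_mem' c _ h := ⟨contDiff_const.smul h.1, fun x => by simp [h.2 x]⟩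

/-- The derivative of a test function. -/
def TestFunction.deriv : TestFunction →ₗ[ℂ] TestFunction where
  toFun φ := ⟨_root_.deriv φ.1, (contDiff_infty_iff_deriv.mp φ.2.1).2, fun x => by
    have h : (fun y => φ.1 (y + 1)) = φ.1 := funext φ.2.2
    rw [← deriv_comp_add_const, h]⟩
  map_add' φ ψ := Subtype.ext <| funext fun x =>
    deriv_add (φ.2.1.differentiable (by simp) x) (ψ.2.1.differentiable (by simp) x)
  map_smul' c φ := Subtype.ext <| funext fun x =>
    deriv_const_smul c (φ.2.1.differentiable (by simp) x)

/-- The character `x ↦ e^{2πinx}` as a test function. -/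
def character (n : ℤ) : TestFunction :=
  ⟨fun x => Complex.exp (2 * Real.pi * Complex.I * n * x), by
    refine ⟨?_, fun x => ?_⟩
    · exact (contDiff_const.mul Complex.ofRealCLM.contDiff).cexp
    · change Complex.exp _ = Complex.exp _
      rw [Complex.exp_eq_exp_iff_exists_int]
      exact ⟨n, by push_cast; ring⟩⟩

/-- The distributions on `𝕋`: linear functionals on `C^∞(𝕋)` that are continuous for the usual
Fréchet topology, that is, bounded by a multiple of some `C^m` norm. -/
def Distribution : Submodule ℂ (TestFunction →ₗ[ℂ] ℂ) where
  carrier := {L | ∃ (m : ℕ) (C : ℝ), ∀ (φ : TestFunction) (B : ℝ),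
    (∀ j ≤ m, ∀ x, ‖iteratedDeriv j φ.1 x‖ ≤ B) → ‖L φ‖ ≤ C * B}
  add_mem' := by
    rintro L₁ L₂ ⟨m₁, C₁, h₁⟩ ⟨m₂, C₂, h₂⟩
    refine ⟨max m₁ m₂, C₁ + C₂, fun φ B h => ?_⟩
    have e₁ := h₁ φ B fun j hj => h j (hj.trans (le_max_left _ _))
    have e₂ := h₂ φ B fun j hj => h j (hj.trans (le_max_right _ _))
    calc ‖L₁ φ + L₂ φ‖ ≤ ‖L₁ φ‖ + ‖L₂ φ‖ := norm_add_le _ _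
      _ ≤ (C₁ + C₂) * B := by linarith
  zero_mem' := ⟨0, 0, fun φ B _ => by simp⟩
  smul_mem' := by
    rintro c L ⟨m, C, h⟩
    refine ⟨m, ‖c‖ * C, fun φ B hB => ?_⟩
    calc ‖c • L φ‖ = ‖c‖ * ‖L φ‖ := norm_smul _ _
      _ ≤ ‖c‖ * (C * B) := mul_le_mul_of_nonneg_left (h φ B hB) (norm_nonneg _)
      _ = ‖c‖ * C * B := by ring

/-- The distributional derivative `⟨∂_x L, φ⟩ = -⟨L, ∂_x φ⟩`. -/
def distDeriv (L : Distribution) : Distribution :=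
  ⟨-(L.1 ∘ₗ TestFunction.deriv), by
    obtain ⟨m, C, h⟩ := L.2
    refine ⟨m + 1, C, fun φ B hB => ?_⟩
    have := h (TestFunction.deriv φ) B fun j hj x => by
      have := hB (j + 1) (by omega) x
      rwa [iteratedDeriv_succ'] at this
    simpa using this⟩

/-- The distribution `φ ↦ ∫_𝕋 φ f` of a continuous function `f` on `𝕋`. -/
def toDistribution (f : C(UnitAddCircle, ℂ)) : Distribution :=
  ⟨{ toFun := fun φ => ∫ x in (0 : ℝ)..1, φ.1 x * f (x : UnitAddCircle)
     map_add' := fun φ ψ => by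
      have hf : Continuous fun x : ℝ => f (x : UnitAddCircle) :=
        f.continuous.comp (AddCircle.continuous_mk' 1)
      rw [← intervalIntegral.integral_add (f := fun x : ℝ => φ.1 x * f (x : UnitAddCircle))
        (g := fun x : ℝ => ψ.1 x * f (x : UnitAddCircle))
        ((φ.2.1.continuous.mul hf).intervalIntegrable _ _)
        ((ψ.2.1.continuous.mul hf).intervalIntegrable _ _)]
      exact intervalIntegral.integral_congr fun x _ => add_mul _ _ _
     map_smul' := fun c φ => by
      simp only [RingHom.id_apply, smul_eq_mul]
      rw [← intervalIntegral.integral_const_mul]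
      exact intervalIntegral.integral_congr fun x _ => mul_assoc _ _ _ }, by
    refine ⟨0, ‖f‖, fun φ B hB => ?_⟩
    have := intervalIntegral.norm_integral_le_of_norm_le_const (a := (0 : ℝ)) (b := 1)
      (f := fun x : ℝ => φ.1 x * f (x : UnitAddCircle)) (C := ‖f‖ * B) fun x _ => by
        have h := hB 0 le_rfl x
        rw [iteratedDeriv_zero] at h
        calc ‖φ.1 x * f (x : UnitAddCircle)‖ = ‖f (x : UnitAddCircle)‖ * ‖φ.1 x‖ := by
              rw [norm_mul, mul_comm]
          _ ≤ ‖f‖ * B := mul_le_mul (f.norm_coe_le_norm _) h (norm_nonneg _) (norm_nonneg _)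
    simpa using this⟩

/-- The Fourier coefficients `⟨L, e^{-2πinx}⟩`, `n ∈ ℤ`, of a distribution on `𝕋`. -/
def fourierCoeff (L : Distribution) (n : ℤ) : ℂ := L.1 (character (-n))

/-- The `H^s(𝕋)` norm of a distribution, `(∑_{n ∈ ℤ} ⟨n⟩^{2s} |L̂(n)|²)^{1/2} ∈ [0, ∞]`. -/
def sobolevNorm (s : ℝ) (L : Distribution) : ℝ≥0∞ :=
  (∑' n : ℤ, ENNReal.ofReal ((1 + (n : ℝ) ^ 2) ^ s * ‖fourierCoeff L n‖ ^ 2)) ^ (1 / 2 : ℝ)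

/-- A distribution is real-valued if it is real on real-valued test functions. -/
def IsReal (L : Distribution) : Prop :=
  ∀ φ : TestFunction, (∀ x, (φ.1 x).im = 0) → (L.1 φ).im = 0

/-- The function `∑_n a_n e^{2πinx}` with the absolutely summable Fourier coefficients `a`. The
Wiener algebra `𝓕L¹(𝕋)` consists of these functions, with the `ℓ¹` norm of `a` as norm. -/
def fourierSeries (a : lp (fun _ : ℤ => ℂ) 1) : C(UnitAddCircle, ℂ) :=
  ∑' n : ℤ, a n • (fourier n : C(UnitAddCircle, ℂ))

/-- `u` is a solution, on the time interval `[0, T]` and on `𝕋`, of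
`∂_t² u - ∂_x² u - ∂_t² ∂_x² u = ∂_x² (u^k)`, and `v = ∂_t u`.

The solution is of class `C²` in time with values in `𝓕L¹(𝕋)`: `U t`, `V t`, `W t` are the Fourier
coefficients of `u t`, `∂_t u t`, `∂_t² u t`, and the derivatives are those of `ℓ¹(ℤ)`-valued
functions (one-sided at `0` and `T`). The equation holds for all `t ∈ [0, T]` in the sense of
distributions in `x`. -/
structure IsSolution (k : ℕ) (T : ℝ) (u v : ℝ → C(UnitAddCircle, ℂ)) : Prop where
  pos : 0 < T
  exists_fourier : ∃ U V W : ℝ → lp (fun _ : ℤ => ℂ) 1,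
    (∀ t ∈ Icc 0 T, u t = fourierSeries (U t)) ∧
    (∀ t ∈ Icc 0 T, v t = fourierSeries (V t)) ∧
    (∀ t ∈ Icc 0 T, HasDerivWithinAt U (V t) (Icc 0 T) t) ∧
    (∀ t ∈ Icc 0 T, HasDerivWithinAt V (W t) (Icc 0 T) t) ∧
    ContinuousOn W (Icc 0 T) ∧
    ∀ t ∈ Icc 0 T,
      toDistribution (fourierSeries (W t)) - distDeriv (distDeriv (toDistribution (u t)))
        - distDeriv (distDeriv (toDistribution (fourierSeries (W t))))
      = distDeriv (distDeriv (toDistribution (u t ^ k)))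

end Torus

end

/-!
The equation reads `∂_t² û = -m (û + (u^k)^)` on the Fourier side, with the bounded multiplier
`m ξ = 4π²ξ² / (1 + 4π²ξ²)`. It is thus an ordinary differential equation in every Banach algebra
of Fourier transforms under convolution; no dispersion has to be used. The ill-posedness below
`L²` is a high-to-low frequency cascade: the perturbation `A ψ`, where `ψ` is the indicator
function of small balls around the frequencies `±N`, `±(N + 1)`, `±2N`, has an `H^s` norm of order
`A N^s`, which is small for `N` large because `s < 0`, whereas its `k`-th convolution power puts
mass of order `A^k`, independently of `N`, near the frequency `1`: for every `k ≥ 2` some sum of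
`k` of the centres is equal to `1` (`le_setIntegral_convPow`).

Let `u₀` and `u₁` be replaced by approximations in `H^s` of bounded frequency. By Taylor
expansion, the solution with data `u₀ + A ψ`, `u₁` has at the time `T` a low-frequency part
`-(T² / 2) m (A ψ)^k` up to smaller terms. For `T = τ A^{-(k - 1) / 2}` this is of order `τ² A`,
and the remainder is of order `1 + τ³ A`. Hence a small fixed `τ`, then a large `A`, then a large
`N` make the low-frequency part large, and with it every Sobolev norm, while `T` and the distance
of the data to `(u₀, u₁)` in `H^s` are small. Lifespan and expansion are obtained for
`y'' = -m (λ y + y^k)` with `0 ≤ λ ≤ 1` and data of size one (`exists_solution_of_small_time`),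
and the solution of the equation arises from it by scaling (`exists_solution_of_large_data`).

The Banach space is the weighted space of all `f` with `w f ∈ L¹ ∩ L²`. The weight
`w ξ = (1 + |ξ| / M)^p` is submultiplicative, which makes convolution bounded by Young's
inequality, it is at most `2^p` on the frequencies of the data if `M` is large enough, which makes
all the constants independent of `N`, and it puts the solution into `H^θ` if `p ≥ θ`. As the
solution of the ordinary differential equation is unique, it inherits the Hermitian symmetry
`f (-ξ) = conj (f ξ)` of the Fourier transforms of real data.

The argument on the Fourier side, `exists_norm_inflation`, is carried out once for a group of
frequencies `G` with an isometric embedding of `ℤ`. The cases `G = ℝ` and `G = ℤ` are then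
transferred to distributions on the line and on the torus.
-/

/-! ### Powers with respect to a bounded bilinear map -/

section BilinearPower

variable {X : Type*} [NormedAddCommGroup X] [NormedSpace ℝ X]

/-- The right-nested power `x · (x · (⋯ · x))` with `n + 1` factors, for the product given by a
bounded bilinear map `B`, of which neither associativity nor commutativity is needed. -/
noncomputable def bilinPow (B : X →L[ℝ] X →L[ℝ] X) : ℕ → X → X
  | 0, x => x
  | n + 1, x => B x (bilinPow B n x)

variable {B : X →L[ℝ] X →L[ℝ] X}

theorem norm_bilinPow_le (hB : ∀ x y, ‖B x y‖ ≤ ‖x‖ * ‖y‖) (n : ℕ) (x : X) :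
    ‖bilinPow B n x‖ ≤ ‖x‖ ^ (n + 1) := by
  induction n with
  | zero => simp [bilinPow]
  | succ n ih =>
    calc ‖B x (bilinPow B n x)‖ ≤ ‖x‖ * ‖bilinPow B n x‖ := hB _ _
      _ ≤ ‖x‖ * ‖x‖ ^ (n + 1) := by gcongr
      _ = ‖x‖ ^ (n + 1 + 1) := by ring

theorem norm_bilinPow_sub_le (hB : ∀ x y, ‖B x y‖ ≤ ‖x‖ * ‖y‖) {ρ : ℝ} (n : ℕ) {x y : X}
    (hx : ‖x‖ ≤ ρ) (hy : ‖y‖ ≤ ρ) :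
    ‖bilinPow B n x - bilinPow B n y‖ ≤ (n + 1) * ρ ^ n * ‖x - y‖ := by
  have hρ : 0 ≤ ρ := (norm_nonneg x).trans hx
  induction n with
  | zero => simp [bilinPow]
  | succ n ih =>
    have e : B x (bilinPow B n x) - B y (bilinPow B n y)
        = B (x - y) (bilinPow B n x) + B y (bilinPow B n x - bilinPow B n y) := by
      simp
    have h₁ : ‖bilinPow B n x‖ ≤ ρ ^ (n + 1) :=
      (norm_bilinPow_le hB n x).trans (by gcongr)
    calc ‖B x (bilinPow B n x) - B y (bilinPow B n y)‖
        ≤ ‖x - y‖ * ‖bilinPow B n x‖ + ‖y‖ * ‖bilinPow B n x - bilinPow B n y‖ := by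
          rw [e]
          exact (norm_add_le _ _).trans (add_le_add (hB _ _) (hB _ _))
      _ ≤ ‖x - y‖ * ρ ^ (n + 1) + ρ * ((n + 1) * ρ ^ n * ‖x - y‖) := by gcongr
      _ = ((n + 1 : ℕ) + 1) * ρ ^ (n + 1) * ‖x - y‖ := by push_cast; ring

theorem continuous_bilinPow (n : ℕ) : Continuous (bilinPow B n) := by
  induction n with
  | zero => exact continuous_id
  | succ n ih => exact (B.continuous.clm_apply ih : Continuous fun x => B x (bilinPow B n x))

theorem bilinPow_smul (n : ℕ) (c : ℝ) (x : X) :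
    bilinPow B n (c • x) = c ^ (n + 1) • bilinPow B n x := by
  induction n with
  | zero => simp [bilinPow]
  | succ n ih => simp [bilinPow, ih, smul_smul, pow_succ]

theorem map_bilinPow {σ : X →L[ℝ] X} (hσ : ∀ x y, σ (B x y) = B (σ x) (σ y)) (n : ℕ) (x : X) :
    σ (bilinPow B n x) = bilinPow B n (σ x) := by
  induction n with
  | zero => rfl
  | succ n ih => simp only [bilinPow, hσ, ih]

end BilinearPower

/-! ### The second-order equation `y'' = -m (λ y + y ^ (n + 1))` in a Banach space -/

/-- The Picard-Lindelöf theorem, with the additional information that the solution stays in the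
ball on which the vector field is controlled. -/
theorem IsPicardLindelof.exists_mem_closedBall {E : Type*} [NormedAddCommGroup E] [NormedSpace ℝ E]
    [CompleteSpace E] {f : ℝ → E → E} {tmin tmax : ℝ} {t₀ : Icc tmin tmax} {x₀ x : E}
    {a r L K : NNReal} (hf : IsPicardLindelof f t₀ x₀ a r L K) (hx : x ∈ Metric.closedBall x₀ r) :
    ∃ α : ℝ → E, α t₀ = x ∧ (∀ t, α t ∈ Metric.closedBall x₀ a) ∧
      ∀ t ∈ Icc tmin tmax, HasDerivWithinAt α (f t (α t)) (Icc tmin tmax) t := by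
  obtain ⟨α, hα⟩ := ODE.FunSpace.exists_isFixedPt_next hf hx
  refine ⟨α.compProj, by rw [ODE.FunSpace.compProj_val, ← hα, ODE.FunSpace.next_apply₀],
    fun t => α.compProj_mem_closedBall hf.mul_max_le, fun t ht => ?_⟩
  apply ODE.hasDerivWithinAt_picard_Icc t₀.2 hf.continuousOn_uncurry
    α.continuous_compProj.continuousOn (fun _ ht' => α.compProj_mem_closedBall hf.mul_max_le)
    x ht |>.congr_of_mem _ ht
  intro t' ht'
  nth_rw 1 [← hα]
  rw [ODE.FunSpace.compProj_of_mem ht', ODE.FunSpace.next_apply]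

section SecondOrder

variable {X : Type*} [NormedAddCommGroup X] [NormedSpace ℝ X]

/-- The vector field on the phase space `X × X` of the equation
`y'' = -m (lam • y + y ^ (n + 1))`. -/
noncomputable def phaseField (B : X →L[ℝ] X →L[ℝ] X) (m : X →L[ℝ] X) (n : ℕ)
    (lam : ℝ) (p : X × X) : X × X :=
  (p.2, -m (lam • p.1 + bilinPow B n p.1))

variable {B : X →L[ℝ] X →L[ℝ] X} {m : X →L[ℝ] X}

theorem norm_force_le (hB : ∀ x y, ‖B x y‖ ≤ ‖x‖ * ‖y‖) (hm : ∀ x, ‖m x‖ ≤ ‖x‖) {n : ℕ} {lam ρ : ℝ}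
    (h0 : 0 ≤ lam) (h1 : lam ≤ 1) (hρ : 1 ≤ ρ) {x : X} (hx : ‖x‖ ≤ ρ) :
    ‖m (lam • x + bilinPow B n x)‖ ≤ 2 * ρ ^ (n + 1) := by
  have hl : ‖lam • x‖ ≤ ρ := by
    rw [norm_smul, Real.norm_of_nonneg h0]
    nlinarith [norm_nonneg x]
  have hp : ‖bilinPow B n x‖ ≤ ρ ^ (n + 1) := (norm_bilinPow_le hB n x).trans (by gcongr)
  have : ρ ≤ ρ ^ (n + 1) := le_self_pow₀ hρ (by omega)
  linarith [hm (lam • x + bilinPow B n x), norm_add_le (lam • x) (bilinPow B n x)]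

theorem norm_force_sub_le (hB : ∀ x y, ‖B x y‖ ≤ ‖x‖ * ‖y‖) (hm : ∀ x, ‖m x‖ ≤ ‖x‖) {n : ℕ}
    {lam ρ : ℝ} (h0 : 0 ≤ lam) (h1 : lam ≤ 1) (hρ : 1 ≤ ρ) {x y : X} (hx : ‖x‖ ≤ ρ)
    (hy : ‖y‖ ≤ ρ) :
    ‖m (lam • x + bilinPow B n x) - m (lam • y + bilinPow B n y)‖
      ≤ 2 * (n + 1) * ρ ^ (n + 1) * ‖x - y‖ := by
  have e : m (lam • x + bilinPow B n x) - m (lam • y + bilinPow B n y)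
      = m (lam • (x - y) + (bilinPow B n x - bilinPow B n y)) := by
    rw [← map_sub]; congr 1; rw [smul_sub]; abel
  have hl : ‖lam • (x - y)‖ ≤ ‖x - y‖ := by
    rw [norm_smul, Real.norm_of_nonneg h0]
    nlinarith [norm_nonneg (x - y)]
  have hp := norm_bilinPow_sub_le hB n hx hy
  have h2 : ρ ^ n ≤ ρ ^ (n + 1) := pow_le_pow_right₀ hρ (by omega)
  have h3 : 1 ≤ ρ ^ (n + 1) := one_le_pow₀ hρ
  have hn : (0 : ℝ) ≤ n := n.cast_nonneg
  have h4 : 1 + (n + 1) * ρ ^ n ≤ 2 * (n + 1) * ρ ^ (n + 1) := by nlinarith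
  rw [e]
  calc _ ≤ ‖lam • (x - y)‖ + ‖bilinPow B n x - bilinPow B n y‖ := (hm _).trans (norm_add_le _ _)
    _ ≤ (1 + (n + 1) * ρ ^ n) * ‖x - y‖ := by linarith
    _ ≤ _ := by gcongr

/-- Local solvability with constants that depend only on the size of the data, a second-order
Taylor expansion at the final time, and preservation of every symmetry of the equation. -/
theorem exists_solution_of_small_time [CompleteSpace X] (hB : ∀ x y, ‖B x y‖ ≤ ‖x‖ * ‖y‖)
    (hm : ∀ x, ‖m x‖ ≤ ‖x‖) {n : ℕ} {lam R τ K : ℝ} (h0 : 0 ≤ lam) (h1 : lam ≤ 1) (hR : 0 ≤ R)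
    (hK : K = 2 * (n + 1) * (R + 1) ^ (n + 1)) (hτ : 0 < τ) (hτK : K * τ ≤ 1) {a b : X}
    (ha : ‖a‖ ≤ R) (hb : ‖b‖ ≤ R) :
    ∃ y z : ℝ → X, y 0 = a ∧ z 0 = b ∧
      (∀ t ∈ Icc 0 τ, HasDerivWithinAt y (z t) (Icc 0 τ) t) ∧
      (∀ t ∈ Icc 0 τ, HasDerivWithinAt z (-m (lam • y t + bilinPow B n (y t))) (Icc 0 τ) t) ∧
      ‖y τ - a - τ • b + (τ ^ 2 / 2) • m (bilinPow B n a)‖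
        ≤ lam * (R + 1) * τ ^ 2 + K ^ 2 * τ ^ 3 ∧
      ∀ σ : X →L[ℝ] X, (∀ x, ‖σ x‖ ≤ ‖x‖) → (∀ x y, σ (B x y) = B (σ x) (σ y)) →
        (∀ x, σ (m x) = m (σ x)) → σ a = a → σ b = b → ∀ t ∈ Icc 0 τ, σ (y t) = y t := by
  have hρ : 1 ≤ R + 1 := by linarith
  have hp1 : 1 ≤ (R + 1) ^ (n + 1) := one_le_pow₀ hρ
  have hp2 : R + 1 ≤ (R + 1) ^ (n + 1) := le_self_pow₀ hρ (by omega)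
  have hn : (0 : ℝ) ≤ n := n.cast_nonneg
  have hK2 : 2 * (R + 1) ^ (n + 1) ≤ K := by rw [hK]; nlinarith
  have hK0 : 0 ≤ K := by linarith
  have hKR : R + 1 ≤ K := by linarith
  have hball : ∀ p ∈ Metric.closedBall ((a, b) : X × X) 1,
      ‖p.1 - a‖ ≤ 1 ∧ ‖p.2 - b‖ ≤ 1 ∧ ‖p.1‖ ≤ R + 1 ∧ ‖p.2‖ ≤ R + 1 := by
    intro p hp
    rw [Metric.mem_closedBall, dist_eq_norm] at hp
    have h₁ : ‖p.1 - a‖ ≤ 1 := (norm_fst_le (p - (a, b))).trans hp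
    have h₂ : ‖p.2 - b‖ ≤ 1 := (norm_snd_le (p - (a, b))).trans hp
    refine ⟨h₁, h₂, ?_, ?_⟩
    · linarith [norm_le_norm_add_norm_sub' p.1 a]
    · linarith [norm_le_norm_add_norm_sub' p.2 b]
  have hlip : LipschitzOnWith (Real.toNNReal K) (phaseField B m n lam)
      (Metric.closedBall ((a, b) : X × X) 1) := by
    refine LipschitzOnWith.of_dist_le_mul fun p hp q hq => ?_
    obtain ⟨-, -, hp1', -⟩ := hball p hp
    obtain ⟨-, -, hq1', -⟩ := hball q hq
    rw [dist_eq_norm, dist_eq_norm, Real.coe_toNNReal _ hK0]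
    have e₁ : ‖p.1 - q.1‖ ≤ ‖p - q‖ := norm_fst_le (p - q)
    have e₂ : ‖p.2 - q.2‖ ≤ ‖p - q‖ := norm_snd_le (p - q)
    refine max_le ?_ ?_
    · change ‖p.2 - q.2‖ ≤ _
      nlinarith [norm_nonneg (p - q)]
    · change ‖-m (lam • p.1 + bilinPow B n p.1) - -m (lam • q.1 + bilinPow B n q.1)‖ ≤ _
      rw [neg_sub_neg, norm_sub_rev]
      refine (norm_force_sub_le hB hm h0 h1 hρ hp1' hq1').trans ?_
      rw [← hK]
      gcongr
  have hPL : IsPicardLindelof (fun _ => phaseField B m n lam) (tmin := 0) (tmax := τ)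
      ⟨0, le_rfl, hτ.le⟩ (a, b) 1 0 (Real.toNNReal K) (Real.toNNReal K) := by
    refine ⟨fun t _ => ?_, fun x _ => continuousOn_const, fun t _ p hp => ?_, ?_⟩
    · simpa using hlip
    · obtain ⟨-, -, hp1', hp2'⟩ := hball p (by simpa using hp)
      rw [Real.coe_toNNReal _ hK0]
      refine max_le (by change ‖p.2‖ ≤ K; linarith) ?_
      change ‖-m (lam • p.1 + bilinPow B n p.1)‖ ≤ K
      rw [norm_neg]
      exact (norm_force_le hB hm h0 h1 hρ hp1').trans hK2
    · rw [Real.coe_toNNReal _ hK0]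
      simp [hτ.le, hτK]
  obtain ⟨α, hα0, hαb, hα⟩ := hPL.exists_mem_closedBall (x := (a, b)) (by simp)
  simp only [NNReal.coe_one] at hαb
  have hy : ∀ t ∈ Icc 0 τ, HasDerivWithinAt (fun t => (α t).1) (α t).2 (Icc 0 τ) t := fun t ht =>
    (ContinuousLinearMap.fst ℝ X X).hasFDerivAt.comp_hasDerivWithinAt t (hα t ht)
  have hz : ∀ t ∈ Icc 0 τ, HasDerivWithinAt (fun t => (α t).2)
      (-m (lam • (α t).1 + bilinPow B n (α t).1)) (Icc 0 τ) t := fun t ht =>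
    (ContinuousLinearMap.snd ℝ X X).hasFDerivAt.comp_hasDerivWithinAt t (hα t ht)
  have hya : (α 0).1 = a := by rw [hα0]
  have hzb : (α 0).2 = b := by rw [hα0]
  have h0mem : (0 : ℝ) ∈ Icc 0 τ := ⟨le_rfl, hτ.le⟩
  refine ⟨fun t => (α t).1, fun t => (α t).2, hya, hzb, hy, hz, ?_, ?_⟩
  · have d₁ : ∀ t ∈ Icc 0 τ, ‖(α t).1 - a‖ ≤ K * τ := by
      intro t ht
      have := (convex_Icc (0 : ℝ) τ).norm_image_sub_le_of_norm_hasDerivWithin_le (C := K) hy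
        (fun t _ => by linarith [(hball _ (hαb t)).2.2.2]) h0mem ht
      rw [hya, Real.norm_eq_abs, sub_zero, abs_of_nonneg ht.1] at this
      exact this.trans (mul_le_mul_of_nonneg_left ht.2 hK0)
    set E := lam * (R + 1) + K ^ 2 * τ with hE
    have hE0 : 0 ≤ E := by positivity
    have d₂ : ∀ t ∈ Icc 0 τ, ‖(α t).2 - b + t • m (bilinPow B n a)‖ ≤ E * τ := by
      intro t ht
      have hder : ∀ t ∈ Icc 0 τ, HasDerivWithinAt (fun t => (α t).2 + t • m (bilinPow B n a))
          (-m (lam • (α t).1 + bilinPow B n (α t).1) + (1 : ℝ) • m (bilinPow B n a))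
          (Icc 0 τ) t := fun t ht =>
        (hz t ht).add ((hasDerivAt_id t).hasDerivWithinAt.smul_const _)
      have hbound : ∀ t ∈ Icc 0 τ, ‖-m (lam • (α t).1 + bilinPow B n (α t).1)
          + (1 : ℝ) • m (bilinPow B n a)‖ ≤ E := by
        intro t ht
        obtain ⟨-, -, hy', -⟩ := hball _ (hαb t)
        have e : -m (lam • (α t).1 + bilinPow B n (α t).1) + (1 : ℝ) • m (bilinPow B n a)
            = -m (lam • (α t).1 + (bilinPow B n (α t).1 - bilinPow B n a)) := by
          simp only [map_add, map_sub, one_smul]; abel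
        rw [e, norm_neg]
        refine (hm _).trans ((norm_add_le _ _).trans (add_le_add ?_ ?_))
        · rw [norm_smul, Real.norm_of_nonneg h0]
          gcongr
        · have h₂ := norm_bilinPow_sub_le hB n hy' (ha.trans (by linarith : R ≤ R + 1))
          have h₃ : (n + 1) * (R + 1) ^ n ≤ K := by
            have : (R + 1) ^ n ≤ (R + 1) ^ (n + 1) := pow_le_pow_right₀ hρ (by omega)
            rw [hK]; nlinarith
          calc _ ≤ (n + 1) * (R + 1) ^ n * ‖(α t).1 - a‖ := h₂
            _ ≤ K * (K * τ) := by gcongr; exact d₁ t ht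
            _ = K ^ 2 * τ := by ring
      have := (convex_Icc (0 : ℝ) τ).norm_image_sub_le_of_norm_hasDerivWithin_le hder hbound
        h0mem ht
      rw [hzb, Real.norm_eq_abs, sub_zero, abs_of_nonneg ht.1, zero_smul, add_zero] at this
      calc ‖(α t).2 - b + t • m (bilinPow B n a)‖
          = ‖(α t).2 + t • m (bilinPow B n a) - b‖ := by congr 1; abel
        _ ≤ E * t := this
        _ ≤ E * τ := mul_le_mul_of_nonneg_left ht.2 hE0
    have hder : ∀ t ∈ Icc 0 τ, HasDerivWithinAt
        (fun t => (α t).1 - t • b + (t ^ 2 / 2) • m (bilinPow B n a))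
        ((α t).2 - (1 : ℝ) • b + t • m (bilinPow B n a)) (Icc 0 τ) t := fun t ht => by
      have hsq : HasDerivAt (fun t : ℝ => t ^ 2 / 2) t t := by
        simpa using (hasDerivAt_pow 2 t).div_const 2
      exact ((hy t ht).sub ((hasDerivAt_id t).hasDerivWithinAt.smul_const b)).add
        (hsq.hasDerivWithinAt.smul_const _)
    have := (convex_Icc (0 : ℝ) τ).norm_image_sub_le_of_norm_hasDerivWithin_le (C := E * τ) hder
      (fun t ht => by simpa using d₂ t ht) h0mem (⟨hτ.le, le_rfl⟩ : τ ∈ Icc 0 τ)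
    rw [hya, Real.norm_eq_abs, sub_zero, abs_of_nonneg hτ.le] at this
    calc _ = ‖(α τ).1 - τ • b + (τ ^ 2 / 2) • m (bilinPow B n a)
            - (a - (0 : ℝ) • b + ((0 : ℝ) ^ 2 / 2) • m (bilinPow B n a))‖ := by
          congr 1; simp; abel
      _ ≤ E * τ * τ := this
      _ = _ := by rw [hE]; ring
  · intro σ hσ1 hσB hσm hσa hσb
    have hcont : ContinuousOn α (Icc 0 τ) := fun t ht => (hα t ht).continuousWithinAt
    let S : X × X →L[ℝ] X × X := σ.prodMap σ
    have hright : ∀ {γ : ℝ → X × X} {v : X × X} {t : ℝ}, t ∈ Ico 0 τ →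
        HasDerivWithinAt γ v (Icc 0 τ) t → HasDerivWithinAt γ v (Ici t) t := by
      intro γ v t ht h
      have h' := h.mono (Icc_subset_Icc_left ht.1)
      exact h'.mono_of_mem_nhdsWithin (Icc_mem_nhdsGE ht.2)
    have key := ODE_solution_unique_of_mem_Icc_right (v := fun _ => phaseField B m n lam)
      (s := fun _ => Metric.closedBall ((a, b) : X × X) 1) (K := Real.toNNReal K)
      (f := fun t => S (α t)) (g := α) (a := 0) (b := τ) (fun _ _ => hlip)
      (S.continuous.comp_continuousOn hcont) ?_ ?_ hcont
      (fun t ht => hright ht (hα t (Ico_subset_Icc_self ht))) (fun t _ => hαb t) ?_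
    · intro t ht
      exact congrArg Prod.fst (key ht)
    · intro t ht
      refine hright ht ?_
      have := S.hasFDerivAt.comp_hasDerivWithinAt t (hα t (Ico_subset_Icc_self ht))
      have e : S (phaseField B m n lam (α t)) = phaseField B m n lam (S (α t)) := by
        simp [S, phaseField, hσm, map_bilinPow hσB]
      rwa [e] at this
    · intro t _
      have h := hαb t
      rw [Metric.mem_closedBall, dist_eq_norm] at h ⊢
      have e : S (α t) - (a, b) = S (α t - (a, b)) := by
        rw [map_sub]; simp [S, hσa, hσb]
      rw [e]
      refine le_trans ?_ h
      exact max_le_max (hσ1 _) (hσ1 _)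
    · simp [S, hα0, hσa, hσb]

/-- Solution of `U'' = -m (U + U ^ (n + 1))` for data of size `A ≥ 1`, on the time scale
`A ^ (-n / 2)` on which the nonlinearity acts. -/
theorem exists_solution_of_large_data [CompleteSpace X] (hB : ∀ x y, ‖B x y‖ ≤ ‖x‖ * ‖y‖)
    (hm : ∀ x, ‖m x‖ ≤ ‖x‖) {n : ℕ} {R τ K A T : ℝ} (hn : n ≠ 0) (hR : 0 ≤ R)
    (hK : K = 2 * (n + 1) * (R + 1) ^ (n + 1)) (hτ : 0 < τ) (hτK : K * τ ≤ 1) (hA : 1 ≤ A)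
    (hT0 : 0 < T) (hT : T ^ 2 * A ^ n = τ ^ 2) {a b : X}
    (ha : ‖a‖ ≤ R * A) (hb : ‖b‖ ≤ R * A) :
    ∃ U V W : ℝ → X, U 0 = a ∧ V 0 = b ∧
      (∀ t ∈ Icc 0 T, HasDerivWithinAt U (V t) (Icc 0 T) t) ∧
      (∀ t ∈ Icc 0 T, HasDerivWithinAt V (W t) (Icc 0 T) t) ∧
      ContinuousOn W (Icc 0 T) ∧
      (∀ t, W t = -m (U t + bilinPow B n (U t))) ∧
      ‖U T - a - T • b + (T ^ 2 / 2) • m (bilinPow B n a)‖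
        ≤ (R + 1) * τ ^ 2 + K ^ 2 * τ ^ 3 * A ∧
      ∀ σ : X →L[ℝ] X, (∀ x, ‖σ x‖ ≤ ‖x‖) → (∀ x y, σ (B x y) = B (σ x) (σ y)) →
        (∀ x, σ (m x) = m (σ x)) → σ a = a → σ b = b → ∀ t ∈ Icc 0 T, σ (U t) = U t := by
  have hA0 : 0 < A := by linarith
  have hAn : 1 ≤ A ^ n := one_le_pow₀ hA
  set w := τ / T with hw
  have hw0 : 0 < w := by positivity
  have hwT : w * T = τ := by rw [hw]; field_simp
  have hw2 : w ^ 2 = A ^ n := by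
    rw [hw, div_pow, ← hT]; field_simp
  have hw1 : 1 ≤ w := by
    by_contra! h
    nlinarith
  obtain ⟨y, z, hy0, hz0, hy, hz, hTay, hsym⟩ := exists_solution_of_small_time (a := A⁻¹ • a)
    (b := (A * w)⁻¹ • b) (lam := (A ^ n)⁻¹) hB hm (by positivity) (inv_le_one_of_one_le₀ hAn) hR hK
    hτ hτK
    (by rw [norm_smul, Real.norm_of_nonneg (by positivity), inv_mul_le_iff₀ hA0]; linarith)
    (by
      rw [norm_smul, Real.norm_of_nonneg (by positivity), inv_mul_le_iff₀ (by positivity)]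
      have : R * A * 1 ≤ R * A * w := mul_le_mul_of_nonneg_left hw1 (by positivity)
      linarith)
  have hmaps : MapsTo (fun t => w * t) (Icc 0 T) (Icc 0 τ) := fun t ht =>
    ⟨mul_nonneg hw0.le ht.1, hwT ▸ mul_le_mul_of_nonneg_left ht.2 hw0.le⟩
  have hlin : ∀ t, HasDerivWithinAt (fun t => w * t) w (Icc 0 T) t := fun t => by
    simpa using ((hasDerivAt_id t).const_mul w).hasDerivWithinAt
  have hU : ∀ t ∈ Icc 0 T, HasDerivWithinAt (fun t => A • y (w * t)) ((A * w) • z (w * t))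
      (Icc 0 T) t := fun t ht => by
    have := ((hy _ (hmaps ht)).scomp t (hlin t) hmaps).const_smul A
    rwa [smul_smul] at this
  have hforce : ∀ t, (A * w) • w • -m ((A ^ n)⁻¹ • y (w * t) + bilinPow B n (y (w * t)))
      = -m (A • y (w * t) + bilinPow B n (A • y (w * t))) := fun t => by
    rw [bilinPow_smul, smul_smul, smul_neg, ← map_smul, smul_add, smul_smul,
      show A * w * w = A ^ (n + 1) by rw [mul_assoc, ← sq, hw2, pow_succ']]
    congr 4
    field_simp
    exact pow_succ A n
  have hV : ∀ t ∈ Icc 0 T, HasDerivWithinAt (fun t => (A * w) • z (w * t))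
      (-m (A • y (w * t) + bilinPow B n (A • y (w * t)))) (Icc 0 T) t := fun t ht => by
    have := ((hz _ (hmaps ht)).scomp t (hlin t) hmaps).const_smul (A * w)
    rwa [hforce] at this
  refine ⟨fun t => A • y (w * t), fun t => (A * w) • z (w * t),
    fun t => -m (A • y (w * t) + bilinPow B n (A • y (w * t))), ?_, ?_, hU, hV, ?_, fun _ => rfl,
    ?_, ?_⟩
  · simp [hy0, smul_smul, hA0.ne']
  · simp only [mul_zero, hz0]
    exact smul_inv_smul₀ (mul_pos hA0 hw0).ne' b
  · have hc : ContinuousOn (fun t => A • y (w * t)) (Icc 0 T) := fun t ht =>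
      (hU t ht).continuousWithinAt
    exact (m.continuous.comp_continuousOn
      (hc.add ((continuous_bilinPow n).comp_continuousOn hc))).neg
  · have e : A • y (w * T) - a - T • b + (T ^ 2 / 2) • m (bilinPow B n a)
        = A • (y τ - A⁻¹ • a - τ • (A * w)⁻¹ • b
          + (τ ^ 2 / 2) • m (bilinPow B n (A⁻¹ • a))) := by
      have i₁ : A * (τ * (A * w)⁻¹) = T := by rw [← hwT]; field_simp
      have i₂ : A * (τ ^ 2 / 2 * A⁻¹ ^ (n + 1)) = T ^ 2 / 2 := by
        rw [← hT, inv_pow]; field_simp; exact (pow_succ' A n).symm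
      rw [hwT, bilinPow_smul, map_smul]
      simp only [smul_add, smul_sub, smul_smul]
      rw [i₁, i₂, mul_inv_cancel₀ hA0.ne', one_smul]
    rw [e, norm_smul, Real.norm_of_nonneg hA0.le]
    have hlow : A * (A ^ n)⁻¹ ≤ 1 := by
      rw [← div_eq_mul_inv, div_le_one (by positivity)]
      exact le_self_pow₀ hA hn
    calc A * _ ≤ A * ((A ^ n)⁻¹ * (R + 1) * τ ^ 2 + K ^ 2 * τ ^ 3) := by gcongr
      _ = (A * (A ^ n)⁻¹) * ((R + 1) * τ ^ 2) + K ^ 2 * τ ^ 3 * A := by ring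
      _ ≤ 1 * ((R + 1) * τ ^ 2) + K ^ 2 * τ ^ 3 * A := by gcongr
      _ = _ := by ring
  · intro σ hσ1 hσB hσm hσa hσb t ht
    have := hsym σ hσ1 hσB hσm (by rw [map_smul, hσa]) (by rw [map_smul, hσb]) _ (hmaps ht)
    simp only [map_smul, this]

end SecondOrder

/-! ### The Banach space `L¹ ∩ L²` -/

/-- The subspace of the pairs in `L¹(μ) × L²(μ)` whose two components agree almost everywhere. -/
noncomputable def aeEqPairs {G : Type*} [MeasurableSpace G] (μ : Measure G) :
    Submodule ℝ (Lp ℂ 1 μ × Lp ℂ 2 μ) where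
  carrier := {p | p.1 =ᵐ[μ] p.2}
  add_mem' := by
    intro p q hp hq
    change ((p.1 + q.1 : Lp ℂ 1 μ) : G → ℂ) =ᵐ[μ] (p.2 + q.2 : Lp ℂ 2 μ)
    filter_upwards [Lp.coeFn_add p.1 q.1, Lp.coeFn_add p.2 q.2, hp, hq] with x h₁ h₂ h₃ h₄
    rw [h₁, h₂, Pi.add_apply, Pi.add_apply, h₃, h₄]
  zero_mem' := by
    change ((0 : Lp ℂ 1 μ) : G → ℂ) =ᵐ[μ] (0 : Lp ℂ 2 μ)
    filter_upwards [Lp.coeFn_zero ℂ 1 μ, Lp.coeFn_zero ℂ 2 μ] with x h₁ h₂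
    rw [h₁, h₂]
  smul_mem' := by
    intro c p hp
    change ((c • p.1 : Lp ℂ 1 μ) : G → ℂ) =ᵐ[μ] (c • p.2 : Lp ℂ 2 μ)
    filter_upwards [Lp.coeFn_smul c p.1, Lp.coeFn_smul c p.2, hp] with x h₁ h₂ h₃
    rw [h₁, h₂, Pi.smul_apply, Pi.smul_apply, h₃]

theorem isClosed_aeEqPairs {G : Type*} [MeasurableSpace G] (μ : Measure G) :
    IsClosed (aeEqPairs μ : Set (Lp ℂ 1 μ × Lp ℂ 2 μ)) := by
  refine IsSeqClosed.isClosed fun p q hp hq => ?_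
  have h₁ := tendstoInMeasure_of_tendsto_Lp ((continuous_fst.tendsto q).comp hq)
  have h₂ := tendstoInMeasure_of_tendsto_Lp ((continuous_snd.tendsto q).comp hq)
  exact tendstoInMeasure_ae_unique (h₁.congr_left fun n => hp n) h₂

/-- The space `L¹(μ) ∩ L²(μ)`, realized as the closed subspace of the pairs in `L¹(μ) × L²(μ)` whose
two components agree almost everywhere; its norm is the maximum of the two norms. -/
def L1L2 {G : Type*} [MeasurableSpace G] (μ : Measure G) : Type _ := aeEqPairs μ

namespace L1L2

variable {G : Type*} [MeasurableSpace G] {μ : Measure G}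

noncomputable instance : NormedAddCommGroup (L1L2 μ) :=
  inferInstanceAs (NormedAddCommGroup (aeEqPairs μ))

noncomputable instance : NormedSpace ℝ (L1L2 μ) := inferInstanceAs (NormedSpace ℝ (aeEqPairs μ))

instance : CompleteSpace (L1L2 μ) := (isClosed_aeEqPairs μ).completeSpace_coe

/-- The component in `L¹` of an element of `L¹ ∩ L²`. -/
def fstL (x : L1L2 μ) : Lp ℂ 1 μ := x.1.1

/-- The component in `L²` of an element of `L¹ ∩ L²`. -/
def sndL (x : L1L2 μ) : Lp ℂ 2 μ := x.1.2

/-- A function representing an element of `L¹ ∩ L²`. -/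
noncomputable def fn (x : L1L2 μ) : G → ℂ := x.fstL

theorem fn_ae_eq_sndL (x : L1L2 μ) : fn x =ᵐ[μ] x.sndL := x.2

theorem memLp_one (x : L1L2 μ) : MemLp (fn x) 1 μ := Lp.memLp x.fstL

theorem memLp_two (x : L1L2 μ) : MemLp (fn x) 2 μ := (Lp.memLp x.sndL).ae_eq x.fn_ae_eq_sndL.symm

theorem integrable (x : L1L2 μ) : Integrable (fn x) μ := memLp_one_iff_integrable.mp x.memLp_one

theorem norm_eq (x : L1L2 μ) :
    ‖x‖ = max (eLpNorm (fn x) 1 μ).toReal (eLpNorm (fn x) 2 μ).toReal := by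
  have h : eLpNorm (fn x) 2 μ = eLpNorm x.sndL 2 μ := eLpNorm_congr_ae x.fn_ae_eq_sndL
  rw [h]
  change max ‖x.fstL‖ ‖x.sndL‖ = _
  rw [Lp.norm_def, Lp.norm_def]
  rfl

theorem eLpNorm_one_le (x : L1L2 μ) : eLpNorm (fn x) 1 μ ≤ ENNReal.ofReal ‖x‖ := by
  rw [ENNReal.le_ofReal_iff_toReal_le x.memLp_one.2.ne (norm_nonneg _), norm_eq]
  exact le_max_left _ _

theorem eLpNorm_two_le (x : L1L2 μ) : eLpNorm (fn x) 2 μ ≤ ENNReal.ofReal ‖x‖ := by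
  rw [ENNReal.le_ofReal_iff_toReal_le x.memLp_two.2.ne (norm_nonneg _), norm_eq]
  exact le_max_right _ _

theorem norm_le {x : L1L2 μ} {C : ℝ} (hC : 0 ≤ C) (h₁ : eLpNorm (fn x) 1 μ ≤ ENNReal.ofReal C)
    (h₂ : eLpNorm (fn x) 2 μ ≤ ENNReal.ofReal C) : ‖x‖ ≤ C := by
  rw [norm_eq]
  exact max_le (ENNReal.toReal_le_of_le_ofReal hC h₁) (ENNReal.toReal_le_of_le_ofReal hC h₂)

theorem ext_ae {x y : L1L2 μ} (h : fn x =ᵐ[μ] fn y) : x = y := by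
  refine Subtype.ext (Prod.ext (Lp.ext h) (Lp.ext ?_))
  exact (x.fn_ae_eq_sndL.symm.trans h).trans y.fn_ae_eq_sndL

theorem fn_add (x y : L1L2 μ) : fn (x + y) =ᵐ[μ] fun ξ => fn x ξ + fn y ξ :=
  Lp.coeFn_add x.fstL y.fstL

theorem fn_smul (c : ℝ) (x : L1L2 μ) : fn (c • x) =ᵐ[μ] fun ξ => c * fn x ξ := by
  filter_upwards [Lp.coeFn_smul c x.fstL] with ξ h
  rw [Pi.smul_apply, Complex.real_smul] at h
  exact h

theorem fn_neg (x : L1L2 μ) : fn (-x) =ᵐ[μ] fun ξ => -fn x ξ := Lp.coeFn_neg x.fstL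

/-- The element of `L¹ ∩ L²` represented by a function. -/
noncomputable def ofFun (f : G → ℂ) (h₁ : MemLp f 1 μ) (h₂ : MemLp f 2 μ) : L1L2 μ :=
  ⟨(h₁.toLp f, h₂.toLp f), h₁.coeFn_toLp.trans h₂.coeFn_toLp.symm⟩

theorem fn_ofFun {f : G → ℂ} (h₁ : MemLp f 1 μ) (h₂ : MemLp f 2 μ) : fn (ofFun f h₁ h₂) =ᵐ[μ] f :=
  h₁.coeFn_toLp

theorem norm_ofFun_le {f : G → ℂ} {h₁ : MemLp f 1 μ} {h₂ : MemLp f 2 μ} {C : ℝ} (hC : 0 ≤ C)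
    (h₁' : eLpNorm f 1 μ ≤ ENNReal.ofReal C) (h₂' : eLpNorm f 2 μ ≤ ENNReal.ofReal C) :
    ‖ofFun f h₁ h₂‖ ≤ C :=
  norm_le hC (by rwa [eLpNorm_congr_ae (fn_ofFun h₁ h₂)])
    (by rwa [eLpNorm_congr_ae (fn_ofFun h₁ h₂)])

/-- An operator on `L¹ ∩ L²` that is given on representatives by a pointwise contraction. -/
noncomputable def mkOp (T : (G → ℂ) → G → ℂ) (hmem : ∀ (p : ℝ≥0∞) f, MemLp f p μ → MemLp (T f) p μ)
    (hcongr : ∀ f g, f =ᵐ[μ] g → T f =ᵐ[μ] T g)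
    (hadd : ∀ f g, T (f + g) = T f + T g) (hsmul : ∀ (c : ℝ) f, T (c • f) = c • T f)
    (hnorm : ∀ (p : ℝ≥0∞) f, MemLp f p μ → eLpNorm (T f) p μ ≤ eLpNorm f p μ) :
    L1L2 μ →L[ℝ] L1L2 μ :=
  LinearMap.mkContinuous
    { toFun := fun x => ofFun (T (fn x)) (hmem 1 _ x.memLp_one) (hmem 2 _ x.memLp_two)
      map_add' := fun x y => by
        apply ext_ae
        filter_upwards [fn_ofFun (hmem 1 _ (x + y).memLp_one) (hmem 2 _ (x + y).memLp_two),
          fn_add (ofFun (T (fn x)) (hmem 1 _ x.memLp_one) (hmem 2 _ x.memLp_two))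
            (ofFun (T (fn y)) (hmem 1 _ y.memLp_one) (hmem 2 _ y.memLp_two)),
          fn_ofFun (hmem 1 _ x.memLp_one) (hmem 2 _ x.memLp_two),
          fn_ofFun (hmem 1 _ y.memLp_one) (hmem 2 _ y.memLp_two),
          hcongr _ (fn x + fn y) (fn_add x y)] with ξ h₁ h₂ h₃ h₄ h₅
        rw [h₁, h₂, h₃, h₄, h₅, hadd, Pi.add_apply]
      map_smul' := fun c x => by
        apply ext_ae
        filter_upwards [fn_ofFun (hmem 1 _ (c • x).memLp_one) (hmem 2 _ (c • x).memLp_two),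
          fn_smul c (ofFun (T (fn x)) (hmem 1 _ x.memLp_one) (hmem 2 _ x.memLp_two)),
          fn_ofFun (hmem 1 _ x.memLp_one) (hmem 2 _ x.memLp_two),
          hcongr _ (c • fn x) (by simpa [Pi.smul_def] using fn_smul c x)] with ξ h₁ h₂ h₃ h₄
        rw [h₁, RingHom.id_apply, h₂, h₃, h₄, hsmul, Pi.smul_apply, Complex.real_smul] }
    1 fun x => by
      rw [one_mul]
      exact norm_ofFun_le (norm_nonneg _)
        ((hnorm 1 _ x.memLp_one).trans x.eLpNorm_one_le)
        ((hnorm 2 _ x.memLp_two).trans x.eLpNorm_two_le)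

section mkOp

variable {T : (G → ℂ) → G → ℂ} {hmem : ∀ (p : ℝ≥0∞) f, MemLp f p μ → MemLp (T f) p μ}
    {hcongr : ∀ f g, f =ᵐ[μ] g → T f =ᵐ[μ] T g}
    {hadd : ∀ f g, T (f + g) = T f + T g} {hsmul : ∀ (c : ℝ) f, T (c • f) = c • T f}
    {hnorm : ∀ (p : ℝ≥0∞) f, MemLp f p μ → eLpNorm (T f) p μ ≤ eLpNorm f p μ}

theorem fn_mkOp (x : L1L2 μ) : fn (mkOp T hmem hcongr hadd hsmul hnorm x) =ᵐ[μ] T (fn x) :=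
  fn_ofFun _ _

theorem norm_mkOp_le (x : L1L2 μ) : ‖mkOp T hmem hcongr hadd hsmul hnorm x‖ ≤ ‖x‖ :=
  norm_ofFun_le (norm_nonneg _) ((hnorm 1 _ x.memLp_one).trans x.eLpNorm_one_le)
        ((hnorm 2 _ x.memLp_two).trans x.eLpNorm_two_le)

end mkOp

/-- Multiplication by a measurable function with values in `[-1, 1]`. -/
noncomputable def mulOp (μ : Measure G) (m : G → ℝ) (hm : Measurable m) (h : ∀ ξ, |m ξ| ≤ 1) :
    L1L2 μ →L[ℝ] L1L2 μ :=
  have hle : ∀ (f : G → ℂ) ξ, ‖(m ξ : ℂ) * f ξ‖ ≤ ‖f ξ‖ := fun f ξ => by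
    rw [norm_mul, Complex.norm_real, Real.norm_eq_abs]
    exact mul_le_of_le_one_left (norm_nonneg _) (h ξ)
  mkOp (fun f ξ => m ξ * f ξ)
    (fun p f hf => hf.mono ((Complex.measurable_ofReal.comp hm).aestronglyMeasurable.mul hf.1)
      (Filter.Eventually.of_forall (hle f)))
    (fun f g hfg => by filter_upwards [hfg] with ξ h; rw [h])
    (fun f g => by ext ξ; simp [mul_add]) (fun c f => by ext ξ; simp [mul_left_comm])
    (fun p f _ => eLpNorm_mono (hle f))

theorem fn_mulOp {m : G → ℝ} (hm : Measurable m) (h : ∀ ξ, |m ξ| ≤ 1) (x : L1L2 μ) :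
    fn (mulOp μ m hm h x) =ᵐ[μ] fun ξ => m ξ * fn x ξ := fn_mkOp x

theorem norm_mulOp_le {m : G → ℝ} (hm : Measurable m) (h : ∀ ξ, |m ξ| ≤ 1) (x : L1L2 μ) :
    ‖mulOp μ m hm h x‖ ≤ ‖x‖ := norm_mkOp_le x

section Group

variable [AddCommGroup G] [MeasurableNeg G]

variable (μ) in
/-- The involution `f ↦ conj (f (-·))`, which is complex conjugation on the physical side. -/
noncomputable def conjNeg [μ.IsNegInvariant] : L1L2 μ →L[ℝ] L1L2 μ :=
  have hn : MeasurePreserving (Neg.neg : G → G) μ μ := Measure.measurePreserving_neg μ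
  have hm : ∀ (p : ℝ≥0∞) (f : G → ℂ), MemLp f p μ →
      MemLp (fun ξ => (starRingEnd ℂ) (f (-ξ))) p μ := fun p f hf =>
    (hf.comp_measurePreserving hn).star
  mkOp (fun f ξ => (starRingEnd ℂ) (f (-ξ))) hm
    (fun f g hfg => by
      filter_upwards [hn.quasiMeasurePreserving.ae_eq_comp hfg] with ξ h
      simp only [Function.comp_apply] at h
      rw [h])
    (fun f g => by ext ξ; simp) (fun c f => by ext ξ; simp)
    (fun p f hf => by
      rw [eLpNorm_congr_norm_ae (g := f ∘ Neg.neg)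
        (Filter.Eventually.of_forall fun ξ => by simp),
        eLpNorm_comp_measurePreserving hf.1 hn])

theorem fn_conjNeg [μ.IsNegInvariant] (x : L1L2 μ) :
    fn (conjNeg μ x) =ᵐ[μ] fun ξ => (starRingEnd ℂ) (fn x (-ξ)) := fn_mkOp x

theorem norm_conjNeg_le [μ.IsNegInvariant] (x : L1L2 μ) : ‖conjNeg μ x‖ ≤ ‖x‖ := norm_mkOp_le x

end Group

end L1L2

/-! ### Young's inequality and the weighted convolution product -/

theorem eLpNorm_two_sq {G : Type*} [MeasurableSpace G] {μ : Measure G} (f : G → ℂ) :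
    eLpNorm f 2 μ ^ 2 = ∫⁻ ξ, ‖f ξ‖ₑ ^ 2 ∂μ := by
  rw [eLpNorm_eq_lintegral_rpow_enorm_toReal (by norm_num) (by norm_num), ← ENNReal.rpow_natCast,
    ← ENNReal.rpow_mul]
  norm_num

section Young

variable {G : Type*} [MeasurableSpace G] [AddCommGroup G] [MeasurableAdd₂ G] [MeasurableNeg G]
  {μ : Measure G} [SFinite μ] [μ.IsAddLeftInvariant]

theorem aemeasurable_sub_mul {F H : G → ℝ≥0∞} (hF : AEMeasurable F μ) (hH : AEMeasurable H μ) :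
    AEMeasurable (fun p : G × G => F p.2 * H (p.1 - p.2)) (μ.prod μ) :=
  hF.comp_snd.mul (hH.comp_quasiMeasurePreserving
    (quasiMeasurePreserving_sub_of_right_invariant μ μ))

theorem lintegral_lintegral_mul_sub {F H : G → ℝ≥0∞} (hF : AEMeasurable F μ)
    (hH : AEMeasurable H μ) :
    ∫⁻ ξ, ∫⁻ η, F η * H (ξ - η) ∂μ ∂μ = (∫⁻ η, F η ∂μ) * ∫⁻ ξ, H ξ ∂μ := by
  rw [lintegral_lintegral_swap (aemeasurable_sub_mul hF hH)]
  have : ∀ η, ∫⁻ ξ, F η * H (ξ - η) ∂μ = F η * ∫⁻ ξ, H ξ ∂μ := fun η => by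
    rw [lintegral_const_mul'', lintegral_sub_right_eq_self]
    exact hH.comp_quasiMeasurePreserving (measurePreserving_sub_right μ η).quasiMeasurePreserving
  simp_rw [this]
  rw [lintegral_mul_const'' _ hF]

/-- Young's inequality `‖F ⋆ H‖₂² ≤ ‖F‖₁² ‖H‖₂²`. -/
theorem lintegral_lintegral_mul_sub_sq_le {F H : G → ℝ≥0∞} (hF : AEMeasurable F μ)
    (hH : AEMeasurable H μ) :
    ∫⁻ ξ, (∫⁻ η, F η * H (ξ - η) ∂μ) ^ 2 ∂μ ≤ (∫⁻ η, F η ∂μ) ^ 2 * ∫⁻ ξ, H ξ ^ 2 ∂μ := by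
  have hHξ : ∀ ξ, AEMeasurable (fun η => H (ξ - η)) μ := fun ξ =>
    hH.comp_quasiMeasurePreserving (quasiMeasurePreserving_sub_left_of_right_invariant μ ξ)
  have key : ∀ ξ, (∫⁻ η, F η * H (ξ - η) ∂μ) ^ 2
      ≤ (∫⁻ η, F η ∂μ) * ∫⁻ η, F η * H (ξ - η) ^ 2 ∂μ := fun ξ => by
    have h := ENNReal.lintegral_mul_le_Lp_mul_Lq μ Real.HolderConjugate.two_two
      (hF.pow_const (1 / 2 : ℝ)) ((hF.pow_const (1 / 2 : ℝ)).mul (hHξ ξ))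
    have e₁ : ∀ η, (((fun η => F η ^ (1 / 2 : ℝ)) * ((fun η => F η ^ (1 / 2 : ℝ)) *
        fun η => H (ξ - η))) : G → ℝ≥0∞) η = F η * H (ξ - η) := fun η => by
      simp only [Pi.mul_apply]
      rw [← mul_assoc, ← ENNReal.rpow_add_of_nonneg _ _ (by norm_num) (by norm_num)]
      norm_num
    have e₂ : ∀ η, (F η ^ (1 / 2 : ℝ)) ^ (2 : ℝ) = F η := fun η => by
      rw [← ENNReal.rpow_mul]; norm_num
    have e₃ : ∀ η, (F η ^ (1 / 2 : ℝ) * H (ξ - η)) ^ (2 : ℝ) = F η * H (ξ - η) ^ 2 := fun η => by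
      rw [ENNReal.mul_rpow_of_nonneg _ _ (by norm_num), e₂]
      norm_num
    have e₄ : ∀ a : ℝ≥0∞, (a ^ (1 / 2 : ℝ)) ^ 2 = a := fun a => by
      rw [← ENNReal.rpow_natCast, ← ENNReal.rpow_mul]; norm_num
    simp_rw [e₁, Pi.mul_apply, e₂, e₃] at h
    calc _ ≤ _ := pow_le_pow_left' h 2
      _ = _ := by rw [mul_pow, e₄, e₄]
  calc ∫⁻ ξ, (∫⁻ η, F η * H (ξ - η) ∂μ) ^ 2 ∂μ
      ≤ ∫⁻ ξ, (∫⁻ η, F η ∂μ) * ∫⁻ η, F η * H (ξ - η) ^ 2 ∂μ ∂μ := lintegral_mono key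
    _ = (∫⁻ η, F η ∂μ) * ∫⁻ ξ, ∫⁻ η, F η * H (ξ - η) ^ 2 ∂μ ∂μ :=
        lintegral_const_mul'' _ (aemeasurable_sub_mul hF (hH.pow_const 2)).lintegral_prod_right'
    _ = _ := by rw [lintegral_lintegral_mul_sub hF (hH.pow_const 2), sq, mul_assoc]

theorem eLpNorm_one_le_of_enorm_le_conv {f g h : G → ℂ} (hf : AEStronglyMeasurable f μ)
    (hg : AEStronglyMeasurable g μ) (hle : ∀ ξ, ‖h ξ‖ₑ ≤ ∫⁻ η, ‖f η‖ₑ * ‖g (ξ - η)‖ₑ ∂μ) :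
    eLpNorm h 1 μ ≤ eLpNorm f 1 μ * eLpNorm g 1 μ := by
  simp only [eLpNorm_one_eq_lintegral_enorm]
  rw [← lintegral_lintegral_mul_sub hf.enorm hg.enorm]
  exact lintegral_mono hle

theorem eLpNorm_two_le_of_enorm_le_conv {f g h : G → ℂ} (hf : AEStronglyMeasurable f μ)
    (hg : AEStronglyMeasurable g μ) (hle : ∀ ξ, ‖h ξ‖ₑ ≤ ∫⁻ η, ‖f η‖ₑ * ‖g (ξ - η)‖ₑ ∂μ) :
    eLpNorm h 2 μ ≤ eLpNorm f 1 μ * eLpNorm g 2 μ := by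
  refine (ENNReal.pow_le_pow_left_iff two_ne_zero).mp ?_
  rw [mul_pow, eLpNorm_two_sq, eLpNorm_two_sq, eLpNorm_one_eq_lintegral_enorm]
  exact (lintegral_mono fun ξ => pow_le_pow_left' (hle ξ) 2).trans
    (lintegral_lintegral_mul_sub_sq_le hf.enorm hg.enorm)

end Young

/-- A submultiplicative even weight on an abelian group. -/
structure SubmulWeight (G : Type*) [AddCommGroup G] [MeasurableSpace G] where
  /-- The weight function. -/
  toFun : G → ℝ
  measurable : Measurable toFun
  one_le : ∀ ξ, 1 ≤ toFun ξ
  add_le : ∀ ξ η, toFun (ξ + η) ≤ toFun ξ * toFun η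
  neg_eq : ∀ ξ, toFun (-ξ) = toFun ξ

namespace SubmulWeight

variable {G : Type*} [MeasurableSpace G] [AddCommGroup G] (w : SubmulWeight G)

theorem pos (ξ : G) : 0 < w.toFun ξ := zero_lt_one.trans_le (w.one_le ξ)

/-- Division by the weight. -/
noncomputable def unweight (f : G → ℂ) : G → ℂ := fun ξ => ((w.toFun ξ)⁻¹ : ℝ) * f ξ

theorem norm_unweight_le (f : G → ℂ) (ξ : G) : ‖w.unweight f ξ‖ ≤ ‖f ξ‖ := by
  rw [unweight, norm_mul, Complex.norm_real, Real.norm_of_nonneg (inv_nonneg.mpr (w.pos ξ).le)]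
  exact mul_le_of_le_one_left (norm_nonneg _) (inv_le_one_of_one_le₀ (w.one_le ξ))

theorem norm_mul_unweight_mul_unweight_le (f g : G → ℂ) (ξ η : G) :
    w.toFun ξ * ‖w.unweight f η * w.unweight g (ξ - η)‖ ≤ ‖f η‖ * ‖g (ξ - η)‖ := by
  have h := w.add_le η (ξ - η)
  rw [add_sub_cancel] at h
  have h₁ := w.pos η
  have h₂ := w.pos (ξ - η)
  rw [unweight, unweight, norm_mul, norm_mul, norm_mul, Complex.norm_real, Complex.norm_real,
    Real.norm_of_nonneg (inv_nonneg.mpr h₁.le), Real.norm_of_nonneg (inv_nonneg.mpr h₂.le)]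
  calc _ = (w.toFun ξ / (w.toFun η * w.toFun (ξ - η))) * (‖f η‖ * ‖g (ξ - η)‖) := by field_simp
    _ ≤ 1 * (‖f η‖ * ‖g (ξ - η)‖) := by
      gcongr
      exact (div_le_one (by positivity)).mpr h
    _ = _ := one_mul _

variable {μ : Measure G}

theorem aestronglyMeasurable_unweight {f : G → ℂ} (hf : AEStronglyMeasurable f μ) :
    AEStronglyMeasurable (w.unweight f) μ :=
  (Complex.measurable_ofReal.comp w.measurable.inv).aestronglyMeasurable.mul hf

theorem memLp_unweight {f : G → ℂ} {p : ℝ≥0∞} (hf : MemLp f p μ) : MemLp (w.unweight f) p μ :=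
  hf.mono (w.aestronglyMeasurable_unweight hf.1)
    (Filter.Eventually.of_forall (w.norm_unweight_le f))

theorem integrable_unweight {f : G → ℂ} (hf : Integrable f μ) : Integrable (w.unweight f) μ :=
  memLp_one_iff_integrable.mp (w.memLp_unweight (memLp_one_iff_integrable.mpr hf))

theorem unweight_congr {f g : G → ℂ} (h : f =ᵐ[μ] g) : w.unweight f =ᵐ[μ] w.unweight g := by
  filter_upwards [h] with ξ hξ
  rw [unweight, unweight, hξ]

open scoped Convolution

/-- The convolution of symbols, transported by the weight: `w · ((f / w) ⋆ (g / w))`. -/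
noncomputable def wconv (μ : Measure G) (f g : G → ℂ) : G → ℂ := fun ξ =>
  w.toFun ξ * (w.unweight f ⋆[ContinuousLinearMap.mul ℂ ℂ, μ] w.unweight g) ξ

theorem enorm_wconv_le (f g : G → ℂ) (ξ : G) :
    ‖w.wconv μ f g ξ‖ₑ ≤ ∫⁻ η, ‖f η‖ₑ * ‖g (ξ - η)‖ₑ ∂μ := by
  rw [wconv, convolution_mul, ← integral_const_mul]
  refine (enorm_integral_le_lintegral_enorm _).trans (lintegral_mono fun η => ?_)
  rw [← enorm_mul, enorm_le_iff_norm_le, norm_mul, Complex.norm_real,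
    Real.norm_of_nonneg (w.pos ξ).le, norm_mul (f η)]
  exact w.norm_mul_unweight_mul_unweight_le f g ξ η

theorem unweight_wconv (f g : G → ℂ) : w.unweight (w.wconv μ f g)
    = w.unweight f ⋆[ContinuousLinearMap.mul ℂ ℂ, μ] w.unweight g := by
  ext ξ
  rw [unweight, wconv, ← mul_assoc, ← Complex.ofReal_mul, inv_mul_cancel₀ (w.pos ξ).ne',
    Complex.ofReal_one, one_mul]

theorem wconv_smul_left (c : ℝ) (f g : G → ℂ) (ξ : G) :
    w.wconv μ (fun ξ => c * f ξ) g ξ = c * w.wconv μ f g ξ := by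
  simp only [wconv, convolution_mul, unweight]
  rw [mul_left_comm (c : ℂ), ← integral_const_mul (c : ℂ)]
  congr 2
  ext η
  ring

theorem wconv_smul_right (c : ℝ) (f g : G → ℂ) (ξ : G) :
    w.wconv μ f (fun ξ => c * g ξ) ξ = c * w.wconv μ f g ξ := by
  simp only [wconv, convolution_mul, unweight]
  rw [mul_left_comm (c : ℂ), ← integral_const_mul (c : ℂ)]
  congr 2
  ext η
  ring

variable [MeasurableAdd₂ G] [MeasurableNeg G] [SFinite μ] [μ.IsAddLeftInvariant]

theorem wconv_congr {f f' g g' : G → ℂ} (hf : f =ᵐ[μ] f') (hg : g =ᵐ[μ] g') :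
    w.wconv μ f g = w.wconv μ f' g' := by
  ext ξ
  rw [wconv, wconv, convolution_congr _ (w.unweight_congr hf) (w.unweight_congr hg)]

theorem aestronglyMeasurable_wconv {f g : G → ℂ} (hf : Integrable f μ) (hg : Integrable g μ) :
    AEStronglyMeasurable (w.wconv μ f g) μ :=
  (Complex.measurable_ofReal.comp w.measurable).aestronglyMeasurable.mul
    ((w.integrable_unweight hf).integrable_convolution _ (w.integrable_unweight hg)).1

theorem wconv_add_left {f f' g : G → ℂ} (hf : Integrable f μ) (hf' : Integrable f' μ)
    (hg : Integrable g μ) :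
    w.wconv μ (f + f') g =ᵐ[μ] fun ξ => w.wconv μ f g ξ + w.wconv μ f' g ξ := by
  have e : w.unweight (f + f') = w.unweight f + w.unweight f' := by
    ext ξ; simp [unweight, mul_add]
  filter_upwards [(w.integrable_unweight hf).ae_convolution_exists (ContinuousLinearMap.mul ℂ ℂ)
    (w.integrable_unweight hg), (w.integrable_unweight hf').ae_convolution_exists
    (ContinuousLinearMap.mul ℂ ℂ) (w.integrable_unweight hg)] with ξ h₁ h₂
  rw [wconv, wconv, wconv, e, h₁.add_distrib h₂, mul_add]

theorem wconv_add_right {f g g' : G → ℂ} (hf : Integrable f μ) (hg : Integrable g μ)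
    (hg' : Integrable g' μ) :
    w.wconv μ f (g + g') =ᵐ[μ] fun ξ => w.wconv μ f g ξ + w.wconv μ f g' ξ := by
  have e : w.unweight (g + g') = w.unweight g + w.unweight g' := by
    ext ξ; simp [unweight, mul_add]
  filter_upwards [(w.integrable_unweight hf).ae_convolution_exists (ContinuousLinearMap.mul ℂ ℂ)
    (w.integrable_unweight hg), (w.integrable_unweight hf).ae_convolution_exists
    (ContinuousLinearMap.mul ℂ ℂ) (w.integrable_unweight hg')] with ξ h₁ h₂
  rw [wconv, wconv, wconv, e, h₁.distrib_add h₂, mul_add]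

theorem memLp_one_wconv (x y : L1L2 μ) : MemLp (w.wconv μ x.fn y.fn) 1 μ :=
  ⟨w.aestronglyMeasurable_wconv x.integrable y.integrable,
    (eLpNorm_one_le_of_enorm_le_conv x.memLp_one.1 y.memLp_one.1 (w.enorm_wconv_le _ _)).trans_lt
      (ENNReal.mul_lt_top x.memLp_one.2 y.memLp_one.2)⟩

theorem memLp_two_wconv (x y : L1L2 μ) : MemLp (w.wconv μ x.fn y.fn) 2 μ :=
  ⟨w.aestronglyMeasurable_wconv x.integrable y.integrable,
    (eLpNorm_two_le_of_enorm_le_conv x.memLp_one.1 y.memLp_one.1 (w.enorm_wconv_le _ _)).trans_lt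
      (ENNReal.mul_lt_top x.memLp_one.2 y.memLp_two.2)⟩

/-- The product of two elements of `L¹ ∩ L²` given by the weighted convolution. -/
noncomputable def prod (x y : L1L2 μ) : L1L2 μ :=
  L1L2.ofFun (w.wconv μ x.fn y.fn) (w.memLp_one_wconv x y) (w.memLp_two_wconv x y)

theorem fn_prod (x y : L1L2 μ) : (w.prod x y).fn =ᵐ[μ] w.wconv μ x.fn y.fn := L1L2.fn_ofFun _ _

theorem norm_prod_le (x y : L1L2 μ) : ‖w.prod x y‖ ≤ ‖x‖ * ‖y‖ := by
  refine L1L2.norm_ofFun_le (by positivity) ?_ ?_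
  · rw [ENNReal.ofReal_mul (norm_nonneg _)]
    exact (eLpNorm_one_le_of_enorm_le_conv x.memLp_one.1 y.memLp_one.1 (w.enorm_wconv_le _ _)).trans
      (mul_le_mul' x.eLpNorm_one_le y.eLpNorm_one_le)
  · rw [ENNReal.ofReal_mul (norm_nonneg _)]
    exact (eLpNorm_two_le_of_enorm_le_conv x.memLp_one.1 y.memLp_one.1 (w.enorm_wconv_le _ _)).trans
      (mul_le_mul' x.eLpNorm_one_le y.eLpNorm_two_le)

/-- The weighted convolution as a bounded bilinear map on `L¹ ∩ L²`. -/
noncomputable def prodL (μ : Measure G) [SFinite μ] [μ.IsAddLeftInvariant] :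
    L1L2 μ →L[ℝ] L1L2 μ →L[ℝ] L1L2 μ :=
  LinearMap.mkContinuous₂
    (LinearMap.mk₂ ℝ w.prod
      (fun x x' y => L1L2.ext_ae <| by
        filter_upwards [w.fn_prod (x + x') y, w.fn_prod x y, w.fn_prod x' y,
          L1L2.fn_add (w.prod x y) (w.prod x' y),
          w.wconv_add_left x.integrable x'.integrable y.integrable] with ξ h₁ h₂ h₃ h₄ h₅
        rw [h₁, h₄, h₂, h₃, ← h₅]
        exact congrFun (w.wconv_congr (L1L2.fn_add x x') (ae_eq_refl y.fn)) ξ)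
      (fun c x y => L1L2.ext_ae <| by
        filter_upwards [w.fn_prod (c • x) y, w.fn_prod x y, L1L2.fn_smul c (w.prod x y)]
          with ξ h₁ h₂ h₃
        rw [h₁, h₃, h₂, ← wconv_smul_left]
        exact congrFun (w.wconv_congr (L1L2.fn_smul c x) (ae_eq_refl y.fn)) ξ)
      (fun x y y' => L1L2.ext_ae <| by
        filter_upwards [w.fn_prod x (y + y'), w.fn_prod x y, w.fn_prod x y',
          L1L2.fn_add (w.prod x y) (w.prod x y'),
          w.wconv_add_right x.integrable y.integrable y'.integrable] with ξ h₁ h₂ h₃ h₄ h₅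
        rw [h₁, h₄, h₂, h₃, ← h₅]
        exact congrFun (w.wconv_congr (ae_eq_refl x.fn) (L1L2.fn_add y y')) ξ)
      (fun c x y => L1L2.ext_ae <| by
        filter_upwards [w.fn_prod x (c • y), w.fn_prod x y, L1L2.fn_smul c (w.prod x y)]
          with ξ h₁ h₂ h₃
        rw [h₁, h₃, h₂, ← wconv_smul_right]
        exact congrFun (w.wconv_congr (ae_eq_refl x.fn) (L1L2.fn_smul c y)) ξ))
    1 fun x y => by
      rw [one_mul]
      exact w.norm_prod_le x y

theorem prodL_apply (x y : L1L2 μ) : w.prodL μ x y = w.prod x y := rfl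

theorem norm_prodL_le (x y : L1L2 μ) : ‖w.prodL μ x y‖ ≤ ‖x‖ * ‖y‖ := w.norm_prod_le x y

theorem conjNeg_prodL [μ.IsNegInvariant] (x y : L1L2 μ) :
    L1L2.conjNeg μ (w.prodL μ x y) = w.prodL μ (L1L2.conjNeg μ x) (L1L2.conjNeg μ y) := by
  apply L1L2.ext_ae
  filter_upwards [L1L2.fn_conjNeg (w.prodL μ x y), w.fn_prod (L1L2.conjNeg μ x) (L1L2.conjNeg μ y),
    (Measure.measurePreserving_neg μ).quasiMeasurePreserving.ae_eq_comp (w.fn_prod x y)]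
    with ξ h₁ h₂ h₃
  simp only [Function.comp_apply] at h₃
  rw [h₁, prodL_apply, prodL_apply, h₂, h₃,
    w.wconv_congr (L1L2.fn_conjNeg x) (L1L2.fn_conjNeg y)]
  simp only [wconv, convolution_mul, unweight, map_mul, Complex.conj_ofReal, w.neg_eq]
  rw [← integral_conj, ← integral_neg_eq_self]
  congr 2
  ext η
  simp only [map_mul, Complex.conj_ofReal, w.neg_eq]
  rw [show -ξ - -η = -(ξ - η) by abel, w.neg_eq]

end SubmulWeight

/-! ### Symbols of the elements of the weighted space -/

namespace SubmulWeight

open scoped Convolution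

variable {G : Type*} [MeasurableSpace G] [AddCommGroup G] (w : SubmulWeight G) {μ : Measure G}

/-- An element of `L¹ ∩ L²` with prescribed symbol; its norm is controlled by the norms of the
symbol and the size of the weight on its support. -/
theorem exists_unweight_eq {f : G → ℂ} {D : ℝ} (hD : 0 ≤ D) (h₁ : MemLp f 1 μ) (h₂ : MemLp f 2 μ)
    (hw : ∀ ξ, f ξ ≠ 0 → w.toFun ξ ≤ D) :
    ∃ x : L1L2 μ, w.unweight x.fn =ᵐ[μ] f ∧ ∀ C : ℝ, 0 ≤ C → eLpNorm f 1 μ ≤ ENNReal.ofReal C →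
      eLpNorm f 2 μ ≤ ENNReal.ofReal C → ‖x‖ ≤ D * C := by
  have hle : ∀ ξ, ‖(w.toFun ξ : ℂ) * f ξ‖ ≤ D * ‖f ξ‖ := fun ξ => by
    rw [norm_mul, Complex.norm_real, Real.norm_of_nonneg (w.pos ξ).le]
    by_cases h : f ξ = 0
    · simp [h]
    · exact mul_le_mul_of_nonneg_right (hw ξ h) (norm_nonneg _)
  have hmeas : AEStronglyMeasurable (fun ξ => (w.toFun ξ : ℂ) * f ξ) μ :=
    (Complex.measurable_ofReal.comp w.measurable).aestronglyMeasurable.mul h₁.1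
  have hmem : ∀ p : ℝ≥0∞, MemLp f p μ → MemLp (fun ξ => (w.toFun ξ : ℂ) * f ξ) p μ := fun p h =>
    MemLp.of_le_mul h hmeas (Filter.Eventually.of_forall hle)
  have hnorm : ∀ (p : ℝ≥0∞) (C : ℝ), eLpNorm f p μ ≤ ENNReal.ofReal C →
      eLpNorm (fun ξ => (w.toFun ξ : ℂ) * f ξ) p μ ≤ ENNReal.ofReal (D * C) := fun p C h => by
    refine (eLpNorm_le_mul_eLpNorm_of_ae_le_mul (Filter.Eventually.of_forall hle) p).trans ?_
    rw [ENNReal.ofReal_mul hD]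
    gcongr
  refine ⟨L1L2.ofFun _ (hmem 1 h₁) (hmem 2 h₂), ?_, fun C hC hC₁ hC₂ =>
    L1L2.norm_ofFun_le (by positivity) (hnorm 1 C hC₁) (hnorm 2 C hC₂)⟩
  filter_upwards [w.unweight_congr (L1L2.fn_ofFun (hmem 1 h₁) (hmem 2 h₂))] with ξ hξ
  rw [hξ, unweight, ← mul_assoc, ← Complex.ofReal_mul, inv_mul_cancel₀ (w.pos ξ).ne',
    Complex.ofReal_one, one_mul]

theorem unweight_injective {x y : L1L2 μ} (h : w.unweight x.fn =ᵐ[μ] w.unweight y.fn) : x = y := by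
  apply L1L2.ext_ae
  filter_upwards [h] with ξ hξ
  have : (((w.toFun ξ)⁻¹ : ℝ) : ℂ) ≠ 0 := by
    exact_mod_cast inv_ne_zero (w.pos ξ).ne'
  exact mul_left_cancel₀ this hξ

theorem unweight_add (x y : L1L2 μ) :
    w.unweight (x + y).fn =ᵐ[μ] fun ξ => w.unweight x.fn ξ + w.unweight y.fn ξ := by
  filter_upwards [w.unweight_congr (L1L2.fn_add x y)] with ξ h
  rw [h]
  simp [unweight, mul_add]

theorem unweight_smul (c : ℝ) (x : L1L2 μ) :
    w.unweight (c • x).fn =ᵐ[μ] fun ξ => c * w.unweight x.fn ξ := by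
  filter_upwards [w.unweight_congr (L1L2.fn_smul c x)] with ξ h
  rw [h]
  simp [unweight, mul_left_comm]

theorem unweight_neg (x : L1L2 μ) :
    w.unweight (-x).fn =ᵐ[μ] fun ξ => -w.unweight x.fn ξ := by
  filter_upwards [w.unweight_congr (L1L2.fn_neg x)] with ξ h
  rw [h]
  simp [unweight]

theorem unweight_mulOp {m : G → ℝ} (hm : Measurable m) (h : ∀ ξ, |m ξ| ≤ 1) (x : L1L2 μ) :
    w.unweight (L1L2.mulOp μ m hm h x).fn =ᵐ[μ] fun ξ => m ξ * w.unweight x.fn ξ := by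
  filter_upwards [w.unweight_congr (L1L2.fn_mulOp hm h x)] with ξ h
  rw [h]
  simp [unweight, mul_left_comm]

/-- An element is fixed by the involution if and only if its symbol is Hermitian. -/
theorem conjNeg_eq_iff [MeasurableNeg G] [μ.IsNegInvariant] (x : L1L2 μ) : L1L2.conjNeg μ x = x ↔
    w.unweight x.fn =ᵐ[μ] fun ξ => (starRingEnd ℂ) (w.unweight x.fn (-ξ)) := by
  have key : w.unweight (L1L2.conjNeg μ x).fn
      =ᵐ[μ] fun ξ => (starRingEnd ℂ) (w.unweight x.fn (-ξ)) := by
    filter_upwards [w.unweight_congr (L1L2.fn_conjNeg x)] with ξ h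
    rw [h]
    simp [unweight, w.neg_eq]
  refine ⟨fun h => ?_, fun h => w.unweight_injective (key.trans h.symm)⟩
  rw [h] at key
  exact key

/-- The symbol as an element of `L¹`. -/
noncomputable def toL1 (μ : Measure G) : L1L2 μ →L[ℝ] Lp ℂ 1 μ :=
  LinearMap.mkContinuous
    { toFun := fun x => (w.memLp_unweight x.memLp_one).toLp _
      map_add' := fun x y => by
        rw [← MemLp.toLp_add]
        exact MemLp.toLp_congr _ _ (w.unweight_add x y)
      map_smul' := fun c x => by
        rw [RingHom.id_apply, ← MemLp.toLp_const_smul]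
        exact MemLp.toLp_congr _ _ ((w.unweight_smul c x).trans (ae_of_all _ fun ξ => by simp)) }
    1 fun x => by
      rw [one_mul]
      change ‖(w.memLp_unweight x.memLp_one).toLp _‖ ≤ _
      rw [Lp.norm_toLp]
      exact ENNReal.toReal_le_of_le_ofReal (norm_nonneg _)
        ((eLpNorm_mono (w.norm_unweight_le _)).trans x.eLpNorm_one_le)

theorem coeFn_toL1 (x : L1L2 μ) : w.toL1 μ x =ᵐ[μ] w.unweight x.fn :=
  (w.memLp_unweight x.memLp_one).coeFn_toLp

/-- The integral of the symbol over a set, as a bounded linear functional. -/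
noncomputable def setIntegralL (μ : Measure G) (S : Set G) : L1L2 μ →L[ℝ] ℂ :=
  LinearMap.mkContinuous
    { toFun := fun x => ∫ ξ in S, w.unweight x.fn ξ ∂μ
      map_add' := fun x y => by
        rw [← integral_add (w.integrable_unweight x.integrable).integrableOn
          (w.integrable_unweight y.integrable).integrableOn]
        exact integral_congr_ae (ae_restrict_of_ae (w.unweight_add x y))
      map_smul' := fun c x => by
        rw [RingHom.id_apply, Complex.real_smul, ← integral_const_mul]
        exact integral_congr_ae (ae_restrict_of_ae (w.unweight_smul c x)) }
    1 fun x => by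
      rw [one_mul]
      refine (norm_integral_le_integral_norm _).trans ?_
      have hint := w.integrable_unweight x.integrable
      refine (setIntegral_le_integral hint.norm (ae_of_all _ fun ξ => norm_nonneg _)).trans ?_
      refine (integral_mono hint.norm x.integrable.norm (w.norm_unweight_le _)).trans ?_
      rw [integral_norm_eq_lintegral_enorm x.memLp_one.1, ← eLpNorm_one_eq_lintegral_enorm]
      exact ENNReal.toReal_le_of_le_ofReal (norm_nonneg _) x.eLpNorm_one_le

theorem setIntegralL_apply (S : Set G) (x : L1L2 μ) :
    w.setIntegralL μ S x = ∫ ξ in S, w.unweight x.fn ξ ∂μ := rfl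

theorem norm_setIntegralL_le (S : Set G) (x : L1L2 μ) : ‖w.setIntegralL μ S x‖ ≤ ‖x‖ := by
  simpa using (w.setIntegralL μ S).le_of_opNorm_le
    (LinearMap.mkContinuous_norm_le _ zero_le_one _) x

variable [MeasurableAdd₂ G] [MeasurableNeg G] [SFinite μ] [μ.IsAddLeftInvariant]

theorem unweight_prodL (x y : L1L2 μ) : w.unweight (w.prodL μ x y).fn
    =ᵐ[μ] w.unweight x.fn ⋆[ContinuousLinearMap.mul ℂ ℂ, μ] w.unweight y.fn := by
  rw [← unweight_wconv]
  exact w.unweight_congr (w.fn_prod x y)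

/-- Integration against a character turns convolution powers into powers; this is the statement
that the Fourier transform of a convolution is the product of the Fourier transforms. -/
theorem integral_char_bilinPow {χ : G → ℂ} (hχm : Measurable χ) (hχ : ∀ ξ, ‖χ ξ‖ = 1)
    (hadd : ∀ ξ η, χ (ξ + η) = χ ξ * χ η) (n : ℕ) (x : L1L2 μ) :
    ∫ ξ, χ ξ * w.unweight (bilinPow (w.prodL μ) n x).fn ξ ∂μ
      = (∫ ξ, χ ξ * w.unweight x.fn ξ ∂μ) ^ (n + 1) := by
  have hint : ∀ y : L1L2 μ, Integrable (fun ξ => χ ξ * w.unweight y.fn ξ) μ := fun y =>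
    (w.integrable_unweight y.integrable).mono
      (hχm.aestronglyMeasurable.mul (w.integrable_unweight y.integrable).1)
      (ae_of_all _ fun ξ => by rw [norm_mul, hχ, one_mul])
  induction n with
  | zero => simp [bilinPow]
  | succ n ih =>
    rw [pow_succ', ← ih]
    have h := integral_convolution (ContinuousLinearMap.mul ℂ ℂ) (hint x)
      (hint (bilinPow (w.prodL μ) n x))
    rw [ContinuousLinearMap.mul_apply'] at h
    rw [← h]
    refine integral_congr_ae ?_
    filter_upwards [w.unweight_prodL x (bilinPow (w.prodL μ) n x)] with ξ hξ
    rw [bilinPow, hξ, convolution_mul, convolution_mul, ← integral_const_mul]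
    congr 1
    ext η
    have : χ ξ = χ η * χ (ξ - η) := by rw [← hadd, add_sub_cancel]
    rw [this]
    ring

end SubmulWeight

/-! ### Lower bounds for convolution powers of nonnegative functions -/

section LowerBound

open scoped Convolution

/-- The convolution of `n + 1` copies of a real function. -/
noncomputable def convPow {G : Type*} [MeasurableSpace G] [AddCommGroup G] (μ : Measure G)
    (ψ : G → ℝ) : ℕ → G → ℝ
  | 0 => ψ
  | n + 1 => ψ ⋆[ContinuousLinearMap.mul ℝ ℝ, μ] convPow μ ψ n

variable {G : Type*} [MeasurableSpace G] [AddCommGroup G] {μ : Measure G} {ψ : G → ℝ}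

theorem convPow_nonneg (hψ : ∀ ξ, 0 ≤ ψ ξ) (n : ℕ) (ξ : G) : 0 ≤ convPow μ ψ n ξ := by
  induction n generalizing ξ with
  | zero => exact hψ ξ
  | succ n ih =>
    rw [convPow, convolution_mul]
    exact integral_nonneg fun η => mul_nonneg (hψ _) (ih _)

variable [MeasurableAdd₂ G] [MeasurableNeg G] [SFinite μ] [μ.IsAddLeftInvariant]

theorem integrable_convPow (hψ : Integrable ψ μ) (n : ℕ) : Integrable (convPow μ ψ n) μ := by
  induction n with
  | zero => exact hψ
  | succ n ih => exact hψ.integrable_convolution _ ih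

theorem SubmulWeight.unweight_bilinPow (w : SubmulWeight G) {x : L1L2 μ}
    (hx : w.unweight x.fn =ᵐ[μ] fun ξ => (ψ ξ : ℂ)) (n : ℕ) :
    w.unweight (bilinPow (w.prodL μ) n x).fn =ᵐ[μ] fun ξ => (convPow μ ψ n ξ : ℂ) := by
  induction n with
  | zero => exact hx
  | succ n ih =>
    filter_upwards [w.unweight_prodL x (bilinPow (w.prodL μ) n x)] with ξ h
    rw [bilinPow, h, convolution_congr _ hx ih, convPow, convolution_mul, convolution_mul,
      ← integral_complex_ofReal]
    simp

/-- Convolution carries the mass on `S` and the mass on `S'` to the sumset; this is the lower bound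
behind the transfer of mass from high to low frequencies. -/
theorem setIntegral_mul_setIntegral_le_convolution {f h : G → ℝ} (hf : Integrable f μ)
    (hh : Integrable h μ) (hf0 : ∀ ξ, 0 ≤ f ξ) (hh0 : ∀ ξ, 0 ≤ h ξ) {S S' S'' : Set G}
    (hS : MeasurableSet S) (hS' : MeasurableSet S') (hS'' : MeasurableSet S'')
    (hadd : ∀ ξ ∈ S, ∀ η ∈ S', ξ + η ∈ S'') :
    (∫ ξ in S, f ξ ∂μ) * ∫ ξ in S', h ξ ∂μ
      ≤ ∫ ξ in S'', (f ⋆[ContinuousLinearMap.mul ℝ ℝ, μ] h) ξ ∂μ := by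
  have hf' := hf.indicator hS
  have hh' := hh.indicator hS'
  rw [← integral_indicator hS, ← integral_indicator hS', ← integral_indicator hS'']
  have e := integral_convolution (ContinuousLinearMap.mul ℝ ℝ) hf' hh'
  rw [ContinuousLinearMap.mul_apply'] at e
  rw [← e]
  refine integral_mono_ae (hf'.integrable_convolution _ hh')
    ((hf.integrable_convolution _ hh).indicator hS'') ?_
  filter_upwards [hf.ae_convolution_exists (ContinuousLinearMap.mul ℝ ℝ) hh,
    hf'.ae_convolution_exists (ContinuousLinearMap.mul ℝ ℝ) hh'] with ξ h₁ h₂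
  by_cases hξ : ξ ∈ S''
  · rw [indicator_of_mem hξ]
    refine integral_mono h₂ h₁ fun η => ?_
    exact mul_le_mul (indicator_le_self' (fun _ _ => hf0 _) _)
      (indicator_le_self' (fun _ _ => hh0 _) _) (indicator_nonneg (fun _ _ => hh0 _) _) (hf0 _)
  · rw [indicator_of_notMem hξ, convolution_mul]
    refine (integral_eq_zero_of_ae (ae_of_all _ fun η => ?_)).le
    by_contra hne
    have hη : η ∈ S := by
      by_contra h
      exact hne (by simp [h])
    have hξη : ξ - η ∈ S' := by
      by_contra h
      exact hne (by simp [h])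
    exact hξ (by simpa using hadd η hη (ξ - η) hξη)

end LowerBound

/-! ### The high-frequency perturbation -/

section Bumps

/-- The centres of the frequency bumps. Sums of `n + 1 ≥ 2` of them can produce the frequency `1`:
`(N + 1) - N = 1` and `N + (N + 1) - 2 N = 1`, and adding `N - N` changes nothing. -/
def bumpCenters (N : ℤ) : Finset ℤ := {N, -N, N + 1, -(N + 1), 2 * N, -(2 * N)}

theorem neg_mem_bumpCenters {N ν : ℤ} (h : ν ∈ bumpCenters N) : -ν ∈ bumpCenters N := by
  simp only [bumpCenters, Finset.mem_insert, Finset.mem_singleton] at h ⊢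
  omega

theorem le_abs_bumpCenters {N ν : ℤ} (hN : 0 ≤ N) (h : ν ∈ bumpCenters N) :
    N ≤ |ν| ∧ |ν| ≤ 2 * N + 1 := by
  simp only [bumpCenters, Finset.mem_insert, Finset.mem_singleton] at h
  rcases h with rfl | rfl | rfl | rfl | rfl | rfl
  all_goals
    first
    | rw [abs_neg, abs_of_nonneg (by omega)]
    | rw [abs_of_nonneg (by omega)]
    omega

variable {G : Type*} [NormedAddCommGroup G]

/-- The support of the high-frequency perturbation: closed balls around the centres. -/
def bumpSet (c : ℤ →+ G) (δ : ℝ) (N : ℤ) : Set G :=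
  ⋃ ν ∈ bumpCenters N, Metric.closedBall (c ν) δ

theorem neg_mem_bumpSet {c : ℤ →+ G} {δ : ℝ} {N : ℤ} {ξ : G} (h : ξ ∈ bumpSet c δ N) :
    -ξ ∈ bumpSet c δ N := by
  simp only [bumpSet, mem_iUnion, Metric.mem_closedBall, dist_eq_norm] at h ⊢
  obtain ⟨ν, hν, h⟩ := h
  refine ⟨-ν, neg_mem_bumpCenters hν, ?_⟩
  rwa [map_neg, neg_sub_neg, norm_sub_rev]

theorem norm_of_mem_bumpSet {c : ℤ →+ G} (hc : ∀ ν, ‖c ν‖ = |(ν : ℝ)|) {δ : ℝ} (hδ : δ ≤ 1) {N : ℤ}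
    (hN : 0 ≤ N) {ξ : G} (h : ξ ∈ bumpSet c δ N) : N - 1 ≤ ‖ξ‖ ∧ ‖ξ‖ ≤ 2 * N + 2 := by
  simp only [bumpSet, mem_iUnion, Metric.mem_closedBall, dist_eq_norm] at h
  obtain ⟨ν, hν, h⟩ := h
  obtain ⟨h₁, h₂⟩ := le_abs_bumpCenters hN hν
  have h₁' : (N : ℝ) ≤ ‖c ν‖ := by rw [hc]; exact_mod_cast h₁
  have h₂' : ‖c ν‖ ≤ 2 * N + 1 := by rw [hc]; exact_mod_cast h₂
  have h₃ := norm_le_norm_add_norm_sub' ξ (c ν)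
  have h₄ := norm_le_norm_add_norm_sub (c ν) ξ
  have h₅ := norm_le_norm_add_norm_sub' (c ν) ξ
  rw [norm_sub_rev] at h₅
  constructor <;> linarith

/-- The indicator function of the union of the frequency bumps. -/
noncomputable def bump (c : ℤ →+ G) (δ : ℝ) (N : ℤ) : G → ℝ := (bumpSet c δ N).indicator 1

theorem bump_nonneg (c : ℤ →+ G) (δ : ℝ) (N : ℤ) (ξ : G) : 0 ≤ bump c δ N ξ :=
  indicator_nonneg (fun _ _ => zero_le_one) _

variable [MeasurableSpace G] [BorelSpace G]

theorem measurableSet_bumpSet (c : ℤ →+ G) (δ : ℝ) (N : ℤ) : MeasurableSet (bumpSet c δ N) :=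
  Finset.measurableSet_biUnion _ fun _ _ => Metric.isClosed_closedBall.measurableSet

variable (μ : Measure G) [μ.IsAddLeftInvariant]

theorem measure_closedBall_eq_zero_center (x : G) (δ : ℝ) :
    μ (Metric.closedBall x δ) = μ (Metric.closedBall 0 δ) := by
  rw [← measure_preimage_add μ x (Metric.closedBall x δ)]
  congr 1
  ext ξ
  simp [dist_eq_norm]

theorem measure_bumpSet_le (c : ℤ →+ G) (δ : ℝ) (N : ℤ) :
    μ (bumpSet c δ N) ≤ 6 * μ (Metric.closedBall 0 δ) := by
  refine (measure_biUnion_finset_le _ _).trans ?_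
  simp_rw [measure_closedBall_eq_zero_center μ]
  rw [Finset.sum_const, nsmul_eq_mul]
  gcongr
  have : (bumpCenters N).card ≤ 6 := Finset.card_le_six
  exact_mod_cast this

theorem setIntegral_bump {c : ℤ →+ G} {δ : ℝ} {N ν : ℤ} (hν : ν ∈ bumpCenters N) :
    ∫ ξ in Metric.closedBall (c ν) δ, bump c δ N ξ ∂μ = μ.real (Metric.closedBall 0 δ) := by
  rw [setIntegral_congr_fun (g := fun _ => (1 : ℝ)) Metric.isClosed_closedBall.measurableSet
    fun ξ hξ => ?_]
  · rw [setIntegral_const, smul_eq_mul, mul_one, measureReal_def, measureReal_def,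
      measure_closedBall_eq_zero_center μ]
  · rw [bump, indicator_of_mem]
    · rfl
    · exact mem_biUnion hν hξ

variable [ProperSpace G] [IsFiniteMeasureOnCompacts μ]

theorem measure_bumpSet_lt_top (c : ℤ →+ G) (δ : ℝ) (N : ℤ) : μ (bumpSet c δ N) < ⊤ :=
  (measure_bumpSet_le μ c δ N).trans_lt
    (ENNReal.mul_lt_top (by norm_num) (isCompact_closedBall 0 δ).measure_lt_top)

theorem integrable_bump (c : ℤ →+ G) (δ : ℝ) (N : ℤ) : Integrable (bump c δ N) μ :=
  (integrable_indicator_iff (measurableSet_bumpSet c δ N)).mpr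
    (integrableOn_const (measure_bumpSet_lt_top μ c δ N).ne)

variable [SecondCountableTopology G]

/-- The mass which the convolution powers of the bumps put near a frequency is bounded below as soon
as that frequency is the sum of the right number of centres. -/
theorem le_setIntegral_convPow_succ [SFinite μ] {c : ℤ →+ G} {δ : ℝ} {N ν z : ℤ}
    (hν : ν ∈ bumpCenters N) {j : ℕ}
    (h : μ.real (Metric.closedBall 0 δ) ^ (j + 1)
      ≤ ∫ ξ in Metric.closedBall (c z) ((j + 1) * δ), convPow μ (bump c δ N) j ξ ∂μ) :
    μ.real (Metric.closedBall 0 δ) ^ (j + 1 + 1)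
      ≤ ∫ ξ in Metric.closedBall (c (ν + z)) (((j + 1 : ℕ) + 1) * δ),
          convPow μ (bump c δ N) (j + 1) ξ ∂μ := by
  have hball : ∀ (x : G) (r : ℝ), MeasurableSet (Metric.closedBall x r) := fun _ _ =>
    Metric.isClosed_closedBall.measurableSet
  rw [pow_succ']
  refine (mul_le_mul_of_nonneg_left h measureReal_nonneg).trans ?_
  rw [← setIntegral_bump μ hν]
  refine setIntegral_mul_setIntegral_le_convolution (integrable_bump μ c δ N)
    (integrable_convPow (integrable_bump μ c δ N) j) (bump_nonneg c δ N)
    (convPow_nonneg (bump_nonneg c δ N) j) (hball _ _) (hball _ _) (hball _ _) fun ξ hξ η hη => ?_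
  rw [Metric.mem_closedBall, dist_eq_norm] at *
  calc ‖ξ + η - c (ν + z)‖ = ‖(ξ - c ν) + (η - c z)‖ := by rw [map_add]; congr 1; abel
    _ ≤ δ + (j + 1) * δ := (norm_add_le _ _).trans (add_le_add hξ hη)
    _ = _ := by push_cast; ring

theorem le_setIntegral_convPow [SFinite μ] (c : ℤ →+ G) (δ : ℝ) (N : ℤ) (n : ℕ) :
    μ.real (Metric.closedBall 0 δ) ^ (n + 1 + 1)
      ≤ ∫ ξ in Metric.closedBall (c 1) (((n + 1 : ℕ) + 1) * δ),
          convPow μ (bump c δ N) (n + 1) ξ ∂μ := by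
  have hmem : ∀ ν, ν ∈ bumpCenters N ↔ ν = N ∨ ν = -N ∨ ν = N + 1 ∨ ν = -(N + 1) ∨ ν = 2 * N ∨
      ν = -(2 * N) := fun ν => by
    simp [bumpCenters]
  have h0 : ∀ ν ∈ bumpCenters N, μ.real (Metric.closedBall 0 δ) ^ (0 + 1)
      ≤ ∫ ξ in Metric.closedBall (c ν) (((0 : ℕ) + 1) * δ), convPow μ (bump c δ N) 0 ξ ∂μ := by
    intro ν hν
    simp only [Nat.cast_zero, zero_add, one_mul, pow_one]
    exact (setIntegral_bump μ hν).ge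
  have h1 : μ.real (Metric.closedBall 0 δ) ^ (1 + 1)
      ≤ ∫ ξ in Metric.closedBall (c 1) (((1 : ℕ) + 1) * δ),
          convPow μ (bump c δ N) 1 ξ ∂μ := by
    have := le_setIntegral_convPow_succ μ (ν := N + 1) (by rw [hmem]; omega)
      (h0 (-N) (by rw [hmem]; omega))
    rwa [show N + 1 + -N = 1 by ring] at this
  induction n using Nat.twoStepInduction with
  | zero => exact h1
  | one =>
    have h₁ := le_setIntegral_convPow_succ μ (ν := N + 1) (by rw [hmem]; omega)
      (h0 N (by rw [hmem]; omega))
    have h₂ := le_setIntegral_convPow_succ μ (ν := -(2 * N)) (by rw [hmem]; omega) h₁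
    rwa [show -(2 * N) + (N + 1 + N) = 1 by ring] at h₂
  | more n ih _ =>
    have h₁ := le_setIntegral_convPow_succ μ (ν := N) (by rw [hmem]; omega) ih
    have h₂ := le_setIntegral_convPow_succ μ (ν := -N) (by rw [hmem]; omega) h₁
    rwa [show -N + (N + 1) = 1 by ring] at h₂

end Bumps

/-! ### Sobolev weights -/

section Sobolev

variable {G : Type*} [NormedAddCommGroup G]

/-- The Sobolev weight `(1 + ‖ξ‖²)^(s/2)`. -/
noncomputable def bracket (s : ℝ) (ξ : G) : ℝ := (1 + ‖ξ‖ ^ 2) ^ (s / 2)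

theorem bracket_pos (s : ℝ) (ξ : G) : 0 < bracket s ξ := by unfold bracket; positivity

theorem bracket_neg (s : ℝ) (ξ : G) : bracket s (-ξ) = bracket s ξ := by simp [bracket]

theorem bracket_mul_bracket_neg (s : ℝ) (ξ : G) : bracket s ξ * bracket (-s) ξ = 1 := by
  rw [bracket, bracket, ← Real.rpow_add (by positivity)]
  simp [neg_div]

theorem continuous_bracket (s : ℝ) : Continuous (bracket s : G → ℝ) := by
  unfold bracket
  exact Continuous.rpow_const (by fun_prop) fun ξ => Or.inl (by positivity)

theorem bracket_le_of_norm_le {s r : ℝ} {ξ : G} (h : ‖ξ‖ ≤ r) :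
    bracket s ξ ≤ (1 + r ^ 2) ^ (|s| / 2) := by
  have h1 : 1 ≤ 1 + ‖ξ‖ ^ 2 := by nlinarith [norm_nonneg ξ]
  calc bracket s ξ ≤ (1 + ‖ξ‖ ^ 2) ^ (|s| / 2) :=
        Real.rpow_le_rpow_of_exponent_le h1 (by linarith [le_abs_self s])
    _ ≤ _ := by
        apply Real.rpow_le_rpow (by positivity) _ (by positivity)
        gcongr

theorem bracket_le_of_le_norm {s r : ℝ} (hs : s ≤ 0) (hr : 0 < r) {ξ : G} (h : r ≤ ‖ξ‖) :
    bracket s ξ ≤ r ^ s := by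
  calc bracket s ξ ≤ (r ^ 2) ^ (s / 2) :=
        Real.rpow_le_rpow_of_nonpos (by positivity) (by nlinarith) (by linarith)
    _ = r ^ s := by
        rw [← Real.rpow_natCast, ← Real.rpow_mul hr.le]
        congr 1
        push_cast
        ring

theorem bracket_le_pow {θ : ℝ} {p : ℕ} (hp : θ ≤ p) (ξ : G) : bracket θ ξ ≤ (1 + ‖ξ‖) ^ p := by
  have h1 : 1 ≤ 1 + ‖ξ‖ ^ 2 := by nlinarith [norm_nonneg ξ]
  calc bracket θ ξ ≤ (1 + ‖ξ‖ ^ 2) ^ ((p : ℝ) / 2) :=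
        Real.rpow_le_rpow_of_exponent_le h1 (by linarith)
    _ ≤ ((1 + ‖ξ‖) ^ 2) ^ ((p : ℝ) / 2) := by
        apply Real.rpow_le_rpow (by positivity) _ (by positivity)
        nlinarith [norm_nonneg ξ]
    _ = (1 + ‖ξ‖) ^ p := by
        rw [← Real.rpow_natCast, ← Real.rpow_mul (by positivity), ← Real.rpow_natCast]
        congr 1
        push_cast
        ring

variable [MeasurableSpace G] [BorelSpace G]

/-- The weight `(1 + ‖ξ‖ / M)^p`. It is bounded by `2^p` at all frequencies up to `M`, which makes
the estimates uniform in `M`, and it controls every Sobolev weight of order at most `p`. -/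
noncomputable def polyWeight (G : Type*) [NormedAddCommGroup G] [MeasurableSpace G] [BorelSpace G]
    (p : ℕ) (M : ℝ) (hM : 1 ≤ M) : SubmulWeight G where
  toFun ξ := (1 + ‖ξ‖ / M) ^ p
  measurable := by fun_prop
  one_le ξ := one_le_pow₀ (by have : 0 ≤ ‖ξ‖ / M := by positivity
                              linarith)
  add_le ξ η := by
    rw [← mul_pow]
    have h₁ : 0 ≤ ‖ξ‖ / M := by positivity
    have h₂ : 0 ≤ ‖η‖ / M := by positivity
    have h₃ : ‖ξ + η‖ / M ≤ ‖ξ‖ / M + ‖η‖ / M := by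
      rw [← add_div]
      gcongr
      exact norm_add_le _ _
    gcongr
    nlinarith
  neg_eq ξ := by rw [norm_neg]

theorem polyWeight_le {p : ℕ} {M : ℝ} (hM : 1 ≤ M) {ξ : G} (h : ‖ξ‖ ≤ M) :
    (polyWeight G p M hM).toFun ξ ≤ 2 ^ p := by
  change (1 + ‖ξ‖ / M) ^ p ≤ 2 ^ p
  have : ‖ξ‖ / M ≤ 1 := (div_le_one (by linarith)).mpr h
  gcongr
  linarith

theorem bracket_le_polyWeight {θ : ℝ} {p : ℕ} (hp : θ ≤ p) {M : ℝ} (hM : 1 ≤ M) (ξ : G) :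
    bracket θ ξ ≤ M ^ p * (polyWeight G p M hM).toFun ξ := by
  refine (bracket_le_pow hp ξ).trans ?_
  change _ ≤ M ^ p * (1 + ‖ξ‖ / M) ^ p
  rw [← mul_pow]
  gcongr
  rw [mul_add, mul_div_cancel₀ _ (by linarith)]
  linarith

/-- Elements of the weighted space have finite Sobolev norm. -/
theorem memLp_bracket_mul {μ : Measure G} {θ : ℝ} {p : ℕ} (hp : θ ≤ p) {M : ℝ} (hM : 1 ≤ M)
    (x : L1L2 μ) :
    MemLp (fun ξ => (bracket θ ξ : ℂ) * (polyWeight G p M hM).unweight x.fn ξ) 2 μ := by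
  refine MemLp.of_le_mul (c := M ^ p) x.memLp_two ?_ (ae_of_all _ fun ξ => ?_)
  · exact
      (Complex.continuous_ofReal.comp (continuous_bracket θ)).measurable.aestronglyMeasurable.mul
        ((polyWeight G p M hM).aestronglyMeasurable_unweight x.memLp_two.1)
  · have hw := (polyWeight G p M hM).pos ξ
    rw [SubmulWeight.unweight, norm_mul, norm_mul, Complex.norm_real, Complex.norm_real,
      Real.norm_of_nonneg (bracket_pos _ _).le, Real.norm_of_nonneg (inv_nonneg.mpr hw.le),
      ← mul_assoc]
    gcongr
    rw [← div_eq_mul_inv, div_le_iff₀ hw]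
    exact bracket_le_polyWeight hp hM ξ

/-- On a bounded set of frequencies, all Sobolev norms control the integral. -/
theorem enorm_setIntegral_le {μ : Measure G} {θ r : ℝ} {S : Set G} (hS : ∀ ξ ∈ S, ‖ξ‖ ≤ r)
    (hSm : MeasurableSet S) {f : G → ℂ} (hf : AEStronglyMeasurable f μ) :
    ‖∫ ξ in S, f ξ ∂μ‖ₑ ≤ ENNReal.ofReal ((1 + r ^ 2) ^ (|θ| / 2)) *
      (eLpNorm (fun ξ => (bracket θ ξ : ℂ) * f ξ) 2 μ * μ S ^ (1 / 2 : ℝ)) := by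
  set D := (1 + r ^ 2) ^ (|θ| / 2)
  have hle : ∀ ξ ∈ S, ‖f ξ‖ₑ ≤ ENNReal.ofReal D * ‖(bracket θ ξ : ℂ) * f ξ‖ₑ := fun ξ hξ => by
    have h₁ : bracket (-θ) ξ ≤ D := by
      have := bracket_le_of_norm_le (s := -θ) (hS ξ hξ)
      rwa [abs_neg] at this
    have h₂ : ‖f ξ‖ ≤ D * ‖(bracket θ ξ : ℂ) * f ξ‖ := by
      rw [norm_mul, Complex.norm_real, Real.norm_of_nonneg (bracket_pos _ _).le]
      calc ‖f ξ‖ = (bracket θ ξ * bracket (-θ) ξ) * ‖f ξ‖ := by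
            rw [bracket_mul_bracket_neg, one_mul]
        _ = bracket (-θ) ξ * (bracket θ ξ * ‖f ξ‖) := by ring
        _ ≤ _ := by
          gcongr
          exact mul_nonneg (bracket_pos _ _).le (norm_nonneg _)
    rw [← ofReal_norm, ← ofReal_norm,
      ← ENNReal.ofReal_mul ((bracket_pos _ _).le.trans h₁)]
    exact ENNReal.ofReal_le_ofReal h₂
  have hmeas : AEStronglyMeasurable (fun ξ => (bracket θ ξ : ℂ) * f ξ) μ :=
    (Complex.continuous_ofReal.comp (continuous_bracket θ)).measurable.aestronglyMeasurable.mul hf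
  calc ‖∫ ξ in S, f ξ ∂μ‖ₑ ≤ ∫⁻ ξ in S, ‖f ξ‖ₑ ∂μ := enorm_integral_le_lintegral_enorm _
    _ ≤ ∫⁻ ξ in S, ENNReal.ofReal D * ‖(bracket θ ξ : ℂ) * f ξ‖ₑ ∂μ :=
        setLIntegral_mono' hSm hle
    _ = ENNReal.ofReal D * eLpNorm (fun ξ => (bracket θ ξ : ℂ) * f ξ) 1 (μ.restrict S) := by
        rw [lintegral_const_mul'' _ hmeas.enorm.restrict, eLpNorm_one_eq_lintegral_enorm]
    _ ≤ _ := by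
        gcongr
        refine (eLpNorm_le_eLpNorm_mul_rpow_measure_univ (p := 1) (q := 2) (by norm_num)
          hmeas.restrict).trans ?_
        rw [Measure.restrict_apply_univ]
        gcongr ?_ * ?_
        · exact eLpNorm_restrict_le _ _ _ _
        · norm_num

end Sobolev

/-! ### Norm inflation on the Fourier side -/

section Inflation

variable {G : Type*} [NormedAddCommGroup G] [MeasurableSpace G] [BorelSpace G] {μ : Measure G}

/-- `f (-ξ)` is the complex conjugate of `f ξ`: the symbols of the real-valued functions. -/
def IsHermitianSymbol (μ : Measure G) (f : G → ℂ) : Prop :=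
  f =ᵐ[μ] fun ξ => (starRingEnd ℂ) (f (-ξ))

/-- Every element of `H^s` is the limit of elements with compactly supported Fourier transforms.
Here `g` is the Fourier transform multiplied by the Sobolev weight, and `f` the Fourier transform of
the approximation. -/
theorem exists_cutoff [ProperSpace G] [SecondCountableTopology G] [IsFiniteMeasureOnCompacts μ]
    (s : ℝ) {g : G → ℂ} (hg : MemLp g 2 μ) {η : ℝ} (hη : 0 < η) :
    ∃ (r F : ℝ) (f : G → ℂ), 1 ≤ r ∧ 0 ≤ F ∧ (∀ ξ, f ξ ≠ 0 → ‖ξ‖ ≤ r) ∧ MemLp f 1 μ ∧ MemLp f 2 μ ∧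
      eLpNorm f 1 μ ≤ ENNReal.ofReal F ∧ eLpNorm f 2 μ ≤ ENNReal.ofReal F ∧
      eLpNorm (fun ξ => (bracket s ξ : ℂ) * f ξ - g ξ) 2 μ < ENNReal.ofReal η ∧
      (IsHermitianSymbol μ g → IsHermitianSymbol μ f) := by
  obtain ⟨h, hsupp, hle, hcont, hmem⟩ := hg.exists_hasCompactSupport_eLpNorm_sub_le (by norm_num)
    (ε := ENNReal.ofReal (η / 2)) (by simpa using hη)
  obtain ⟨r₀, hr₀⟩ := hsupp.isCompact.isBounded.subset_closedBall 0
  set r := max r₀ 1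
  set B := Metric.closedBall (0 : G) r
  have hBm : MeasurableSet B := Metric.isClosed_closedBall.measurableSet
  have hB : ∀ ξ, ξ ∈ B ↔ ‖ξ‖ ≤ r := fun ξ => by simp [B]
  set f : G → ℂ := B.indicator fun ξ => (bracket (-s) ξ : ℂ) * g ξ with hf
  have hfmeas : AEStronglyMeasurable f μ :=
    ((Complex.continuous_ofReal.comp (continuous_bracket (-s))).measurable.aestronglyMeasurable.mul
      hg.1).indicator hBm
  have hf2 : MemLp f 2 μ := by
    refine MemLp.of_le_mul (c := (1 + r ^ 2) ^ (|-s| / 2)) hg hfmeas (ae_of_all _ fun ξ => ?_)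
    by_cases hξ : ξ ∈ B
    · rw [hf, indicator_of_mem hξ, norm_mul, Complex.norm_real,
        Real.norm_of_nonneg (bracket_pos _ _).le]
      gcongr
      exact bracket_le_of_norm_le ((hB ξ).mp hξ)
    · rw [hf, indicator_of_notMem hξ, norm_zero]
      positivity
  have hfB : B.indicator f = f := by rw [hf, indicator_indicator, inter_self]
  have hf1 : MemLp f 1 μ := by
    have h₁ : MemLp f 1 (μ.restrict B) := by
      have : IsFiniteMeasure (μ.restrict B) :=
        ⟨by rw [Measure.restrict_apply_univ]; exact (isCompact_closedBall 0 r).measure_lt_top⟩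
      exact hf2.restrict B |>.mono_exponent (by norm_num)
    rw [← hfB]
    exact (memLp_indicator_iff_restrict hBm).mpr h₁
  refine ⟨r, max (eLpNorm f 1 μ).toReal (eLpNorm f 2 μ).toReal, f, le_max_right _ _, by positivity,
    fun ξ hξ => ?_, hf1, hf2, ?_, ?_, ?_, fun hherm => ?_⟩
  · rw [← hB]
    by_contra hn
    exact hξ (indicator_of_notMem hn _)
  · exact (ENNReal.le_ofReal_iff_toReal_le hf1.2.ne (by positivity)).mpr (le_max_left _ _)
  · exact (ENNReal.le_ofReal_iff_toReal_le hf2.2.ne (by positivity)).mpr (le_max_right _ _)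
  · refine lt_of_le_of_lt (eLpNorm_mono (g := g - h) fun ξ => ?_) (hle.trans_lt ?_)
    · by_cases hξ : ξ ∈ B
      · rw [hf, indicator_of_mem hξ, ← mul_assoc, ← Complex.ofReal_mul, bracket_mul_bracket_neg]
        simp
      · have : h ξ = 0 := by
          by_contra hne
          refine hξ (Metric.closedBall_subset_closedBall (le_max_left r₀ 1) (hr₀ ?_))
          exact subset_tsupport _ hne
        rw [hf, indicator_of_notMem hξ, Pi.sub_apply, this]
        simp
    · exact (ENNReal.ofReal_lt_ofReal_iff hη).mpr (by linarith)
  · filter_upwards [hherm] with ξ hξ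
    by_cases hm : ξ ∈ B
    · have hm' : -ξ ∈ B := by rw [hB, norm_neg]; exact (hB ξ).mp hm
      simp only [hf]
      rw [indicator_of_mem hm, indicator_of_mem hm', map_mul, ← hξ, bracket_neg,
        Complex.conj_ofReal]
    · have hm' : -ξ ∉ B := by rw [hB, norm_neg]; exact fun h => hm ((hB ξ).mpr h)
      simp only [hf]
      rw [indicator_of_notMem hm, indicator_of_notMem hm', map_zero]

section BumpNorms

variable [μ.IsAddLeftInvariant] [ProperSpace G] [IsFiniteMeasureOnCompacts μ]

theorem eLpNorm_indicator_bumpSet_le (c : ℤ →+ G) (δ : ℝ) (N : ℤ) {b : ℝ} (hb : 0 ≤ b)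
    {f : G → ℂ} (hf : ∀ ξ ∈ bumpSet c δ N, ‖f ξ‖ ≤ b) {p : ℝ≥0∞} (hp : p = 1 ∨ p = 2) :
    eLpNorm ((bumpSet c δ N).indicator f) p μ
      ≤ ENNReal.ofReal (b * (1 + 6 * μ.real (Metric.closedBall 0 δ))) := by
  set q := μ.real (Metric.closedBall (0 : G) δ)
  have hq : 0 ≤ q := measureReal_nonneg
  have h6 : μ (bumpSet c δ N) ≤ ENNReal.ofReal (1 + 6 * q) := by
    refine (measure_bumpSet_le μ c δ N).trans ?_
    rw [← ENNReal.ofReal_toReal (isCompact_closedBall (0 : G) δ).measure_lt_top.ne]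
    change 6 * ENNReal.ofReal q ≤ _
    rw [show (6 : ℝ≥0∞) = ENNReal.ofReal 6 by simp, ← ENNReal.ofReal_mul (by norm_num)]
    exact ENNReal.ofReal_le_ofReal (by linarith)
  have h1 : (1 : ℝ≥0∞) ≤ ENNReal.ofReal (1 + 6 * q) := by
    rw [← ENNReal.ofReal_one]
    exact ENNReal.ofReal_le_ofReal (by linarith)
  calc eLpNorm ((bumpSet c δ N).indicator f) p μ
      ≤ eLpNorm ((bumpSet c δ N).indicator fun _ => (b : ℝ)) p μ := by
        refine eLpNorm_mono fun ξ => ?_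
        by_cases hξ : ξ ∈ bumpSet c δ N
        · rw [indicator_of_mem hξ, indicator_of_mem hξ, Real.norm_of_nonneg hb]
          exact hf ξ hξ
        · rw [indicator_of_notMem hξ, indicator_of_notMem hξ, norm_zero, norm_zero]
    _ ≤ ‖b‖ₑ * μ (bumpSet c δ N) ^ (1 / p.toReal) := eLpNorm_indicator_const_le _ _
    _ ≤ ENNReal.ofReal b * ENNReal.ofReal (1 + 6 * q) := by
        rw [Real.enorm_of_nonneg hb]
        gcongr
        refine (ENNReal.rpow_le_rpow h6 (by positivity)).trans ?_
        refine (ENNReal.rpow_le_rpow_of_exponent_le h1 (?_ : 1 / p.toReal ≤ 1)).trans_eq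
          (ENNReal.rpow_one _)
        rcases hp with rfl | rfl <;> norm_num
    _ = _ := (ENNReal.ofReal_mul hb).symm

end BumpNorms

variable [SecondCountableTopology G] [ProperSpace G] [μ.IsAddHaarMeasure]

/-- The nonlinearity, applied to the bumps, produces a fixed amount of low frequencies. -/
theorem le_re_setIntegralL_bump (w : SubmulWeight G) {c : ℤ →+ G} {m : G → ℝ} (hm : Measurable m)
    (hm1 : ∀ ξ, |m ξ| ≤ 1) {m₀ : ℝ} {n : ℕ} {δ : ℝ} (hm₀ : 0 ≤ m₀)
    (hml : ∀ ξ ∈ Metric.closedBall (c 1) (((n + 1 : ℕ) + 1) * δ), m₀ ≤ m ξ) {N : ℤ}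
    {x : L1L2 μ} (hx : w.unweight x.fn =ᵐ[μ] fun ξ => (bump c δ N ξ : ℂ)) :
    m₀ * μ.real (Metric.closedBall 0 δ) ^ (n + 1 + 1)
      ≤ (w.setIntegralL μ (Metric.closedBall (c 1) (((n + 1 : ℕ) + 1) * δ))
        (L1L2.mulOp μ m hm hm1 (bilinPow (w.prodL μ) (n + 1) x))).re := by
  set S := Metric.closedBall (c 1) (((n + 1 : ℕ) + 1) * δ)
  have hS : MeasurableSet S := Metric.isClosed_closedBall.measurableSet
  set h := convPow μ (bump c δ N) (n + 1)
  have hint : Integrable h μ := integrable_convPow (integrable_bump μ c δ N) _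
  have e : w.setIntegralL μ S (L1L2.mulOp μ m hm hm1 (bilinPow (w.prodL μ) (n + 1) x))
      = ((∫ ξ in S, m ξ * h ξ ∂μ : ℝ) : ℂ) := by
    rw [SubmulWeight.setIntegralL_apply, ← integral_complex_ofReal]
    refine integral_congr_ae (ae_restrict_of_ae ?_)
    filter_upwards [w.unweight_mulOp hm hm1 (bilinPow (w.prodL μ) (n + 1) x),
      w.unweight_bilinPow hx (n + 1)] with ξ h₁ h₂
    rw [h₁, h₂, Complex.ofReal_mul]
  rw [e, Complex.ofReal_re]
  calc m₀ * μ.real (Metric.closedBall 0 δ) ^ (n + 1 + 1)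
      ≤ m₀ * ∫ ξ in S, h ξ ∂μ :=
        mul_le_mul_of_nonneg_left (le_setIntegral_convPow μ c δ N n) hm₀
    _ = ∫ ξ in S, m₀ * h ξ ∂μ := (integral_const_mul _ _).symm
    _ ≤ ∫ ξ in S, m ξ * h ξ ∂μ := by
        refine setIntegral_mono_on (hint.integrableOn.const_mul _) ?_ hS fun ξ hξ => ?_
        · refine Integrable.integrableOn (hint.mono (hm.aestronglyMeasurable.mul hint.1)
            (ae_of_all _ fun ξ => ?_))
          rw [norm_mul, Real.norm_eq_abs (m ξ)]
          exact mul_le_of_le_one_left (norm_nonneg _) (hm1 ξ)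
        · exact mul_le_mul_of_nonneg_right (hml ξ hξ)
            (convPow_nonneg (bump_nonneg c δ N) _ ξ)

end Inflation

section Growth

variable {X : Type*} [NormedAddCommGroup X] [NormedSpace ℝ X]

/-- The second-order Taylor term of the solution with the data `A • x + a`, `b`, seen through a
functional `ℓ` which does not see `x` itself, grows linearly in `A`. -/
theorem mul_le_norm_functional_solution {B : X →L[ℝ] X →L[ℝ] X} {m : X →L[ℝ] X} {ℓ : X →L[ℝ] ℂ}
    (hB : ∀ x y, ‖B x y‖ ≤ ‖x‖ * ‖y‖) (hm : ∀ x, ‖m x‖ ≤ ‖x‖) (hℓ : ∀ x, ‖ℓ x‖ ≤ ‖x‖) {n : ℕ}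
    {A R F₀ F₁ κ τ T E : ℝ} {x a b y : X} (hA : 0 < A) (hT0 : 0 < T) (hTτ : T ≤ τ)
    (hT : T ^ 2 * A ^ n = τ ^ 2) (hAx : ‖A • x‖ ≤ R * A) (hAxa : ‖A • x + a‖ ≤ R * A)
    (ha : ‖a‖ ≤ F₀) (hb : ‖b‖ ≤ F₁) (hℓx : ℓ x = 0) (hκ : κ ≤ (ℓ (m (bilinPow B n x))).re)
    (hy : ‖y - (A • x + a) - T • b + (T ^ 2 / 2) • m (bilinPow B n (A • x + a))‖ ≤ E) :
    τ ^ 2 / 2 * A * κ ≤ ‖ℓ y‖ + (E + F₀ + τ * F₁ + τ ^ 2 * ((n + 1) * R ^ n * F₀)) := by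
  have hR : 0 ≤ R := nonneg_of_mul_nonneg_left ((norm_nonneg _).trans hAx) hA
  have hF₀ : 0 ≤ F₀ := (norm_nonneg _).trans ha
  have hF₁ : 0 ≤ F₁ := (norm_nonneg _).trans hb
  set P := bilinPow B n
  set e := y - (A • x + a) - T • b + (T ^ 2 / 2) • m (P (A • x + a)) with he
  have hP : ‖P (A • x + a) - P (A • x)‖ ≤ (n + 1) * (R * A) ^ n * F₀ := by
    refine (norm_bilinPow_sub_le hB n hAxa hAx).trans ?_
    rw [add_sub_cancel_left]
    gcongr
  have hdecomp : (T ^ 2 / 2 * A ^ (n + 1)) • m (P x)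
      = e - y + a + A • x + T • b - (T ^ 2 / 2) • m (P (A • x + a) - P (A • x)) := by
    have : P (A • x) = A ^ (n + 1) • P x := bilinPow_smul _ _ _
    rw [map_sub, this, map_smul, smul_sub, smul_smul, he]
    abel
  have hTA : T ^ 2 / 2 * A ^ (n + 1) = τ ^ 2 / 2 * A := by
    rw [pow_succ A n, ← hT]
    ring
  have n₃ : ‖T • ℓ b‖ ≤ τ * F₁ := by
    rw [norm_smul, Real.norm_of_nonneg hT0.le]
    exact mul_le_mul hTτ ((hℓ b).trans hb) (norm_nonneg _) (hT0.le.trans hTτ)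
  have n₄ : ‖(T ^ 2 / 2) • ℓ (m (P (A • x + a) - P (A • x)))‖
      ≤ τ ^ 2 * ((n + 1) * R ^ n * F₀) := by
    rw [norm_smul, Real.norm_of_nonneg (by positivity)]
    calc _ ≤ T ^ 2 / 2 * ((n + 1) * (R * A) ^ n * F₀) := by
          gcongr
          exact (hℓ _).trans ((hm _).trans hP)
      _ = (T ^ 2 * A ^ n) / 2 * ((n + 1) * R ^ n * F₀) := by
          rw [mul_pow]
          ring
      _ ≤ _ := by
          rw [hT]
          gcongr
          linarith [sq_nonneg τ]
  calc τ ^ 2 / 2 * A * κ ≤ ‖ℓ ((T ^ 2 / 2 * A ^ (n + 1)) • m (P x))‖ := by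
        rw [map_smul, norm_smul, hTA, Real.norm_of_nonneg (by positivity)]
        gcongr
        exact hκ.trans ((le_abs_self _).trans (Complex.abs_re_le_norm _))
    _ = ‖ℓ e - ℓ y + ℓ a + T • ℓ b - (T ^ 2 / 2) • ℓ (m (P (A • x + a) - P (A • x)))‖ := by
        rw [hdecomp, map_sub, map_add, map_add, map_add, map_sub, map_smul, map_smul, map_smul,
          hℓx, smul_zero, add_zero]
    _ ≤ ‖ℓ e‖ + ‖ℓ y‖ + ‖ℓ a‖ + ‖T • ℓ b‖
          + ‖(T ^ 2 / 2) • ℓ (m (P (A • x + a) - P (A • x)))‖ := by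
        refine (norm_sub_le _ _).trans (add_le_add ?_ le_rfl)
        refine (norm_add_le _ _).trans (add_le_add ?_ le_rfl)
        exact (norm_add_le _ _).trans (add_le_add (norm_sub_le _ _) le_rfl)
    _ ≤ _ := by linarith [(hℓ e).trans hy, (hℓ a).trans ha]

/-- Growth of the solutions with the data `A • x + a`, `b`, measured by a functional `ℓ` which does
not see `x` but sees its power. The size `A` is chosen before the product, the functional and the
data. The symmetries of the equation are preserved. -/
theorem exists_solution_lt_norm_functional [CompleteSpace X] {n : ℕ} (hn : n ≠ 0) {D F₀ F₁ κ ε : ℝ}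
    (hD : 0 ≤ D) (hF₀ : 0 ≤ F₀) (hF₁ : 0 ≤ F₁) (hκ : 0 < κ) (hε : 0 < ε) (L : ℝ) :
    ∃ A : ℝ, 0 < A ∧ ∀ (B : X →L[ℝ] X →L[ℝ] X) (m : X →L[ℝ] X) (ℓ : X →L[ℝ] ℂ) (x a b : X),
      (∀ x y, ‖B x y‖ ≤ ‖x‖ * ‖y‖) → (∀ x, ‖m x‖ ≤ ‖x‖) → (∀ x, ‖ℓ x‖ ≤ ‖x‖) →
      ‖x‖ ≤ D → ‖a‖ ≤ F₀ → ‖b‖ ≤ F₁ → ℓ x = 0 → κ ≤ (ℓ (m (bilinPow B n x))).re →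
      ∃ T ∈ Ioo 0 ε, ∃ U V W : ℝ → X, U 0 = A • x + a ∧ V 0 = b ∧
        (∀ t ∈ Icc 0 T, HasDerivWithinAt U (V t) (Icc 0 T) t) ∧
        (∀ t ∈ Icc 0 T, HasDerivWithinAt V (W t) (Icc 0 T) t) ∧
        ContinuousOn W (Icc 0 T) ∧
        (∀ t, W t = -m (U t + bilinPow B n (U t))) ∧
        L < ‖ℓ (U T)‖ ∧
        ∀ σ : X →L[ℝ] X, (∀ x, ‖σ x‖ ≤ ‖x‖) → (∀ x y, σ (B x y) = B (σ x) (σ y)) →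
          (∀ x, σ (m x) = m (σ x)) → σ x = x → σ a = a → σ b = b →
            ∀ t ∈ Icc 0 T, σ (U t) = U t := by
  set R := D + 1 with hR
  have hR0 : 0 < R := by positivity
  obtain ⟨K, hK⟩ : ∃ K : ℝ, K = 2 * (n + 1) * (R + 1) ^ (n + 1) := ⟨_, rfl⟩
  have hK0 : 0 < K := by rw [hK]; positivity
  -- `K * τ ≤ 1` makes the solution exist, `K ^ 2 * τ ≤ κ / 8` makes the second-order term dominate.
  obtain ⟨τ, hτ0, hτK, hτκ⟩ : ∃ τ : ℝ, 0 < τ ∧ K * τ ≤ 1 ∧ K ^ 2 * τ ≤ κ / 8 := by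
    refine ⟨min (1 / K) (κ / (8 * K ^ 2)), lt_min (by positivity) (by positivity), ?_, ?_⟩
    · have : min (1 / K) (κ / (8 * K ^ 2)) ≤ 1 / K := min_le_left _ _
      rwa [le_div_iff₀ hK0, mul_comm] at this
    · have : min (1 / K) (κ / (8 * K ^ 2)) ≤ κ / (8 * K ^ 2) := min_le_right _ _
      rw [le_div_iff₀ (by positivity)] at this
      linarith
  obtain ⟨C, hC⟩ : ∃ C : ℝ,
    C = (R + 1) * τ ^ 2 + F₀ + τ * F₁ + τ ^ 2 * ((n + 1) * R ^ n * F₀) := ⟨_, rfl⟩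
  have hC0 : 0 ≤ C := by rw [hC]; positivity
  have hd : 0 < τ ^ 2 * κ / 8 := by positivity
  obtain ⟨A, hA⟩ : ∃ A : ℝ, A = 1 + F₀ + F₁ + (τ / ε) ^ 2 + (C + |L|) / (τ ^ 2 * κ / 8) := ⟨_, rfl⟩
  have h₁ : 0 ≤ (C + |L|) / (τ ^ 2 * κ / 8) := by positivity
  have h₂ := sq_nonneg (τ / ε)
  have hA1 : 1 ≤ A := by linarith
  have hA0 : 0 < A := by linarith
  have hAF₀ : F₀ ≤ A := by linarith
  have hAF₁ : F₁ ≤ A := by linarith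
  have hAε : (τ / ε) ^ 2 < A := by linarith
  have hAC : C + L < τ ^ 2 * κ / 4 * A := by
    have h₃ : (C + |L|) / (τ ^ 2 * κ / 8) ≤ A := by linarith
    rw [div_le_iff₀ hd] at h₃
    have : 0 < τ ^ 2 * κ / 8 * A := by positivity
    linarith [le_abs_self L]
  refine ⟨A, hA0, fun B m ℓ x a b hB hm hℓ hx ha hb hℓx hκx => ?_⟩
  have hsq : Real.sqrt (A ^ n) ^ 2 = A ^ n := Real.sq_sqrt (by positivity)
  have hsq1 : 1 ≤ Real.sqrt (A ^ n) := Real.one_le_sqrt.mpr (one_le_pow₀ hA1)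
  obtain ⟨T, hT⟩ : ∃ T : ℝ, T = τ / Real.sqrt (A ^ n) := ⟨_, rfl⟩
  have hT0 : 0 < T := by rw [hT]; positivity
  have hT2 : T ^ 2 * A ^ n = τ ^ 2 := by
    rw [hT, div_pow, hsq]
    field_simp
  have hTτ : T ≤ τ := hT ▸ div_le_self hτ0.le hsq1
  have hTε : T < ε := by
    refine lt_of_pow_lt_pow_left₀ 2 hε.le ?_
    rw [hT, div_pow, hsq, div_lt_iff₀ (by positivity)]
    rw [div_pow, div_lt_iff₀ (by positivity)] at hAε
    have : ε ^ 2 * A ≤ ε ^ 2 * A ^ n := by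
      gcongr
      exact le_self_pow₀ hA1 hn
    linarith
  have hAx : ‖A • x‖ ≤ D * A := by
    rw [norm_smul, Real.norm_of_nonneg hA0.le, mul_comm]
    gcongr
  have hdata : ‖A • x + a‖ ≤ R * A := by
    have := norm_add_le (A • x) a
    rw [hR]
    linarith
  have hb' : ‖b‖ ≤ R * A := by
    have : 0 ≤ D * A := by positivity
    rw [hR]
    linarith
  obtain ⟨U, V, W, hU0, hV0, hU, hV, hWc, hW, hTay, hsym⟩ :=
    exists_solution_of_large_data hB hm hn hR0.le hK hτ0 hτK hA1 hT0 hT2 hdata hb'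
  refine ⟨T, ⟨hT0, hTε⟩, U, V, W, hU0, hV0, hU, hV, hWc, hW, ?_,
    fun σ hσ₁ hσB hσm hσx hσa hσb => hsym σ hσ₁ hσB hσm (by rw [map_add, map_smul, hσx, hσa]) hσb⟩
  have hgrow := mul_le_norm_functional_solution hB hm hℓ hA0 hT0 hTτ hT2
    (hAx.trans (by rw [hR]; linarith)) hdata ha hb hℓx hκx hTay
  have : K ^ 2 * τ ^ 3 * A ≤ τ ^ 2 * κ / 8 * A := by
    have : K ^ 2 * τ * (τ ^ 2 * A) ≤ κ / 8 * (τ ^ 2 * A) := by gcongr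
    linarith
  have : 0 < τ ^ 2 * κ / 8 * A := by positivity
  linarith

end Growth

section InflationTheorem

variable {G : Type*} [NormedAddCommGroup G] [MeasurableSpace G] [BorelSpace G]
  [SecondCountableTopology G] [ProperSpace G]

/-- Norm inflation on the Fourier side, for frequencies in a group `G` that contains the integers
isometrically and for a bounded even multiplier `m` which is bounded below near the frequency `1`.
The functions `g₀` and `g₁` are the Fourier transforms of the data, multiplied by the Sobolev
weight. The function `P` is the Fourier transform of the power of the solution: this is what the
statement about the characters `χ` expresses. -/
theorem exists_norm_inflation (μ : Measure G) [μ.IsAddHaarMeasure] [μ.IsNegInvariant]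
    (c : ℤ →+ G) (hc : ∀ ν, ‖c ν‖ = |(ν : ℝ)|) {m : G → ℝ} (hm : Measurable m)
    (hm1 : ∀ ξ, |m ξ| ≤ 1) (hmneg : ∀ ξ, m (-ξ) = m ξ) {m₀ : ℝ} (hm₀ : 0 < m₀)
    (hml : ∀ ξ ∈ Metric.closedBall (c 1) (1 / 2), m₀ ≤ m ξ) {k : ℕ} (hk : 2 ≤ k) {s : ℝ} (θ : ℝ)
    (hs : s < 0) {g₀ g₁ : G → ℂ} (hg₀ : MemLp g₀ 2 μ) (hg₁ : MemLp g₁ 2 μ) {ε : ℝ} (hε : 0 < ε) :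
    ∃ T ∈ Ioo 0 ε, ∃ U V W : ℝ → Lp ℂ 1 μ,
      (∀ t ∈ Icc 0 T, HasDerivWithinAt U (V t) (Icc 0 T) t) ∧
      (∀ t ∈ Icc 0 T, HasDerivWithinAt V (W t) (Icc 0 T) t) ∧
      ContinuousOn W (Icc 0 T) ∧
      (∀ t, ∃ P : G → ℂ, Integrable P μ ∧
        (∀ χ : G → ℂ, Measurable χ → (∀ ξ, ‖χ ξ‖ = 1) → (∀ ξ η, χ (ξ + η) = χ ξ * χ η) →
          ∫ ξ, χ ξ * P ξ ∂μ = (∫ ξ, χ ξ * U t ξ ∂μ) ^ k) ∧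
        W t =ᵐ[μ] fun ξ => -(m ξ * (U t ξ + P ξ))) ∧
      (IsHermitianSymbol μ g₀ → IsHermitianSymbol μ g₁ →
        ∀ t ∈ Icc 0 T, IsHermitianSymbol μ (U t)) ∧
      eLpNorm (fun ξ => (bracket s ξ : ℂ) * U 0 ξ - g₀ ξ) 2 μ
        + eLpNorm (fun ξ => (bracket s ξ : ℂ) * V 0 ξ - g₁ ξ) 2 μ < ENNReal.ofReal ε ∧
      ENNReal.ofReal ε⁻¹ < eLpNorm (fun ξ => (bracket θ ξ : ℂ) * U T ξ) 2 μ ∧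
      MemLp (fun ξ => (bracket θ ξ : ℂ) * U T ξ) 2 μ := by
  obtain ⟨n, rfl⟩ : ∃ n, k = n + 1 + 1 := ⟨k - 2, by omega⟩
  have hn0 : (0 : ℝ) ≤ n := n.cast_nonneg
  -- `n + 2` copies of a ball of radius `δ` add up to a ball of radius `1 / 2`.
  set δ : ℝ := 1 / (2 * ((n + 1 : ℕ) + 1)) with hδ
  have hδ0 : 0 < δ := by positivity
  have hδ1 : δ ≤ 1 := by
    rw [hδ, div_le_one (by positivity)]
    push_cast
    linarith
  have hδn : ((n + 1 : ℕ) + 1) * δ = 1 / 2 := by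
    rw [hδ]
    push_cast
    field_simp
  set S := Metric.closedBall (c 1) (1 / 2) with hS
  have hSm : MeasurableSet S := Metric.isClosed_closedBall.measurableSet
  have hSfin : μ S ≠ ⊤ := (isCompact_closedBall (c 1) (1 / 2)).measure_lt_top.ne
  have hc1 : ‖c 1‖ = 1 := by rw [hc]; simp
  have hSnorm : ∀ ξ ∈ S, ‖ξ‖ ≤ 3 / 2 := fun ξ hξ => by
    rw [hS, Metric.mem_closedBall, dist_eq_norm] at hξ
    linarith [norm_le_norm_add_norm_sub' ξ (c 1)]
  set q := μ.real (Metric.closedBall (0 : G) δ) with hq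
  have hq0 : 0 < q := ENNReal.toReal_pos (Metric.measure_closedBall_pos μ 0 hδ0).ne'
    (isCompact_closedBall (0 : G) δ).measure_lt_top.ne
  set κ := m₀ * q ^ (n + 1 + 1) with hκ
  have hκ0 : 0 < κ := by positivity
  obtain ⟨p, hp⟩ := exists_nat_ge θ
  set Q := 1 + 6 * q with hQ
  have hQ0 : 0 < Q := by positivity
  obtain ⟨r₀, F₀, f₀, hr₀, hF₀, hf₀supp, hf₀1, hf₀2, hf₀1F, hf₀2F, hf₀g, hf₀herm⟩ :=
    exists_cutoff s hg₀ (η := ε / 4) (by positivity)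
  obtain ⟨r₁, F₁, f₁, hr₁, hF₁, hf₁supp, hf₁1, hf₁2, hf₁1F, hf₁2F, hf₁g, hf₁herm⟩ :=
    exists_cutoff s hg₁ (η := ε / 4) (by positivity)
  set Λ := (1 + (3 / 2 : ℝ) ^ 2) ^ (|θ| / 2) * (1 + μ.real S) with hΛ
  have hΛ0 : 0 < Λ := by
    have : 0 ≤ μ.real S := measureReal_nonneg
    positivity
  have h2p : (0 : ℝ) ≤ 2 ^ p := by positivity
  -- The size of the perturbation.
  obtain ⟨A, hA0, hA⟩ := exists_solution_lt_norm_functional (X := L1L2 μ) (Nat.succ_ne_zero n)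
    (mul_nonneg h2p hQ0.le) (mul_nonneg h2p hF₀) (mul_nonneg h2p hF₁) hκ0 hε (ε⁻¹ * Λ)
  -- The frequency of the perturbation.
  obtain ⟨N, hN3, hNs⟩ : ∃ N : ℕ, 3 ≤ N ∧ A * (((N : ℝ) - 1) ^ s * Q) < ε / 4 := by
    have ht : Filter.Tendsto (fun N : ℕ => A * (((N : ℝ) - 1) ^ s * Q)) Filter.atTop
        (nhds (A * (0 * Q))) := by
      refine Filter.Tendsto.const_mul A (Filter.Tendsto.mul_const Q ?_)
      have h₁ := tendsto_rpow_neg_atTop (y := -s) (by linarith)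
      rw [neg_neg] at h₁
      exact h₁.comp (Filter.tendsto_atTop_add_const_right _ (-1) tendsto_natCast_atTop_atTop)
    rw [zero_mul, mul_zero] at ht
    obtain ⟨N, h₁, h₂⟩ := ((Filter.eventually_ge_atTop 3).and
      (ht.eventually_lt_const (show (0 : ℝ) < ε / 4 by positivity))).exists
    exact ⟨N, h₁, h₂⟩
  have hN3' : (3 : ℝ) ≤ N := by exact_mod_cast hN3
  set M : ℝ := r₀ + r₁ + (2 * N + 2) with hM
  have hM1 : 1 ≤ M := by linarith
  set w := polyWeight G p M hM1
  have hwle : ∀ ξ : G, ‖ξ‖ ≤ M → w.toFun ξ ≤ 2 ^ p := fun ξ h => polyWeight_le hM1 h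
  -- The symbols of the data as elements of the weighted space.
  obtain ⟨a, hau, hanorm⟩ := w.exists_unweight_eq h2p hf₀1 hf₀2
    fun ξ hξ => hwle ξ ((hf₀supp ξ hξ).trans (by linarith))
  obtain ⟨b, hbu, hbnorm⟩ := w.exists_unweight_eq h2p hf₁1 hf₁2
    fun ξ hξ => hwle ξ ((hf₁supp ξ hξ).trans (by linarith))
  replace hanorm := hanorm F₀ hF₀ hf₀1F hf₀2F
  replace hbnorm := hbnorm F₁ hF₁ hf₁1F hf₁2F
  have hbumpC : (fun ξ => (bump c δ N ξ : ℂ)) = (bumpSet c δ N).indicator fun _ => 1 := by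
    ext ξ
    by_cases hξ : ξ ∈ bumpSet c δ N <;> simp [bump, hξ]
  have hbumpnorm : ∀ q' : ℝ≥0∞, q' = 1 ∨ q' = 2 →
      eLpNorm (fun ξ => (bump c δ N ξ : ℂ)) q' μ ≤ ENNReal.ofReal Q := fun q' hq' => by
    rw [hbumpC, ← one_mul Q]
    exact eLpNorm_indicator_bumpSet_le c δ N zero_le_one (fun ξ _ => by simp) hq'
  have hbumpmem : ∀ q' : ℝ≥0∞, q' = 1 ∨ q' = 2 → MemLp (fun ξ => (bump c δ N ξ : ℂ)) q' μ :=
    fun q' hq' => ⟨by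
      rw [hbumpC]
      exact aestronglyMeasurable_const.indicator (measurableSet_bumpSet c δ N),
      (hbumpnorm q' hq').trans_lt ENNReal.ofReal_lt_top⟩
  have hbumpsupp : ∀ ξ, (bump c δ N ξ : ℂ) ≠ 0 → ξ ∈ bumpSet c δ N := fun ξ hξ => by
    by_contra h
    exact hξ (by rw [bump, indicator_of_notMem h, Complex.ofReal_zero])
  have hNnorm : ∀ ξ ∈ bumpSet c δ N, (N : ℝ) - 1 ≤ ‖ξ‖ ∧ ‖ξ‖ ≤ 2 * N + 2 := fun ξ hξ => by
    simpa using norm_of_mem_bumpSet hc hδ1 (Int.natCast_nonneg N) hξ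
  obtain ⟨x, hxu, hxnorm⟩ := w.exists_unweight_eq h2p (hbumpmem 1 (.inl rfl))
    (hbumpmem 2 (.inr rfl)) fun ξ hξ => hwle ξ
      ((hNnorm ξ (hbumpsupp ξ hξ)).2.trans (by linarith))
  replace hxnorm := hxnorm Q hQ0.le (hbumpnorm 1 (.inl rfl)) (hbumpnorm 2 (.inr rfl))
  set mul := L1L2.mulOp μ m hm hm1 with hmul
  -- The low-frequency part.
  set ℓ := w.setIntegralL μ S with hℓ
  have hℓx : ℓ x = 0 := by
    rw [hℓ, SubmulWeight.setIntegralL_apply]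
    refine integral_eq_zero_of_ae ?_
    filter_upwards [ae_restrict_of_ae hxu, ae_restrict_mem hSm] with ξ h₁ h₂
    rw [h₁]
    by_contra hne
    have h₃ := (hNnorm ξ (hbumpsupp ξ hne)).1
    linarith [hSnorm ξ h₂]
  have hlow : κ ≤ (ℓ (mul (bilinPow (w.prodL μ) (n + 1) x))).re := by
    have := le_re_setIntegralL_bump w hm hm1 (c := c) (n := n) (δ := δ) hm₀.le
      (by rwa [hδn]) hxu
    rwa [hδn] at this
  obtain ⟨T, hTmem, U, V, W, hU0, hV0, hU, hV, hWc, hW, hbig, hsym⟩ := hA (w.prodL μ) mul ℓ x a b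
    w.norm_prodL_le (L1L2.norm_mulOp_le hm hm1) (w.norm_setIntegralL_le S) hxnorm hanorm hbnorm hℓx
    hlow
  have htoL1 : ∀ {X X' : ℝ → L1L2 μ}, (∀ t ∈ Icc 0 T, HasDerivWithinAt X (X' t) (Icc 0 T) t) →
      ∀ t ∈ Icc 0 T, HasDerivWithinAt (fun t => w.toL1 μ (X t)) (w.toL1 μ (X' t)) (Icc 0 T) t :=
    fun h t ht => (w.toL1 μ).hasFDerivAt.comp_hasDerivWithinAt t (h t ht)
  have hUTae : (fun ξ => (bracket θ ξ : ℂ) * w.toL1 μ (U T) ξ) =ᵐ[μ]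
      fun ξ => (bracket θ ξ : ℂ) * w.unweight (U T).fn ξ := by
    filter_upwards [w.coeFn_toL1 (U T)] with ξ h
    rw [h]
  refine ⟨T, hTmem, fun t => w.toL1 μ (U t), fun t => w.toL1 μ (V t), fun t => w.toL1 μ (W t),
    htoL1 hU, htoL1 hV, (w.toL1 μ).continuous.comp_continuousOn hWc, fun t => ?_, ?_, ?_, ?_, ?_⟩
  · refine ⟨w.unweight (bilinPow (w.prodL μ) (n + 1) (U t)).fn,
      w.integrable_unweight (L1L2.integrable _), fun χ hχm hχ hadd => ?_, ?_⟩
    · rw [w.integral_char_bilinPow hχm hχ hadd]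
      congr 1
      refine integral_congr_ae ?_
      filter_upwards [w.coeFn_toL1 (U t)] with ξ h
      rw [h]
    · filter_upwards [w.coeFn_toL1 (W t), w.coeFn_toL1 (U t),
        w.unweight_neg (mul (U t + bilinPow (w.prodL μ) (n + 1) (U t))),
        w.unweight_mulOp hm hm1 (U t + bilinPow (w.prodL μ) (n + 1) (U t)),
        w.unweight_add (U t) (bilinPow (w.prodL μ) (n + 1) (U t))] with ξ h₁ h₂ h₃ h₄ h₅
      rw [h₁, h₂, hW, h₃, hmul, h₄, h₅]
  · intro hh₀ hh₁ t ht
    have hxσ : L1L2.conjNeg μ x = x := by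
      rw [w.conjNeg_eq_iff]
      filter_upwards [hxu, (Measure.measurePreserving_neg μ).quasiMeasurePreserving.ae_eq_comp hxu]
        with ξ h₁ h₂
      simp only [Function.comp_apply] at h₂
      rw [h₁, h₂, Complex.conj_ofReal]
      congr 1
      by_cases hξ : ξ ∈ bumpSet c δ N
      · rw [bump, indicator_of_mem hξ, indicator_of_mem (neg_mem_bumpSet hξ)]
        rfl
      · have hξ' : -ξ ∉ bumpSet c δ N := fun h => hξ (by simpa using neg_mem_bumpSet h)
        rw [bump, indicator_of_notMem hξ, indicator_of_notMem hξ']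
    have hσ : ∀ {y : L1L2 μ} {f : G → ℂ}, w.unweight y.fn =ᵐ[μ] f → IsHermitianSymbol μ f →
        L1L2.conjNeg μ y = y := fun {y f} hy hf => by
      rw [w.conjNeg_eq_iff]
      filter_upwards [hy, hf,
        (Measure.measurePreserving_neg μ).quasiMeasurePreserving.ae_eq_comp hy] with ξ h₁ h₂ h₃
      simp only [Function.comp_apply] at h₃
      rw [h₁, h₃, h₂]
    have hmulσ : ∀ y, L1L2.conjNeg μ (mul y) = mul (L1L2.conjNeg μ y) := fun y => by
      apply L1L2.ext_ae
      filter_upwards [L1L2.fn_conjNeg (mul y), L1L2.fn_mulOp hm hm1 (L1L2.conjNeg μ y),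
        L1L2.fn_conjNeg y, (Measure.measurePreserving_neg μ).quasiMeasurePreserving.ae_eq_comp
          (L1L2.fn_mulOp hm hm1 y)] with ξ h₁ h₂ h₃ h₄
      simp only [Function.comp_apply] at h₄
      rw [h₁, hmul, h₂, h₃, h₄, map_mul, Complex.conj_ofReal, hmneg]
    have h := hsym (L1L2.conjNeg μ) L1L2.norm_conjNeg_le w.conjNeg_prodL hmulσ
      hxσ (hσ hau (hf₀herm hh₀)) (hσ hbu (hf₁herm hh₁)) t ht
    rw [w.conjNeg_eq_iff] at h
    have h' := w.coeFn_toL1 (U t)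
    filter_upwards [h, h', (Measure.measurePreserving_neg μ).quasiMeasurePreserving.ae_eq_comp h']
      with ξ h₁ h₂ h₃
    simp only [Function.comp_apply] at h₃
    rw [h₂, h₃, h₁]
  · have e₀ : (fun ξ => (bracket s ξ : ℂ) * w.toL1 μ (U 0) ξ - g₀ ξ) =ᵐ[μ]
        (fun ξ => (bracket s ξ : ℂ) * f₀ ξ - g₀ ξ) +
          (bumpSet c δ N).indicator fun ξ => ((A * bracket s ξ : ℝ) : ℂ) := by
      filter_upwards [w.coeFn_toL1 (U 0), w.unweight_add (A • x) a, w.unweight_smul A x, hxu, hau]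
        with ξ h₁ h₂ h₃ h₄ h₅
      rw [h₁, hU0, h₂, h₃, h₄, h₅, Pi.add_apply]
      by_cases hξ : ξ ∈ bumpSet c δ N
      · simp [bump, hξ]
        ring
      · simp [bump, hξ]
    have e₁ : (fun ξ => (bracket s ξ : ℂ) * w.toL1 μ (V 0) ξ - g₁ ξ) =ᵐ[μ]
        fun ξ => (bracket s ξ : ℂ) * f₁ ξ - g₁ ξ := by
      filter_upwards [w.coeFn_toL1 (V 0), hbu] with ξ h₁ h₂
      rw [h₁, hV0, h₂]
    have hbr : eLpNorm ((bumpSet c δ N).indicator fun ξ => ((A * bracket s ξ : ℝ) : ℂ)) 2 μ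
        ≤ ENNReal.ofReal (ε / 4) := by
      refine (eLpNorm_indicator_bumpSet_le c δ N (b := A * ((N : ℝ) - 1) ^ s) ?_ (fun ξ hξ => ?_)
        (.inr rfl)).trans (ENNReal.ofReal_le_ofReal ?_)
      · exact mul_nonneg hA0.le (Real.rpow_nonneg (by linarith) _)
      · rw [Complex.norm_real, Real.norm_of_nonneg (mul_nonneg hA0.le (bracket_pos _ _).le)]
        exact mul_le_mul_of_nonneg_left
          (bracket_le_of_le_norm hs.le (by linarith) (hNnorm ξ hξ).1) hA0.le
      · rw [mul_assoc]
        exact hNs.le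
    have hmeas₀ : AEStronglyMeasurable (fun ξ => (bracket s ξ : ℂ) * f₀ ξ - g₀ ξ) μ :=
      ((Complex.continuous_ofReal.comp
        (continuous_bracket s)).measurable.aestronglyMeasurable.mul hf₀1.1).sub hg₀.1
    have hmeas₁ : AEStronglyMeasurable
        ((bumpSet c δ N).indicator fun ξ => ((A * bracket s ξ : ℝ) : ℂ)) μ :=
      (Complex.continuous_ofReal.comp
        (continuous_const.mul (continuous_bracket s))).measurable.aestronglyMeasurable.indicator
        (measurableSet_bumpSet c δ N)
    rw [eLpNorm_congr_ae e₀, eLpNorm_congr_ae e₁]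
    calc _ ≤ (eLpNorm (fun ξ => (bracket s ξ : ℂ) * f₀ ξ - g₀ ξ) 2 μ + ENNReal.ofReal (ε / 4))
          + ENNReal.ofReal (ε / 4) := by
          gcongr
          exact (eLpNorm_add_le hmeas₀ hmeas₁ (by norm_num)).trans (by gcongr)
      _ ≤ (ENNReal.ofReal (ε / 4) + ENNReal.ofReal (ε / 4)) + ENNReal.ofReal (ε / 4) := by gcongr
      _ = ENNReal.ofReal (ε / 4 + ε / 4 + ε / 4) := by
          rw [ENNReal.ofReal_add (by positivity) (by positivity),
            ENNReal.ofReal_add (by positivity) (by positivity)]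
      _ < ENNReal.ofReal ε := (ENNReal.ofReal_lt_ofReal_iff hε).mpr (by linarith)
  · rw [eLpNorm_congr_ae hUTae]
    have hupper : ‖ℓ (U T)‖ₑ ≤ ENNReal.ofReal Λ *
        eLpNorm (fun ξ => (bracket θ ξ : ℂ) * w.unweight (U T).fn ξ) 2 μ := by
      refine (enorm_setIntegral_le hSnorm hSm (θ := θ)
        (w.integrable_unweight (U T).integrable).1).trans ?_
      rw [hΛ, ENNReal.ofReal_mul (by positivity), mul_assoc,
        mul_comm (eLpNorm _ 2 μ)]
      gcongr
      have h1 : (1 : ℝ≥0∞) ≤ ENNReal.ofReal (1 + μ.real S) := by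
        rw [← ENNReal.ofReal_one]
        exact ENNReal.ofReal_le_ofReal (by linarith [measureReal_nonneg (μ := μ) (s := S)])
      have h2 : μ S ≤ ENNReal.ofReal (1 + μ.real S) := by
        rw [ENNReal.le_ofReal_iff_toReal_le hSfin
          (by linarith [measureReal_nonneg (μ := μ) (s := S)])]
        change μ.real S ≤ _
        linarith
      refine (ENNReal.rpow_le_rpow h2 (by norm_num)).trans ?_
      exact (ENNReal.rpow_le_rpow_of_exponent_le h1 (by norm_num)).trans_eq (ENNReal.rpow_one _)
    have hlt : ENNReal.ofReal Λ * ENNReal.ofReal ε⁻¹ < ENNReal.ofReal Λ *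
        eLpNorm (fun ξ => (bracket θ ξ : ℂ) * w.unweight (U T).fn ξ) 2 μ := by
      refine lt_of_lt_of_le ?_ hupper
      rw [← ENNReal.ofReal_mul hΛ0.le, ← ofReal_norm]
      exact (ENNReal.ofReal_lt_ofReal_iff ((by positivity : (0 : ℝ) < ε⁻¹ * Λ).trans hbig)).mpr
        (by linarith)
    exact lt_of_mul_lt_mul_left' hlt
  · exact (memLp_bracket_mul hp hM1 (U T)).ae_eq hUTae.symm

end InflationTheorem

/-! ### The symbol of the equation -/

section Symbol

variable {G : Type*} [NormedAddCommGroup G]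

/-- The multiplier `4π²|ξ|² / (1 + 4π²|ξ|²)` of the equation solved for `∂_t² u`. -/
noncomputable def boussinesqSymbol (ξ : G) : ℝ :=
  (2 * Real.pi) ^ 2 * ‖ξ‖ ^ 2 / (1 + (2 * Real.pi) ^ 2 * ‖ξ‖ ^ 2)

theorem boussinesqSymbol_mul (ξ : G) : (boussinesqSymbol ξ : ℂ) *
    (1 + (2 * Real.pi) ^ 2 * (‖ξ‖ : ℂ) ^ 2) = (2 * Real.pi) ^ 2 * (‖ξ‖ : ℂ) ^ 2 := by
  have : boussinesqSymbol ξ * (1 + (2 * Real.pi) ^ 2 * ‖ξ‖ ^ 2) = (2 * Real.pi) ^ 2 * ‖ξ‖ ^ 2 :=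
    div_mul_cancel₀ _ (by positivity)
  exact_mod_cast this

theorem abs_boussinesqSymbol_le (ξ : G) : |boussinesqSymbol ξ| ≤ 1 := by
  rw [abs_of_nonneg (by unfold boussinesqSymbol; positivity), boussinesqSymbol,
    div_le_one (by positivity)]
  linarith

theorem boussinesqSymbol_neg (ξ : G) : boussinesqSymbol (-ξ) = boussinesqSymbol ξ := by
  simp [boussinesqSymbol]

theorem measurable_boussinesqSymbol [MeasurableSpace G] [BorelSpace G] :
    Measurable (boussinesqSymbol : G → ℝ) := by
  unfold boussinesqSymbol
  fun_prop

theorem le_boussinesqSymbol {x ξ : G} (hx : ‖x‖ = 1) (hξ : ξ ∈ Metric.closedBall x (1 / 2)) :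
    1 / 2 ≤ boussinesqSymbol ξ := by
  rw [Metric.mem_closedBall, dist_eq_norm] at hξ
  have h₁ : 1 / 2 ≤ ‖ξ‖ := by
    have := norm_le_norm_add_norm_sub ξ x
    linarith
  have h₂ : 1 ≤ Real.pi := by linarith [Real.pi_gt_three]
  have h₃ : 1 ≤ (2 * Real.pi) ^ 2 * ‖ξ‖ ^ 2 := by
    rw [← mul_pow]
    refine one_le_pow₀ ?_
    nlinarith
  rw [boussinesqSymbol, le_div_iff₀ (by linarith)]
  linarith

end Symbol

/-! ### From the Fourier side to the line -/

namespace Line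

open FourierTransform TemperedDistribution

theorem toDistribution_apply (f : ℝ →ᵇ ℂ) (φ : 𝓢(ℝ, ℂ)) :
    toDistribution f φ = ∫ x, φ x * f x := by
  rw [toDistribution, Lp.toTemperedDistribution_apply]
  refine integral_congr_ae ?_
  filter_upwards [(BoundedContinuousFunction.memLp_top (μ := (volume : Measure ℝ)) f).coeFn_toLp]
    with x hx
  rw [hx, smul_eq_mul]

theorem fourier_toDistribution (a : Lp ℂ 1 (volume : Measure ℝ)) :
    𝓕 (toDistribution (Real.Lp.fourierTransformInv a)) = (a : 𝓢'(ℝ, ℂ)) := by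
  ext φ
  rw [TemperedDistribution.fourier_apply, toDistribution_apply, Lp.toTemperedDistribution_apply]
  have h := VectorFourier.integral_fourierIntegral_smul_eq_flip (μ := volume) (ν := volume)
    (L := -innerₗ ℝ) (e := Real.fourierChar) (f := (a : ℝ → ℂ)) (g := (𝓕 φ : 𝓢(ℝ, ℂ)))
    Real.continuous_fourierChar (continuous_inner (𝕜 := ℝ) (E := ℝ)).neg
    (L1.integrable_coeFn a) (𝓕 φ : 𝓢(ℝ, ℂ)).integrable
  have hinv : VectorFourier.fourierIntegral Real.fourierChar volume (-innerₗ ℝ).flip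
      (𝓕 φ : 𝓢(ℝ, ℂ)) = φ := by
    have : ((𝓕⁻ (𝓕 φ : 𝓢(ℝ, ℂ)) : 𝓢(ℝ, ℂ)) : ℝ → ℂ) = φ := by
      rw [fourierInv_fourier_eq]
    rw [SchwartzMap.fourierInv_coe] at this
    have hflip : (-innerₗ ℝ).flip = -innerₗ ℝ := by
      ext
      simp
    rw [hflip]
    exact this
  rw [hinv] at h
  simp only [smul_eq_mul] at h ⊢
  calc _ = _ := by
        refine integral_congr_ae (ae_of_all _ fun x => ?_)
        dsimp only
        rw [Real.Lp.fourierTransformInv_apply, mul_comm]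
        rfl
    _ = _ := h
    _ = _ := by simp_rw [mul_comm]

theorem fourier_laplacian (f : 𝓢'(ℝ, ℂ)) (φ : 𝓢(ℝ, ℂ)) :
    𝓕 (Δ f) φ = -(2 * Real.pi) ^ 2 * 𝓕 f (SchwartzMap.smulLeftCLM ℂ
      (fun x : ℝ => Complex.ofReal (‖x‖ ^ 2)) φ) := by
  rw [laplacian_eq_fourierMultiplierCLM, fourierMultiplierCLM_apply]
  simp

/-- The `H^s` norm as the `L²` norm of the weighted Fourier transform, by Plancherel. -/
theorem sobolevNorm_eq_enorm {s : ℝ} {f : 𝓢'(ℝ, ℂ)} {h : Lp ℂ 2 (volume : Measure ℝ)}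
    (hf : 𝓕 (besselPotential ℝ ℂ s f) = (h : 𝓢'(ℝ, ℂ))) : sobolevNorm s f = ‖h‖ₑ := by
  have hinj : Function.Injective (Lp.toTemperedDistributionCLM ℂ (volume : Measure ℝ) 2) :=
    LinearMap.ker_eq_bot.mp Lp.ker_toTemperedDistributionCLM_eq_bot
  have huniq : ∀ g : Lp ℂ 2 (volume : Measure ℝ),
      besselPotential ℝ ℂ s f = (g : 𝓢'(ℝ, ℂ)) → ‖g‖ₑ = ‖h‖ₑ := fun g hg => by
    rw [hg, Lp.fourier_toTemperedDistribution_eq] at hf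
    have : 𝓕 g = h := hinj hf
    rw [← this, ← ofReal_norm, ← ofReal_norm, Lp.norm_fourier_eq]
  have hex : besselPotential ℝ ℂ s f = ((𝓕⁻ h : Lp ℂ 2 (volume : Measure ℝ)) : 𝓢'(ℝ, ℂ)) := by
    rw [← Lp.fourierInv_toTemperedDistribution_eq, ← hf, fourierInv_fourier_eq]
  refine le_antisymm ?_ (le_iInf₂ fun g hg => (huniq g hg).ge)
  exact (iInf₂_le (𝓕⁻ h) hex).trans_eq (huniq _ hex)

theorem fourier_besselPotential_toDistribution_apply (s : ℝ) (a : Lp ℂ 1 (volume : Measure ℝ))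
    (φ : 𝓢(ℝ, ℂ)) :
    𝓕 (besselPotential ℝ ℂ s (toDistribution (Real.Lp.fourierTransformInv a))) φ
      = ∫ ξ, φ ξ * ((bracket s ξ : ℂ) * a ξ) := by
  rw [fourier_besselPotential_eq_smulLeftCLM_fourier_apply, fourier_toDistribution,
    TemperedDistribution.smulLeftCLM_apply_apply, Lp.toTemperedDistribution_apply]
  congr 1
  ext ξ
  rw [SchwartzMap.smulLeftCLM_apply_apply (by fun_prop), smul_eq_mul, smul_eq_mul, bracket]
  ring

theorem exists_fourier_besselPotential {s : ℝ} {u : 𝓢'(ℝ, ℂ)} (hu : MemSobolev s 2 u) :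
    ∃ g : Lp ℂ 2 (volume : Measure ℝ), 𝓕 (besselPotential ℝ ℂ s u) = (g : 𝓢'(ℝ, ℂ)) := by
  obtain ⟨g, hg⟩ := hu
  exact ⟨𝓕 g, by rw [hg, Lp.fourier_toTemperedDistribution_eq]⟩

/-- The `H^s` distance of a function in the Wiener algebra to an element of `H^s`, computed on the
Fourier side. -/
theorem sobolevNorm_toDistribution_sub {s : ℝ} {a : Lp ℂ 1 (volume : Measure ℝ)}
    {u : 𝓢'(ℝ, ℂ)} {g : Lp ℂ 2 (volume : Measure ℝ)}
    (hu : 𝓕 (besselPotential ℝ ℂ s u) = (g : 𝓢'(ℝ, ℂ)))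
    (h : MemLp (fun ξ => (bracket s ξ : ℂ) * a ξ - g ξ) 2 volume) :
    sobolevNorm s (toDistribution (Real.Lp.fourierTransformInv a) - u)
      = eLpNorm (fun ξ => (bracket s ξ : ℂ) * a ξ - g ξ) 2 volume := by
  have hba : MemLp (fun ξ => (bracket s ξ : ℂ) * a ξ) 2 volume := by
    convert h.add (Lp.memLp g) using 1
    ext ξ
    simp
  rw [sobolevNorm_eq_enorm (h := h.toLp _), Lp.enorm_toLp]
  ext φ
  have hφ : MemLp φ 2 volume := φ.memLp 2
  have e : ((h.toLp _ : Lp ℂ 2 (volume : Measure ℝ)) : 𝓢'(ℝ, ℂ)) φ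
      = ∫ ξ, φ ξ * ((bracket s ξ : ℂ) * a ξ - g ξ) := by
    rw [Lp.toTemperedDistribution_apply]
    refine integral_congr_ae ?_
    filter_upwards [h.coeFn_toLp] with ξ hξ
    rw [hξ, smul_eq_mul]
  have hsub : 𝓕 (besselPotential ℝ ℂ s (toDistribution (Real.Lp.fourierTransformInv a) - u))
      = 𝓕 (besselPotential ℝ ℂ s (toDistribution (Real.Lp.fourierTransformInv a)))
        - 𝓕 (besselPotential ℝ ℂ s u) := by
    rw [map_sub]
    exact map_sub (fourierCLM ℂ 𝓢'(ℝ, ℂ)) _ _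
  have hint : ∀ f : ℝ → ℂ, MemLp f 2 volume → Integrable (fun ξ => φ ξ * f ξ) volume :=
    fun f hf => hφ.integrable_mul hf
  change 𝓕 (besselPotential ℝ ℂ s (toDistribution (Real.Lp.fourierTransformInv a) - u)) φ
    = ((h.toLp _ : Lp ℂ 2 (volume : Measure ℝ)) : 𝓢'(ℝ, ℂ)) φ
  rw [e, hsub]
  change 𝓕 (besselPotential ℝ ℂ s (toDistribution (Real.Lp.fourierTransformInv a))) φ
    - 𝓕 (besselPotential ℝ ℂ s u) φ = _
  rw [fourier_besselPotential_toDistribution_apply, hu, Lp.toTemperedDistribution_apply]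
  simp only [mul_sub, smul_eq_mul]
  rw [integral_sub (hint _ hba) (hint _ (Lp.memLp g))]

theorem im_fourierInv_eq_zero {f : ℝ → ℂ} (hf : IsHermitianSymbol volume f) (x : ℝ) :
    (𝓕⁻ f x).im = 0 := by
  rw [← Complex.conj_eq_iff_im, Real.fourierInv_eq, ← integral_conj, ← integral_neg_eq_self]
  refine integral_congr_ae ?_
  filter_upwards [hf] with ξ hξ
  rw [hξ, Circle.smul_def, Circle.smul_def, smul_eq_mul, smul_eq_mul, map_mul, inner_neg_left,
    ← Circle.coe_inv_eq_conj, AddChar.map_neg_eq_inv, inv_inv]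

/-- The involution `φ ↦ conj (φ (-·))` of the Schwartz space. -/
noncomputable def schwartzConjNeg (φ : 𝓢(ℝ, ℂ)) : 𝓢(ℝ, ℂ) :=
  SchwartzMap.postcompCLM (Complex.conjCLE : ℂ →L[ℝ] ℂ)
    (SchwartzMap.compCLMOfContinuousLinearEquiv ℝ (ContinuousLinearEquiv.neg ℝ) φ)

theorem schwartzConjNeg_apply (φ : 𝓢(ℝ, ℂ)) (ξ : ℝ) :
    schwartzConjNeg φ ξ = (starRingEnd ℂ) (φ (-ξ)) := rfl

/-- The Fourier transform of a real-valued distribution is Hermitian. -/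
theorem isHermitianSymbol_of_isReal {s : ℝ} {u : 𝓢'(ℝ, ℂ)} {g : Lp ℂ 2 (volume : Measure ℝ)}
    (hu : 𝓕 (besselPotential ℝ ℂ s u) = (g : 𝓢'(ℝ, ℂ))) (hr : IsReal u) :
    IsHermitianSymbol volume (g : ℝ → ℂ) := by
  -- Hermitian test functions have real Fourier transforms, on which `u` is real.
  have him : ∀ φ : 𝓢(ℝ, ℂ), (∀ ξ, φ ξ = (starRingEnd ℂ) (φ (-ξ))) →
      ((g : 𝓢'(ℝ, ℂ)) φ).im = 0 := fun φ hφ => by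
    rw [← hu, fourier_besselPotential_eq_smulLeftCLM_fourier_apply,
      TemperedDistribution.smulLeftCLM_apply_apply, TemperedDistribution.fourier_apply]
    refine hr _ fun x => ?_
    rw [SchwartzMap.fourier_coe, ← neg_neg x, ← Real.fourierInv_eq_fourier_neg]
    refine im_fourierInv_eq_zero (ae_of_all _ fun ξ => ?_) _
    dsimp only
    rw [SchwartzMap.smulLeftCLM_apply_apply (by fun_prop),
      SchwartzMap.smulLeftCLM_apply_apply (by fun_prop), smul_eq_mul, smul_eq_mul, map_mul, ← hφ,
      Complex.conj_ofReal, norm_neg]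
  have hconj : ∀ φ : 𝓢(ℝ, ℂ), (g : 𝓢'(ℝ, ℂ)) (schwartzConjNeg φ)
      = (starRingEnd ℂ) ((g : 𝓢'(ℝ, ℂ)) φ) := fun φ => by
    have h₁ := him (φ + schwartzConjNeg φ) fun ξ => by
      simp [schwartzConjNeg_apply, add_comm]
    have h₂ := him (Complex.I • (φ - schwartzConjNeg φ)) fun ξ => by
      simp [schwartzConjNeg_apply]
      ring
    rw [map_add, Complex.add_im] at h₁
    rw [map_smul, map_sub, smul_eq_mul, Complex.I_mul_im, Complex.sub_re] at h₂
    apply Complex.ext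
    · rw [Complex.conj_re]; linarith
    · rw [Complex.conj_im]; linarith
  have hn := Measure.measurePreserving_neg (volume : Measure ℝ)
  have hg' : MemLp (fun ξ => (starRingEnd ℂ) (g (-ξ))) 2 (volume : Measure ℝ) :=
    ((Lp.memLp g).comp_measurePreserving hn).star
  have hinj : Function.Injective (Lp.toTemperedDistributionCLM ℂ (volume : Measure ℝ) 2) :=
    LinearMap.ker_eq_bot.mp Lp.ker_toTemperedDistributionCLM_eq_bot
  have key : g = hg'.toLp _ := hinj <| by
    ext φ
    change (g : 𝓢'(ℝ, ℂ)) φ = ((hg'.toLp _ : Lp ℂ 2 (volume : Measure ℝ)) : 𝓢'(ℝ, ℂ)) φ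
    have h := hconj φ
    rw [← Complex.conj_conj ((g : 𝓢'(ℝ, ℂ)) φ), ← h, Lp.toTemperedDistribution_apply,
      Lp.toTemperedDistribution_apply, ← integral_conj, ← integral_neg_eq_self]
    refine integral_congr_ae ?_
    filter_upwards [hg'.coeFn_toLp] with ξ hξ
    rw [hξ, schwartzConjNeg_apply, smul_eq_mul, smul_eq_mul, map_mul, Complex.conj_conj, neg_neg]
  have := hg'.coeFn_toLp
  rwa [← key] at this

/-- The equation, solved for `∂_t² u` on the Fourier side, in the sense of distributions. -/
theorem boussinesq_of_ae {k : ℕ} {a b : Lp ℂ 1 (volume : Measure ℝ)} {P : ℝ → ℂ}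
    (hP : Integrable P volume)
    (hPk : ∀ χ : ℝ → ℂ, Measurable χ → (∀ ξ, ‖χ ξ‖ = 1) → (∀ ξ η, χ (ξ + η) = χ ξ * χ η) →
      ∫ ξ, χ ξ * P ξ = (∫ ξ, χ ξ * a ξ) ^ k)
    (hb : b =ᵐ[volume] fun ξ => -(boussinesqSymbol ξ * (a ξ + P ξ))) :
    toDistribution (Real.Lp.fourierTransformInv b)
        - Δ (toDistribution (Real.Lp.fourierTransformInv a))
        - Δ (toDistribution (Real.Lp.fourierTransformInv b))
      = Δ (toDistribution (Real.Lp.fourierTransformInv a ^ k)) := by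
  have hpow : Real.Lp.fourierTransformInv a ^ k = Real.Lp.fourierTransformInv (hP.toL1 P) := by
    ext x
    have h := hPk (fun ξ => Real.fourierChar (inner ℝ ξ x)) (by fun_prop)
      (fun ξ => Circle.norm_coe _)
      (fun ξ η => by rw [inner_add_left, AddChar.map_add_eq_mul, Circle.coe_mul])
    rw [BoundedContinuousFunction.pow_apply, Real.Lp.fourierTransformInv_apply,
      Real.Lp.fourierTransformInv_apply, Real.fourierInv_congr_ae hP.coeFn_toL1, Real.fourierInv_eq,
      Real.fourierInv_eq]
    exact h.symm
  rw [hpow]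
  apply (fourierEquiv ℂ 𝓢'(ℝ, ℂ)).injective
  ext φ
  have hsub : ∀ f g : 𝓢'(ℝ, ℂ), 𝓕 (f - g) = 𝓕 f - 𝓕 g := map_sub (fourierCLM ℂ 𝓢'(ℝ, ℂ))
  change (𝓕 (_ - _ - _ : 𝓢'(ℝ, ℂ)) : 𝓢'(ℝ, ℂ)) φ = (𝓕 (Δ _ : 𝓢'(ℝ, ℂ)) : 𝓢'(ℝ, ℂ)) φ
  rw [hsub, hsub]
  change (𝓕 (_ : 𝓢'(ℝ, ℂ)) : 𝓢'(ℝ, ℂ)) φ - (𝓕 (Δ _ : 𝓢'(ℝ, ℂ)) : 𝓢'(ℝ, ℂ)) φ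
    - (𝓕 (Δ _ : 𝓢'(ℝ, ℂ)) : 𝓢'(ℝ, ℂ)) φ = _
  simp only [fourier_laplacian, fourier_toDistribution]
  set ψ := SchwartzMap.smulLeftCLM ℂ (fun x : ℝ => Complex.ofReal (‖x‖ ^ 2)) φ with hψ
  have hψφ : ∀ ξ, ψ ξ = (‖ξ‖ ^ 2 : ℝ) * φ ξ := fun ξ => by
    rw [hψ, SchwartzMap.smulLeftCLM_apply_apply (by fun_prop), smul_eq_mul]
  have hint : ∀ (χ : 𝓢(ℝ, ℂ)) (f : Lp ℂ 1 (volume : Measure ℝ)),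
      Integrable (fun ξ => χ ξ • f ξ) volume := fun χ f => by
    exact (L1.integrable_coeFn f).bdd_mul χ.continuous.aestronglyMeasurable
      (ae_of_all _ fun ξ => χ.toBoundedContinuousFunction.norm_coe_le_norm ξ)
  simp only [Lp.toTemperedDistribution_apply]
  have hsum : Integrable (fun ξ => ψ ξ • b ξ + ψ ξ • hP.toL1 P ξ) volume :=
    (hint _ _).add (hint _ _)
  have e : ∫ ξ, φ ξ • b ξ = ∫ ξ, -(2 * Real.pi : ℂ) ^ 2 *
      (ψ ξ • a ξ + (ψ ξ • b ξ + ψ ξ • hP.toL1 P ξ)) := by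
    refine integral_congr_ae ?_
    filter_upwards [hb, hP.coeFn_toL1] with ξ h₁ h₂
    rw [h₁, h₂, hψφ]
    have hm := boussinesqSymbol_mul ξ
    simp only [smul_eq_mul]
    push_cast
    linear_combination -(φ ξ) * (a ξ + P ξ) * hm
  rw [e, integral_const_mul, integral_add (hint _ _) hsum, integral_add (hint _ _) (hint _ _)]
  ring

/-- Norm inflation on the line. -/
theorem exists_norm_inflation {k : ℕ} (hk : 2 ≤ k) {s : ℝ} (θ : ℝ) (hs : s < 0)
    {u₀ u₁ : 𝓢'(ℝ, ℂ)} (hu₀ : MemSobolev s 2 u₀) (hu₁ : MemSobolev s 2 u₁) {ε : ℝ} (hε : 0 < ε) :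
    ∃ (T t : ℝ) (u v : ℝ → (ℝ →ᵇ ℂ)), IsSolution k T u v ∧
      (IsReal u₀ → IsReal u₁ → ∀ τ ∈ Icc 0 T, ∀ x, (u τ x).im = 0) ∧
      t ∈ Ioo 0 ε ∧ t ≤ T ∧
      sobolevNorm s (toDistribution (u 0) - u₀) + sobolevNorm s (toDistribution (v 0) - u₁)
        < ENNReal.ofReal ε ∧
      ENNReal.ofReal ε⁻¹ < sobolevNorm θ (toDistribution (u t)) ∧
      sobolevNorm θ (toDistribution (u t)) < ⊤ := by
  obtain ⟨g₀, hg₀⟩ := exists_fourier_besselPotential hu₀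
  obtain ⟨g₁, hg₁⟩ := exists_fourier_besselPotential hu₁
  have hc : ∀ ν, ‖Int.castAddHom ℝ ν‖ = |(ν : ℝ)| := fun ν => by simp
  obtain ⟨T, hT, U, V, W, hU, hV, hW, heq, hherm, hdata, hlow, hmem⟩ :=
    _root_.exists_norm_inflation (volume : Measure ℝ) (Int.castAddHom ℝ) hc
      measurable_boussinesqSymbol abs_boussinesqSymbol_le boussinesqSymbol_neg
      (m₀ := 1 / 2) (by norm_num) (fun ξ => le_boussinesqSymbol (by rw [hc]; simp)) hk θ hs
      (Lp.memLp g₀) (Lp.memLp g₁) hε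
  have hmeas : ∀ (a : Lp ℂ 1 (volume : Measure ℝ)) (g : Lp ℂ 2 (volume : Measure ℝ)),
      AEStronglyMeasurable (fun ξ => (bracket s ξ : ℂ) * a ξ - g ξ) volume := fun a g =>
    ((Complex.continuous_ofReal.comp (continuous_bracket s)).aestronglyMeasurable.mul
      (Lp.aestronglyMeasurable a)).sub (Lp.aestronglyMeasurable g)
  have hlt := ENNReal.add_lt_top.mp (hdata.trans ENNReal.ofReal_lt_top)
  have hθ : sobolevNorm θ (toDistribution (Real.Lp.fourierTransformInv (U T)))
      = eLpNorm (fun ξ => (bracket θ ξ : ℂ) * U T ξ) 2 volume := by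
    have h0 : 𝓕 (besselPotential ℝ ℂ θ (0 : 𝓢'(ℝ, ℂ)))
        = ((0 : Lp ℂ 2 (volume : Measure ℝ)) : 𝓢'(ℝ, ℂ)) := by
      rw [map_zero, ← Lp.toTemperedDistributionCLM_apply, map_zero]
      exact map_zero (fourierCLM ℂ 𝓢'(ℝ, ℂ))
    have e : (fun ξ => (bracket θ ξ : ℂ) * U T ξ - (0 : Lp ℂ 2 (volume : Measure ℝ)) ξ)
        =ᵐ[volume] fun ξ => (bracket θ ξ : ℂ) * U T ξ := by
      filter_upwards [Lp.coeFn_zero ℂ 2 (volume : Measure ℝ)] with ξ h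
      rw [h, Pi.zero_apply, sub_zero]
    have := sobolevNorm_toDistribution_sub (a := U T) h0 (hmem.ae_eq e.symm)
    rwa [sub_zero, eLpNorm_congr_ae e] at this
  refine ⟨T, T, fun t => Real.Lp.fourierTransformInv (U t),
    fun t => Real.Lp.fourierTransformInv (V t),
    ⟨hT.1, U, V, W, fun _ _ => rfl, fun _ _ => rfl, hU, hV, hW, fun t _ => ?_⟩, ?_, hT, le_rfl,
    ?_, ?_, ?_⟩
  · obtain ⟨P, hP, hPk, hWt⟩ := heq t
    exact boussinesq_of_ae hP hPk hWt
  · intro hr₀ hr₁ t ht x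
    rw [Real.Lp.fourierTransformInv_apply]
    exact im_fourierInv_eq_zero (hherm (isHermitianSymbol_of_isReal hg₀ hr₀)
      (isHermitianSymbol_of_isReal hg₁ hr₁) t ht) x
  · rwa [sobolevNorm_toDistribution_sub hg₀ ⟨hmeas _ _, hlt.1⟩,
      sobolevNorm_toDistribution_sub hg₁ ⟨hmeas _ _, hlt.2⟩]
  · rwa [hθ]
  · rw [hθ]
    exact hmem.2

end Line

/-! ### From the Fourier side to the torus -/

instance : (Measure.count : Measure ℤ).IsAddHaarMeasure where
  lt_top_of_isCompact _ hK := Measure.count_apply_lt_top.mpr hK.finite_of_discrete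
  open_pos _ _ hne := Measure.count_ne_zero hne

theorem integral_count_eq_tsum {f : ℤ → ℂ} (hf : Integrable f Measure.count) :
    ∫ n, f n ∂Measure.count = ∑' n, f n := by
  rw [integral_countable hf]
  simp

namespace Torus

/-- The identification of `L¹` for the counting measure on `ℤ` with `ℓ¹(ℤ)`. -/
noncomputable def toLpOne : Lp ℂ 1 (Measure.count : Measure ℤ) →L[ℝ] lp (fun _ : ℤ => ℂ) 1 :=
  have hs : ∀ a : Lp ℂ 1 (Measure.count : Measure ℤ), Summable fun n => ‖a n‖ := fun a =>
    integrable_count_iff.mp (L1.integrable_coeFn a)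
  LinearMap.mkContinuous
    { toFun := fun a => ⟨fun n => a n, memℓp_gen (by simpa using hs a)⟩
      map_add' := fun a b => by
        ext n
        exact Measure.ae_count_iff.mp (Lp.coeFn_add a b) n
      map_smul' := fun c a => by
        ext n
        exact Measure.ae_count_iff.mp (Lp.coeFn_smul c a) n }
    1 fun a => by
      rw [one_mul, lp.norm_eq_tsum_rpow (by norm_num), L1.norm_eq_integral_norm,
        integral_countable (L1.integrable_coeFn a).norm]
      simp

theorem toLpOne_apply (a : Lp ℂ 1 (Measure.count : Measure ℤ)) (n : ℤ) : toLpOne a n = a n := rfl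

theorem summable_norm (a : lp (fun _ : ℤ => ℂ) 1) : Summable fun n => ‖a n‖ := by
  simpa using (memℓp_gen_iff (by norm_num)).mp (lp.memℓp a)

theorem norm_fourier_apply (n : ℤ) (x : UnitAddCircle) : ‖(fourier n x : ℂ)‖ = 1 :=
  Circle.norm_coe _

theorem hasSum_fourierSeries (a : lp (fun _ : ℤ => ℂ) 1) (x : UnitAddCircle) :
    HasSum (fun n => a n * fourier n x) (fourierSeries a x) := by
  have h : HasSum (fun n : ℤ => a n • (fourier n : C(UnitAddCircle, ℂ))) (fourierSeries a) := by
    refine (Summable.of_norm ?_).hasSum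
    simpa only [norm_smul, fourier_norm, mul_one] using summable_norm a
  exact (ContinuousMap.evalCLM ℂ x).hasSum h

/-- Fourier series may be tested term by term. -/
theorem hasSum_toDistribution_fourierSeries (a : lp (fun _ : ℤ => ℂ) 1) (φ : TestFunction) :
    HasSum (fun n => a n * (toDistribution (fourier n)).1 φ)
      ((toDistribution (fourierSeries a)).1 φ) := by
  have hcont : ∀ f : C(UnitAddCircle, ℂ), Continuous fun x : ℝ => f (x : UnitAddCircle) := fun f =>
    f.continuous.comp (AddCircle.continuous_mk' 1)
  have hφ : Continuous φ.1 := φ.2.1.continuous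
  have h := intervalIntegral.hasSum_integral_of_dominated_convergence (μ := volume)
    (a := 0) (b := 1)
    (F := fun n x => a n * (φ.1 x * fourier n (x : UnitAddCircle)))
    (f := fun x => φ.1 x * fourierSeries a (x : UnitAddCircle)) (fun n x => ‖a n‖ * ‖φ.1 x‖)
    (fun n => (continuous_const.mul (hφ.mul (hcont _))).aestronglyMeasurable)
    (fun n => ae_of_all _ fun x _ => by
      rw [norm_mul, norm_mul, norm_fourier_apply, mul_one])
    (ae_of_all _ fun x _ => (summable_norm a).mul_right _)
    (by
      simp_rw [tsum_mul_right]
      exact (continuous_const.mul hφ.norm).intervalIntegrable _ _)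
    (ae_of_all _ fun x _ => by
      have := (hasSum_fourierSeries a (x : UnitAddCircle)).mul_left (φ.1 x)
      simpa only [mul_left_comm] using this)
  simp only [intervalIntegral.integral_const_mul] at h
  exact h

/-- Integration by parts. -/
theorem toDistribution_fourier_deriv (n : ℤ) (φ : TestFunction) :
    (toDistribution (fourier n)).1 (TestFunction.deriv φ)
      = -(2 * Real.pi * Complex.I * n) * (toDistribution (fourier n)).1 φ := by
  have hd : ∀ x, HasDerivAt φ.1 (deriv φ.1 x) x := fun x =>
    (φ.2.1.differentiable (by simp) x).hasDerivAt
  have he : ∀ x : ℝ, HasDerivAt (fun x : ℝ => fourier n (x : UnitAddCircle))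
      (2 * Real.pi * Complex.I * n * fourier n (x : UnitAddCircle)) x := fun x => by
    simpa using hasDerivAt_fourier 1 n x
  have hec : Continuous fun x : ℝ => (fourier n (x : UnitAddCircle) : ℂ) :=
    (fourier n).continuous.comp (AddCircle.continuous_mk' 1)
  have h := intervalIntegral.integral_deriv_mul_eq_sub (a := 0) (b := 1) (fun x _ => hd x)
    (fun x _ => he x) ((contDiff_infty_iff_deriv.mp φ.2.1).2.continuous.intervalIntegrable _ _)
    ((continuous_const.mul hec).intervalIntegrable _ _)
  have hper : φ.1 1 = φ.1 0 := by simpa using φ.2.2 0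
  have hper' : ((1 : ℝ) : UnitAddCircle) = ((0 : ℝ) : UnitAddCircle) := by
    simp
  have hi₁ : IntervalIntegrable (fun x => deriv φ.1 x * fourier n (x : UnitAddCircle)) volume 0 1 :=
    ((contDiff_infty_iff_deriv.mp φ.2.1).2.continuous.mul hec).intervalIntegrable _ _
  have hi₂ : IntervalIntegrable (fun x => φ.1 x *
      (2 * Real.pi * Complex.I * n * fourier n (x : UnitAddCircle))) volume 0 1 :=
    (φ.2.1.continuous.mul (continuous_const.mul hec)).intervalIntegrable _ _
  rw [hper, hper', sub_self, intervalIntegral.integral_add hi₁ hi₂] at h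
  have e : ∫ x in (0 : ℝ)..1, φ.1 x * (2 * Real.pi * Complex.I * n * fourier n (x : UnitAddCircle))
      = 2 * Real.pi * Complex.I * n * ∫ x in (0 : ℝ)..1, φ.1 x * fourier n (x : UnitAddCircle) := by
    rw [← intervalIntegral.integral_const_mul]
    simp only [mul_left_comm]
  rw [e] at h
  change ∫ x in (0 : ℝ)..1, deriv φ.1 x * fourier n (x : UnitAddCircle)
    = -(2 * Real.pi * Complex.I * n) * ∫ x in (0 : ℝ)..1, φ.1 x * fourier n (x : UnitAddCircle)
  linear_combination h

theorem distDeriv_distDeriv_apply (L : Distribution) (φ : TestFunction) :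
    (distDeriv (distDeriv L)).1 φ = L.1 (TestFunction.deriv (TestFunction.deriv φ)) := by
  simp [distDeriv]

theorem deriv_character (n : ℤ) :
    TestFunction.deriv (character n) = (2 * Real.pi * Complex.I * n) • character n := by
  apply Subtype.ext
  funext x
  change deriv (fun x : ℝ => Complex.exp (2 * Real.pi * Complex.I * n * x)) x =
    2 * Real.pi * Complex.I * n * Complex.exp (2 * Real.pi * Complex.I * n * x)
  have h : HasDerivAt (fun x : ℝ => 2 * Real.pi * Complex.I * n * (x : ℂ))
      (2 * Real.pi * Complex.I * n * 1) x := (Complex.ofRealCLM.hasDerivAt (x := x)).const_mul _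
  rw [h.cexp.deriv]
  ring

theorem toDistribution_fourier_character (m n : ℤ) :
    (toDistribution (fourier m)).1 (character (-n)) = if m = n then 1 else 0 := by
  split_ifs with h
  · subst h
    change ∫ x in (0 : ℝ)..1, Complex.exp (2 * Real.pi * Complex.I * (-m : ℤ) * x)
      * fourier m (x : UnitAddCircle) = 1
    rw [intervalIntegral.integral_congr (g := fun _ => (1 : ℂ))]
    · simp
    · intro x _
      dsimp only
      rw [fourier_coe_apply, ← Complex.exp_add, ← Complex.exp_zero]
      congr 1
      push_cast
      ring
  · have h₁ := toDistribution_fourier_deriv m (character (-n))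
    rw [deriv_character, map_smul, smul_eq_mul] at h₁
    have h₂ : (2 * Real.pi * Complex.I * (m - n : ℂ))
        * (toDistribution (fourier m)).1 (character (-n)) = 0 := by
      push_cast at h₁
      linear_combination h₁
    refine (mul_eq_zero.mp h₂).resolve_left ?_
    have h₃ : (m - n : ℂ) ≠ 0 := sub_ne_zero.mpr (by exact_mod_cast h)
    simp [Real.pi_ne_zero, h₃]

theorem fourierCoeff_toDistribution_fourierSeries (a : lp (fun _ : ℤ => ℂ) 1) (n : ℤ) :
    fourierCoeff (toDistribution (fourierSeries a)) n = a n := by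
  refine (hasSum_toDistribution_fourierSeries a (character (-n))).unique ?_
  convert hasSum_ite_eq n (a n) using 2 with m
  rw [toDistribution_fourier_character]
  split_ifs with h
  · rw [h, mul_one]
  · rw [mul_zero]

theorem sobolevNorm_eq_eLpNorm (s : ℝ) (L : Distribution) :
    sobolevNorm s L
      = eLpNorm (fun n : ℤ => (bracket s n : ℂ) * fourierCoeff L n) 2 Measure.count := by
  rw [eLpNorm_eq_lintegral_rpow_enorm_toReal (by norm_num) (by norm_num), lintegral_count,
    sobolevNorm]
  congr 1
  refine tsum_congr fun n => ?_
  rw [← ofReal_norm, ENNReal.ofReal_rpow_of_nonneg (norm_nonneg _) (by norm_num)]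
  congr 1
  rw [norm_mul, Complex.norm_real, Real.norm_of_nonneg (bracket_pos _ _).le, bracket,
    Int.norm_eq_abs, sq_abs, Real.mul_rpow (by positivity) (by positivity),
    ← Real.rpow_mul (by positivity)]
  norm_num

theorem memLp_bracket_mul_fourierCoeff {s : ℝ} {L : Distribution} (h : sobolevNorm s L < ⊤) :
    MemLp (fun n : ℤ => (bracket s n : ℂ) * fourierCoeff L n) 2 Measure.count :=
  ⟨(measurable_of_countable _).aestronglyMeasurable, sobolevNorm_eq_eLpNorm s L ▸ h⟩

theorem sobolevNorm_toDistribution_sub (s : ℝ) (a : lp (fun _ : ℤ => ℂ) 1) (L : Distribution) :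
    sobolevNorm s (toDistribution (fourierSeries a) - L)
      = eLpNorm (fun n : ℤ => (bracket s n : ℂ) * a n - bracket s n * fourierCoeff L n) 2
          Measure.count := by
  rw [sobolevNorm_eq_eLpNorm]
  congr 1
  ext n
  rw [← fourierCoeff_toDistribution_fourierSeries a n, ← mul_sub]
  rfl

/-- The Fourier coefficients of a real-valued distribution are Hermitian. -/
theorem isHermitianSymbol_of_isReal {s : ℝ} {L : Distribution} (hL : IsReal L) :
    IsHermitianSymbol Measure.count fun n : ℤ => (bracket s n : ℂ) * fourierCoeff L n := by
  refine ae_of_all _ fun n => ?_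
  have hconj : ∀ (m : ℤ) (x : ℝ),
      (character (-m)).1 x = (starRingEnd ℂ) ((character m).1 x) := fun m x => by
    change Complex.exp _ = (starRingEnd ℂ) (Complex.exp _)
    rw [← Complex.exp_conj]
    simp [map_ofNat]
  have h₁ := hL (character n + character (-n)) fun x => by
    change ((character n).1 x + (character (-n)).1 x).im = 0
    rw [hconj]
    simp
  have h₂ := hL (Complex.I • (character n - character (-n))) fun x => by
    change (Complex.I * ((character n).1 x - (character (-n)).1 x)).im = 0
    rw [hconj]
    simp
  rw [map_add, Complex.add_im] at h₁
  rw [map_smul, map_sub, smul_eq_mul, Complex.I_mul_im, Complex.sub_re] at h₂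
  dsimp only
  rw [bracket_neg, map_mul, Complex.conj_ofReal, fourierCoeff, fourierCoeff, neg_neg]
  congr 1
  apply Complex.ext
  · rw [Complex.conj_re]; linarith
  · rw [Complex.conj_im]; linarith

theorem im_fourierSeries_eq_zero {a : lp (fun _ : ℤ => ℂ) 1}
    (ha : ∀ n, a n = (starRingEnd ℂ) (a (-n))) (x : UnitAddCircle) :
    (fourierSeries a x).im = 0 := by
  rw [← Complex.conj_eq_iff_im]
  have h := hasSum_fourierSeries a x
  have h' := ((Equiv.neg ℤ).hasSum_iff.mpr h).map (starRingEnd ℂ) Complex.continuous_conj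
  refine h'.unique ?_
  convert h using 1
  ext n
  simp only [Function.comp_apply, Equiv.neg_apply, map_mul]
  rw [← ha, fourier_neg, Complex.conj_conj]

/-- The equation, solved for `∂_t² u` on the Fourier side, in the sense of distributions. -/
theorem boussinesq_of_ae {k : ℕ} {a b : lp (fun _ : ℤ => ℂ) 1} {P : ℤ → ℂ}
    (hP : Integrable P Measure.count)
    (hPk : ∀ χ : ℤ → ℂ, Measurable χ → (∀ ξ, ‖χ ξ‖ = 1) → (∀ ξ η, χ (ξ + η) = χ ξ * χ η) →
      ∫ ξ, χ ξ * P ξ ∂Measure.count = (∫ ξ, χ ξ * a ξ ∂Measure.count) ^ k)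
    (hb : ∀ n, b n = -(boussinesqSymbol n * (a n + P n))) :
    toDistribution (fourierSeries b) - distDeriv (distDeriv (toDistribution (fourierSeries a)))
        - distDeriv (distDeriv (toDistribution (fourierSeries b)))
      = distDeriv (distDeriv (toDistribution (fourierSeries a ^ k))) := by
  let c : lp (fun _ : ℤ => ℂ) 1 := ⟨P, memℓp_gen (by simpa using integrable_count_iff.mp hP)⟩
  have hint : ∀ (d : lp (fun _ : ℤ => ℂ) 1) (x : UnitAddCircle),
      ∫ n : ℤ, (fourier n x : ℂ) * d n ∂Measure.count = fourierSeries d x := fun d x => by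
    have hd : Integrable (fun n : ℤ => (fourier n x : ℂ) * d n) Measure.count :=
      integrable_count_iff.mpr (by
        simpa only [norm_mul, norm_fourier_apply, one_mul] using summable_norm d)
    rw [integral_count_eq_tsum hd, ← (hasSum_fourierSeries d x).tsum_eq]
    simp only [mul_comm]
  have hpow : fourierSeries a ^ k = fourierSeries c := by
    ext x
    have h := hPk (fun n => (fourier n x : ℂ)) (measurable_of_countable _)
      (fun n => Circle.norm_coe _) fun m n => fourier_add
    rw [ContinuousMap.pow_apply, ← hint a x, ← h]
    exact hint c x
  rw [hpow]
  apply Subtype.ext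
  ext φ
  change (toDistribution (fourierSeries b)).1 φ
    - (distDeriv (distDeriv (toDistribution (fourierSeries a)))).1 φ
    - (distDeriv (distDeriv (toDistribution (fourierSeries b)))).1 φ = _
  simp only [distDeriv_distDeriv_apply]
  rw [← sub_eq_zero]
  set ψ := TestFunction.deriv (TestFunction.deriv φ) with hψ
  have h := (((hasSum_toDistribution_fourierSeries b φ).sub
    (hasSum_toDistribution_fourierSeries a ψ)).sub
    (hasSum_toDistribution_fourierSeries b ψ)).sub (hasSum_toDistribution_fourierSeries c ψ)
  refine h.unique ?_
  convert hasSum_zero using 1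
  ext n
  have hm := boussinesqSymbol_mul n
  have hn : ((‖n‖ : ℝ) : ℂ) ^ 2 = (n : ℂ) ^ 2 := by
    rw [Int.norm_eq_abs, ← Complex.ofReal_pow, sq_abs]
    simp
  have hI := Complex.I_sq
  rw [hn] at hm
  change b n * _ - a n * _ - b n * _ - P n * _ = 0
  rw [hψ, toDistribution_fourier_deriv, toDistribution_fourier_deriv, hb]
  set z := (toDistribution (fourier n)).1 φ
  linear_combination (-(a n + P n) * z) * hm
    - ((a n + P n) * z * (2 * Real.pi * n) ^ 2 * (1 - boussinesqSymbol n)) * hI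

/-- Norm inflation on the torus. -/
theorem exists_norm_inflation {k : ℕ} (hk : 2 ≤ k) {s : ℝ} (θ : ℝ) (hs : s < 0)
    {u₀ u₁ : Distribution} (hu₀ : sobolevNorm s u₀ < ⊤) (hu₁ : sobolevNorm s u₁ < ⊤) {ε : ℝ}
    (hε : 0 < ε) :
    ∃ (T t : ℝ) (u v : ℝ → C(UnitAddCircle, ℂ)), IsSolution k T u v ∧
      (IsReal u₀ → IsReal u₁ → ∀ τ ∈ Icc 0 T, ∀ x, (u τ x).im = 0) ∧
      t ∈ Ioo 0 ε ∧ t ≤ T ∧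
      sobolevNorm s (toDistribution (u 0) - u₀) + sobolevNorm s (toDistribution (v 0) - u₁)
        < ENNReal.ofReal ε ∧
      ENNReal.ofReal ε⁻¹ < sobolevNorm θ (toDistribution (u t)) ∧
      sobolevNorm θ (toDistribution (u t)) < ⊤ := by
  have hc : ∀ ν : ℤ, ‖AddMonoidHom.id ℤ ν‖ = |(ν : ℝ)| := fun ν => Int.norm_eq_abs ν
  obtain ⟨T, hT, U, V, W, hU, hV, hW, heq, hherm, hdata, hlow, hmem⟩ :=
    _root_.exists_norm_inflation (Measure.count : Measure ℤ) (AddMonoidHom.id ℤ) hc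
      measurable_boussinesqSymbol abs_boussinesqSymbol_le boussinesqSymbol_neg
      (m₀ := 1 / 2) (by norm_num) (fun ξ => le_boussinesqSymbol (by rw [hc]; simp)) hk θ hs
      (memLp_bracket_mul_fourierCoeff hu₀) (memLp_bracket_mul_fourierCoeff hu₁) hε
  have hderiv : ∀ {X X' : ℝ → Lp ℂ 1 (Measure.count : Measure ℤ)},
      (∀ t ∈ Icc 0 T, HasDerivWithinAt X (X' t) (Icc 0 T) t) →
      ∀ t ∈ Icc 0 T, HasDerivWithinAt (fun t => toLpOne (X t)) (toLpOne (X' t)) (Icc 0 T) t :=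
    fun h t ht => toLpOne.hasFDerivAt.comp_hasDerivWithinAt t (h t ht)
  have hθ : sobolevNorm θ (toDistribution (fourierSeries (toLpOne (U T))))
      = eLpNorm (fun n : ℤ => (bracket θ n : ℂ) * U T n) 2 Measure.count := by
    rw [sobolevNorm_eq_eLpNorm]
    simp only [fourierCoeff_toDistribution_fourierSeries, toLpOne_apply]
  refine ⟨T, T, fun t => fourierSeries (toLpOne (U t)), fun t => fourierSeries (toLpOne (V t)),
    ⟨hT.1, fun t => toLpOne (U t), fun t => toLpOne (V t), fun t => toLpOne (W t),
      fun _ _ => rfl, fun _ _ => rfl, hderiv hU, hderiv hV,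
      toLpOne.continuous.comp_continuousOn hW, fun t _ => ?_⟩, ?_, hT, le_rfl, ?_, ?_, ?_⟩
  · obtain ⟨P, hP, hPk, hWt⟩ := heq t
    refine boussinesq_of_ae hP ?_ ?_
    · simpa only [toLpOne_apply] using hPk
    · simpa only [toLpOne_apply] using Measure.ae_count_iff.mp hWt
  · intro hr₀ hr₁ t ht x
    refine im_fourierSeries_eq_zero ?_ x
    simpa only [toLpOne_apply] using Measure.ae_count_iff.mp
      (hherm (isHermitianSymbol_of_isReal hr₀) (isHermitianSymbol_of_isReal hr₁) t ht)
  · rw [sobolevNorm_toDistribution_sub, sobolevNorm_toDistribution_sub]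
    simpa only [toLpOne_apply] using hdata
  · rwa [hθ]
  · rw [hθ]
    exact hmem.2

end Torus

theorem theorem1p3 (k : ℕ) (hk : 2 ≤ k) (s θ : ℝ) (hs : s < 0) :
    (∀ u₀ u₁ : 𝓢'(ℝ, ℂ),
      TemperedDistribution.MemSobolev s 2 u₀ → TemperedDistribution.MemSobolev s 2 u₁ →
      ∀ ε : ℝ, 0 < ε → ∃ (T t : ℝ) (u v : ℝ → (ℝ →ᵇ ℂ)),
        Line.IsSolution k T u v ∧
        (Line.IsReal u₀ → Line.IsReal u₁ → ∀ τ ∈ Icc 0 T, ∀ x, (u τ x).im = 0) ∧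
        t ∈ Ioo 0 ε ∧ t ≤ T ∧
        Line.sobolevNorm s (Line.toDistribution (u 0) - u₀)
          + Line.sobolevNorm s (Line.toDistribution (v 0) - u₁) < ENNReal.ofReal ε ∧
        ENNReal.ofReal ε⁻¹ < Line.sobolevNorm θ (Line.toDistribution (u t)) ∧
        Line.sobolevNorm θ (Line.toDistribution (u t)) < ⊤) ∧
    (∀ u₀ u₁ : Torus.Distribution,
      Torus.sobolevNorm s u₀ < ⊤ → Torus.sobolevNorm s u₁ < ⊤ →
      ∀ ε : ℝ, 0 < ε → ∃ (T t : ℝ) (u v : ℝ → C(UnitAddCircle, ℂ)),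
        Torus.IsSolution k T u v ∧
        (Torus.IsReal u₀ → Torus.IsReal u₁ → ∀ τ ∈ Icc 0 T, ∀ x, (u τ x).im = 0) ∧
        t ∈ Ioo 0 ε ∧ t ≤ T ∧
        Torus.sobolevNorm s (Torus.toDistribution (u 0) - u₀)
          + Torus.sobolevNorm s (Torus.toDistribution (v 0) - u₁) < ENNReal.ofReal ε ∧
        ENNReal.ofReal ε⁻¹ < Torus.sobolevNorm θ (Torus.toDistribution (u t)) ∧
        Torus.sobolevNorm θ (Torus.toDistribution (u t)) < ⊤) :=
  ⟨fun _ _ hu₀ hu₁ _ hε => Line.exists_norm_inflation hk θ hs hu₀ hu₁ hε,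
    fun _ _ hu₀ hu₁ _ hε => Torus.exists_norm_inflation hk θ hs hu₀ hu₁ hε⟩
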